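/- **Setting.** $M\ge 1$ agents interact for $T\ge1$ episodes, each with its own copy of the same episodic MDP with measurable state space $\mathcal S$, finite action set $\mathcal A$, horizon $H\ge1$, transition kernels $\mathbb P_h$ and deterministic rewards $r_h:\mathcal S\times\mathcal A\to[0,1]$. The MDP is linear: there are a measurable feature map $\phi:\mathcal S\times\mathcal A\to\mathbb R^d$ with $\|\phi\|_2\le1$ and, for each $h\in[H]$, signed measures $\mu_h=(\mu_h^1,\dots,\mu_h^d)$ on $\mathcal S$ and $\theta_h\in\mathbb R^d$ with $\mathbb P_h(\cdot\mid x,a)=\langle\phi(x,a),\mu_h(\cdot)\rangle$, $r_h(x,a)=\langle\phi(x,a),\theta_h\rangle$, $\|\theta_h\|_2\le\sqrt d$ and $\|\mu_h(B)\|_2\le\sqrt d$ for every measurable $B\subseteq\mathcal S$. The initial states $x^t_{m,1}$ are chosen arbitrarily by the environment (possibly depending on all earlier episodes); given the past, the agents' transitions are independent. **Algorithm** (inputs $\lambda>0$, threshold $S\ge0$, bonuses $\beta_t$). Let $k_t$ be the number of episodes completed at the last synchronization before episode $t$ ($k_1=0$). In episode $t$ the data available to agent $m$ at step $h$ are the transitions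 $(x,a,x')$ made at step $h$ by all agents in episodes $1,\dots,k_t$ and by agent $m$ itself in episodes $k_t+1,\dots,t-1$. Put $V^t_{m,H+1}=0$ and, for $h=H,\dots,1$, summing over the available data, $$\Lambda^t_{m,h}=\lambda I+\sum\phi(x,a)\phi(x,a)^\top,\qquad w^t_{m,h}=(\Lambda^t_{m,h})^{-1}\sum\phi(x,a)\,\bigl[r_h(x,a)+V^t_{m,h+1}(x')\bigr],$$ $$Q^t_{m,h}(z)=\min\Bigl\{\phi(z)^\top w^t_{m,h}+\beta_t\sqrt{\phi(z)^\top(\Lambda^t_{m,h})^{-1}\phi(z)},\ H-h+1\Bigr\},\qquad V^t_{m,h}(x)=\max_aQ^t_{m,h}(x,a).$$ Agent $m$ follows the policy $\pi_{m,t}$ that is greedy with respect to $Q^t_{m,h}$. All agents synchronize (share all data) at the end of episode $t$, i.e. $k_{t+1}=t$, if for some agent $m$ and step $h$ $$\log\frac{\det(G_h+\delta G_{m,h}+\lambda I)}{\det(G_h+\lambda I)}>\frac{S}{t-k_t},$$ where $G_h=\sum\phi\phi^\top$ over all agents' step-$h$ data of episodes $1,\dots,k_t$ and $\delta G_{m,h}=\sum\phi\phi^\top$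 over agent $m$'s own step-$h$ data of episodes $k_t+1,\dots,t$; otherwise $k_{t+1}=k_t$. The group regret is $$\mathfrak R(T)=\sum_{m=1}^M\sum_{t=1}^T\bigl[V^\star_1(x^t_{m,1})-V_1^{\pi_{m,t}}(x^t_{m,1})\bigr],$$ where $V^\pi_1(x)$ is the expected total reward of one episode of policy $\pi$ started at $x$ and $V^\star_1=\sup_\pi V^\pi_1$. **Theorem.** There are absolute constants $c_0>0$ and $p\in\mathbb N$ such that for every $c\ge c_0$ there are a constant $C$ and constants $C'_{s}$ ($s\in\mathbb R$), depending only on $c$ (and, for $C'_{s}$, on $s$), for which the following holds for all $d,M,H,T\ge1$, $\alpha\in(0,1)$, $S\ge0$ and every homogeneous linear MDP as above. If the algorithm is run with $\lambda=1$ and any deterministic $\beta_t$ with $$c_0\,dH\sqrt{\log(2dMHt/\alpha)}\ \le\ \beta_t\ \le\ c\,dH\sqrt{\log(2dMHT/\alpha)}\qquad(1\le t\le T),$$ then with probability at least $1-\alpha$ $$\mathfrak R(T)\le C\,dH^2\Bigl(dM\sqrt{\max\{1,S\}}+\sqrt{dMT}\Bigr)\sqrt{\log(2/\alpha)}\;\log^p(2dMHT).$$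 Moreover, for every $s_0$, if $S\le s_0$ and $dM\le T$, then with probability at least $1-\alpha$ $$\mathfrak R(T)\le C'_{s_0}\,d^{3/2}H^2\sqrt{MT}\,\sqrt{\log(2/\alpha)}\;\log^p(2dMHT),$$ the centralized rate. -/

import Mathlib

open MeasureTheory ProbabilityTheory

namespace CoopLSVI

/-- A finite-horizon Markov decision process on measurable spaces of states and actions.
Steps are numbered `0, …, H - 1` (mathematically `1, …, H`); what happens at indices `h ≥ H`
is irrelevant. -/
structure EpisodicMDP (S A : Type*) [MeasurableSpace S] [MeasurableSpace A] (H : ℕ) where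
  /-- transition probabilities -/
  P : ℕ → Kernel (S × A) S
  markov : ∀ h, IsMarkovKernel (P h)
  /-- deterministic rewards -/
  r : ℕ → S × A → ℝ
  measurable_r : ∀ h, Measurable (r h)
  r_mem : ∀ h, h < H → ∀ z, r h z ∈ Set.Icc (0 : ℝ) 1

/-- A (Markov, possibly randomized) policy: at each step a Markov kernel from states to actions. -/
structure Policy (S A : Type*) [MeasurableSpace S] [MeasurableSpace A] where
  kernel : ℕ → Kernel S A
  markov : ∀ h, IsMarkovKernel (kernel h)

section Values

variable {S A : Type*} [MeasurableSpace S] [MeasurableSpace A] {H : ℕ}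

/-- The law of the state-action trajectory of `n` steps, starting at step `h` in the given state,
when actions are drawn from the policy: draw an action, move to the next state, continue. -/
noncomputable def trajLaw (mdp : EpisodicMDP S A H) (π : Policy S A) :
    (n : ℕ) → (h : ℕ) → Kernel S (Fin n → S × A)
  | 0, _ => Kernel.const S (Measure.dirac Fin.elim0)
  | n + 1, h =>
      ((Kernel.id ×ₖ π.kernel h) ⊗ₖ
        Kernel.prodMkLeft S (trajLaw mdp π n (h + 1) ∘ₖ mdp.P h)).map
        (fun p => (Fin.cons p.1 p.2 : Fin (n + 1) → S × A))

/-- `V^π_h(x)`: the expected total reward collected from step `h` to the end of the episode. -/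
noncomputable def value (mdp : EpisodicMDP S A H) (π : Policy S A) (h : ℕ) (x : S) : ℝ :=
  ∫ τ, ∑ i : Fin (H - h), mdp.r (h + i) (τ i) ∂(trajLaw mdp π (H - h) h x)

/-- `V^⋆_h(x) = sup_π V^π_h(x)`. -/
noncomputable def optValue (mdp : EpisodicMDP S A H) (h : ℕ) (x : S) : ℝ :=
  ⨆ π : Policy S A, value mdp π h x

/-- The MDP is linear in the feature map `φ`. Here `μ = (μ¹, …, μᵈ)` is a vector of signed
measures, with its size controlled on every measurable set. -/
structure IsLinear {d : ℕ} (mdp : EpisodicMDP S A H) (φ : S × A → EuclideanSpace ℝ (Fin d)) :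
    Prop where
  measurable_feature : Measurable φ
  norm_feature_le : ∀ z, ‖φ z‖ ≤ 1
  linear : ∀ h, h < H → ∃ (μ : Fin d → SignedMeasure S) (θ : EuclideanSpace ℝ (Fin d)),
    (∀ z B, MeasurableSet B → (mdp.P h z).real B = ∑ i, φ z i * μ i B) ∧
    (∀ z, mdp.r h z = inner ℝ (φ z) θ) ∧
    (∀ B, MeasurableSet B → ‖WithLp.toLp 2 (fun i => μ i B)‖ ≤ √(d : ℝ)) ∧
    ‖θ‖ ≤ √(d : ℝ)

end Values

/-- What the algorithm is given: horizon, feature map, ridge parameter `λ`, synchronization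
threshold, bonus multipliers `β^t_{m,h}` (arguments `t m h`), the rewards it observes, and the
rule by which ties in an `argmax` over actions are broken. -/
structure Input (S A : Type*) (d M : ℕ) where
  horizon : ℕ
  feature : S × A → EuclideanSpace ℝ (Fin d)
  ridge : ℝ
  threshold : ℝ
  bonus : ℕ → Fin M → ℕ → ℝ
  reward : ℕ → S × A → ℝ
  select : (A → ℝ) → A

/-- The states and actions met so far, by episode, step and agent. Episodes are numbered from `0`,
so "before episode `t`" means episodes `0, …, t - 1`. -/
structure Record (S A : Type*) (M : ℕ) where
  state : ℕ → ℕ → Fin M → S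
  action : ℕ → ℕ → Fin M → A

section Algorithm

variable {S A : Type*} {d M : ℕ}

/-- The state-action pair of agent `m` at step `h` of episode `t`. -/
def Record.pair (R : Record S A M) (t h : ℕ) (m : Fin M) : S × A :=
  (R.state t h m, R.action t h m)

/-- The sum of `f (episode) (agent)` over the transitions available to agent `m` before episode `t`
when the last synchronization took place after the first `k` episodes: the first `k` episodes of
all agents, and the later episodes of agent `m` itself. -/
def dataSum {E : Type*} [AddCommMonoid E] (k t : ℕ) (m : Fin M) (f : ℕ → Fin M → E) : E :=
  (∑ τ ∈ Finset.range k, ∑ n, f τ n) + ∑ τ ∈ Finset.Ico k t, f τ m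

/-- The regularized covariance matrix of the available features at step `h`. -/
noncomputable def gram (I : Input S A d M) (R : Record S A M) (h : ℕ) (m : Fin M) (k t : ℕ) :
    Matrix (Fin d) (Fin d) ℝ :=
  dataSum k t m (fun τ n => Matrix.vecMulVec (I.feature (R.pair τ h n)).ofLp
    (I.feature (R.pair τ h n)).ofLp) + I.ridge • (1 : Matrix (Fin d) (Fin d) ℝ)

/-- The synchronization test during episode `t`, when `k` episodes had been completed at the last
synchronization: some agent, at some step, sees its log-determinant ratio exceed
`threshold / Δt`, with `Δt` the number of episodes since that synchronization, the present one
included. -/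
def Triggered (I : Input S A d M) (R : Record S A M) (k t : ℕ) : Prop :=
  ∃ m : Fin M, ∃ h < I.horizon,
    I.threshold / ((t : ℝ) + 1 - (k : ℝ)) <
      Real.log ((gram I R h m k (t + 1)).det / (gram I R h m k k).det)

open Classical in
/-- The number of episodes completed at the last synchronization before episode `t`. -/
noncomputable def syncTime (I : Input S A d M) (R : Record S A M) : ℕ → ℕ
  | 0 => 0
  | t + 1 => if Triggered I R (syncTime I R t) t then t + 1 else syncTime I R t

/-- `Λ^t_{m,h}`. -/
noncomputable def cov (I : Input S A d M) (R : Record S A M) (t h : ℕ) (m : Fin M) :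
    Matrix (Fin d) (Fin d) ℝ :=
  gram I R h m (syncTime I R t) t

/-- The ridge regression weights `(Λ^t_{m,h})⁻¹ u^t_{m,h}` for the targets `r_h + V(x')`. -/
noncomputable def weights (I : Input S A d M) (R : Record S A M) (t h : ℕ) (m : Fin M)
    (V : S → ℝ) : Fin d → ℝ :=
  Matrix.mulVec (cov I R t h m)⁻¹
    (dataSum (syncTime I R t) t m (fun τ n =>
      (I.reward h (R.pair τ h n) + V (R.state τ (h + 1) n)) • (I.feature (R.pair τ h n)).ofLp))

/-- The optimistic, truncated value of the pair `z` for parameters `(w, Λ, β)`. -/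
noncomputable def ucb (φ : S × A → EuclideanSpace ℝ (Fin d)) (w : Fin d → ℝ)
    (Λ : Matrix (Fin d) (Fin d) ℝ) (β cap : ℝ) (z : S × A) : ℝ :=
  min ((φ z).ofLp ⬝ᵥ w + β * √((φ z).ofLp ⬝ᵥ Matrix.mulVec Λ⁻¹ (φ z).ofLp)) cap

/-- One backward step: the action values at step `h` from the value function `V` at step `h + 1`. -/
noncomputable def qStep (I : Input S A d M) (R : Record S A M) (t h : ℕ) (m : Fin M)
    (V : S → ℝ) : S × A → ℝ :=
  ucb I.feature (weights I R t h m V) (cov I R t h m) (I.bonus t m h)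
    ((I.horizon : ℝ) - (h : ℝ))

/-- `V^t_{m,h}` with `j = H - h` steps to go. -/
noncomputable def estValue (I : Input S A d M) (R : Record S A M) (t : ℕ) (m : Fin M) :
    (j : ℕ) → S → ℝ
  | 0 => fun _ => 0
  | j + 1 => fun s =>
      ⨆ a : A, qStep I R t (I.horizon - (j + 1)) m (estValue I R t m j) (s, a)

/-- `Q^t_{m,h}`. -/
noncomputable def estQ (I : Input S A d M) (R : Record S A M) (t h : ℕ) (m : Fin M) :
    S × A → ℝ :=
  qStep I R t h m (estValue I R t m (I.horizon - (h + 1)))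

/-- The greedy action of agent `m` at step `h` of episode `t` in state `s`. -/
noncomputable def greedy (I : Input S A d M) (R : Record S A M) (t h : ℕ) (m : Fin M) (s : S) : A :=
  I.select (fun a => estQ I R t h m (s, a))

variable [MeasurableSpace S] [MeasurableSpace A]

/-- The input of the algorithm when all agents face copies of `mdp`. -/
def mkInput {H : ℕ} (mdp : EpisodicMDP S A H) (φ : S × A → EuclideanSpace ℝ (Fin d))
    (ridge threshold : ℝ) (bonus : ℕ → Fin M → ℕ → ℝ) (select : (A → ℝ) → A) : Input S A d M where
  horizon := H
  feature := φ
  ridge := ridge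
  threshold := threshold
  bonus := bonus
  reward := mdp.r
  select := select

theorem measurable_ucb {φ : S × A → EuclideanSpace ℝ (Fin d)} (hφ : Measurable φ)
    (w : Fin d → ℝ) (Λ : Matrix (Fin d) (Fin d) ℝ) (β cap : ℝ) :
    Measurable (ucb φ w Λ β cap) := by
  have h1 : ∀ i, Measurable fun z => (φ z).ofLp i := fun i => by fun_prop
  unfold ucb
  simp only [dotProduct, Matrix.mulVec]
  fun_prop

theorem measurable_greedy {I : Input S A d M} (hφ : Measurable I.feature)
    (hsel : Measurable I.select) (R : Record S A M) (t h : ℕ) (m : Fin M) :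
    Measurable (greedy I R t h m) := by
  refine hsel.comp (measurable_pi_lambda _ fun a => ?_)
  exact (measurable_ucb hφ _ _ _ _).comp measurable_prodMk_right

/-- The policy that agent `m` follows in episode `t`. -/
noncomputable def greedyPolicy (I : Input S A d M) (hφ : Measurable I.feature)
    (hsel : Measurable I.select) (R : Record S A M) (t : ℕ) (m : Fin M) : Policy S A where
  kernel h := Kernel.deterministic (greedy I R t h m) (measurable_greedy hφ hsel R t h m)
  markov _ := inferInstance

/-- The cumulative group regret of the first `T` episodes. -/
noncomputable def groupRegret {H : ℕ} (mdp : EpisodicMDP S A H) (I : Input S A d M)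
    (hφ : Measurable I.feature) (hsel : Measurable I.select) (R : Record S A M) (T : ℕ) : ℝ :=
  ∑ m, ∑ t ∈ Finset.range T,
    (optValue mdp 0 (R.state t 0 m) - value mdp (greedyPolicy I hφ hsel R t m) 0 (R.state t 0 m))

end Algorithm

/-- The interaction of `M` agents, each running the algorithm in its own copy of the MDP, for `T`
episodes. `ℱ (t, h)` is what has happened when the states at step `h` of episode `t` are revealed.
The initial states of an episode are arbitrary: they may depend on everything that happened in
earlier episodes, and on extra randomness. Given the past, the agents move independently according
to the transition probabilities. -/
structure IsRun {S A Ω : Type*} [MeasurableSpace S] [MeasurableSpace A] [mΩ : MeasurableSpace Ω]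
    {d M H : ℕ} (mdp : EpisodicMDP S A H) (I : Input S A d M) (T : ℕ) (μ : Measure Ω)
    (ℱ : Filtration (ℕ ×ₗ ℕ) mΩ) (R : Ω → Record S A M) : Prop where
  adapted : ∀ t < T, ∀ h ≤ H, Measurable[ℱ (toLex (t, h))] (fun ω => (R ω).state t h)
  acts : ∀ t < T, ∀ h < H, ∀ m ω,
    (R ω).action t h m = greedy I (R ω) t h m ((R ω).state t h m)
  moves : ∀ t < T, ∀ h < H, ∀ B : Set (Fin M → S), MeasurableSet B →
    μ[Set.indicator {ω | (R ω).state t (h + 1) ∈ B} (fun _ => (1 : ℝ)) | ℱ (toLex (t, h))]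
      =ᵐ[μ] fun ω => (Measure.pi fun m => mdp.P h ((R ω).pair t h m)).real B

end CoopLSVI

/-! The proof combines optimism, a uniform concentration bound for the regressions, and an
accounting of exploration widths over the epochs between synchronizations.

Optimism. Suppose that in episode `t` every regression reproduces the true Bellman backup of the
estimated next value up to `β t` times the exploration width. Backward induction then shows that the
estimates dominate the values of all policies (`GridBound.optimism`). Comparing the estimate with
the value of the greedy policy, each step loses at most twice the bonus plus a martingale difference
(`GridBound.gap_le`), so the regret is at most the sum of `2 β` times the widths, plus a bounded
martingale controlled by Hoeffding's inequality (`IsRun.measure_gap_noise_le`).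

Concentration. In a linear MDP the backup is exactly linear in the features
(`IsLinear.exists_backup`), so the regression error is a ridge bias plus averaged transition noise.
The regression target is computed from the same data, hence is not predictable. It does belong to a
family parametrized by a weight vector and an inverse covariance matrix with bounded entries. For a
fixed direction, a fixed target and a fixed synchronization time, the noise has an exponential
supermartingale (`IsRun.lintegral_exp_le_one`), in which the agents are independent given the past.
A union bound over a grid of directions, weights and matrices, and over all agents, steps and
possible synchronization times (`IsRun.measure_not_gridBound_le`), followed by rounding
(`sum_le_of_grid`), covers the actual data. The logarithm of the grid size is of order `d²` up to
logarithms, which is why a bonus of order `d H √log` is enough (`exists_calibrated`).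

Widths. Let the potential be the log-determinant of the covariance of all agents' data; it never
exceeds `d log (1 + M T)`. In an epoch where it grows by at most one, the covariance at the start of
the epoch already controls the widths as in the centralized algorithm (`sum_width_le_of_small`). In
any other epoch the failed synchronization tests bound each agent's total width by `√(2 S) + 1`
(`sum_width_le_of_not_triggered`), and this cost is charged to the growth of the potential. Adding
up gives `sum_width_le`, and balancing its free parameter gives the rate. -/

namespace CoopLSVI

/-! ### Values of policies and the Bellman equation -/

section Bellman

theorem measurable_integral_kernel {X Y : Type*} {mX : MeasurableSpace X} [MeasurableSpace Y]
    (κ : Kernel X Y) [IsSFiniteKernel κ] {f : X × Y → ℝ} (hf : Measurable f) :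
    Measurable fun x => ∫ y, f (x, y) ∂(κ x) :=
  (hf.stronglyMeasurable.integral_kernel_prod_right' (κ := κ)).measurable

variable {S A : Type*} [MeasurableSpace S] [MeasurableSpace A] {H : ℕ}

instance isMarkovKernel_trajLaw (mdp : EpisodicMDP S A H) (π : Policy S A) (n h : ℕ) :
    IsMarkovKernel (trajLaw mdp π n h) := by
  induction n generalizing h with
  | zero => unfold trajLaw; infer_instance
  | succ n ih =>
    unfold trajLaw
    have := mdp.markov h
    have := π.markov h
    have := ih (h + 1)
    refine Kernel.IsMarkovKernel.map _ ?_
    refine measurable_pi_lambda _ fun i => ?_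
    refine Fin.cases ?_ (fun j => ?_) i
    · simpa using measurable_fst
    · simpa using by fun_prop

/-- The expected total reward of `n` steps starting at step `h`. -/
noncomputable def stepsValue (mdp : EpisodicMDP S A H) (π : Policy S A) (n h : ℕ) (x : S) : ℝ :=
  ∫ τ, ∑ i : Fin n, mdp.r (h + i) (τ i) ∂(trajLaw mdp π n h x)

theorem value_eq_stepsValue (mdp : EpisodicMDP S A H) (π : Policy S A) (h : ℕ) (x : S) :
    value mdp π h x = stepsValue mdp π (H - h) h x := rfl

variable (mdp : EpisodicMDP S A H) (π : Policy S A)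

theorem measurable_rewardSum (n h : ℕ) :
    Measurable fun τ : Fin n → S × A => ∑ i : Fin n, mdp.r (h + i) (τ i) :=
  Finset.measurable_sum _ fun i _ => (mdp.measurable_r _).comp (measurable_pi_apply i)

theorem rewardSum_mem (n h : ℕ) (hn : h + n ≤ H) (τ : Fin n → S × A) :
    ∑ i : Fin n, mdp.r (h + i) (τ i) ∈ Set.Icc (0 : ℝ) n := by
  have key : ∀ i : Fin n, mdp.r (h + i) (τ i) ∈ Set.Icc (0 : ℝ) 1 := fun i =>
    mdp.r_mem _ (by omega) _
  refine ⟨Finset.sum_nonneg fun i _ => (key i).1, ?_⟩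
  refine (Finset.sum_le_card_nsmul _ _ 1 fun i _ => (key i).2).trans ?_
  simp

theorem integrable_of_mem_Icc {X : Type*} [MeasurableSpace X] {ν : Measure X} [IsFiniteMeasure ν]
    {f : X → ℝ} (hf : Measurable f) {a b : ℝ} (hab : ∀ x, f x ∈ Set.Icc a b) : Integrable f ν :=
  Integrable.of_mem_Icc a b hf.aemeasurable (Filter.Eventually.of_forall hab)

theorem integral_mem_Icc {X : Type*} [MeasurableSpace X] {ν : Measure X} [IsProbabilityMeasure ν]
    {f : X → ℝ} (hf : Measurable f) {a b : ℝ} (hab : ∀ x, f x ∈ Set.Icc a b) :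
    ∫ x, f x ∂ν ∈ Set.Icc a b := by
  have hi := integrable_of_mem_Icc (ν := ν) hf hab
  constructor
  · simpa using integral_mono (integrable_const a) hi fun x => (hab x).1
  · simpa using integral_mono hi (integrable_const b) fun x => (hab x).2

theorem measurable_stepsValue (n h : ℕ) : Measurable (stepsValue mdp π n h) := by
  exact measurable_integral_kernel (trajLaw mdp π n h)
    ((measurable_rewardSum mdp n h).comp measurable_snd)

theorem stepsValue_mem (n h : ℕ) (hn : h + n ≤ H) (x : S) :
    stepsValue mdp π n h x ∈ Set.Icc (0 : ℝ) n :=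
  integral_mem_Icc (measurable_rewardSum mdp n h) (rewardSum_mem mdp n h hn)

/-- The trajectory law is the image of a composition product: first the pair at step `h`, then the
remaining trajectory given that pair. Integrating in this order splits off the first reward;
boundedness of the rewards supplies the integrability. -/
theorem stepsValue_succ (n h : ℕ) (hn : h + (n + 1) ≤ H) (x : S) :
    stepsValue mdp π (n + 1) h x =
      ∫ a, (mdp.r h (x, a) + ∫ y, stepsValue mdp π n (h + 1) y ∂(mdp.P h (x, a)))
        ∂(π.kernel h x) := by
  have := mdp.markov h
  have := π.markov h
  have hcons : Measurable
      (fun p : (S × A) × (Fin n → S × A) => (Fin.cons p.1 p.2 : Fin (n + 1) → S × A)) := by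
    refine measurable_pi_lambda _ fun i => ?_
    refine Fin.cases ?_ (fun j => ?_) i
    · simpa using measurable_fst
    · simpa using by fun_prop
  have hF : Measurable (fun p : (S × A) × (Fin n → S × A) =>
      mdp.r h p.1 + ∑ i : Fin n, mdp.r (h + 1 + i) (p.2 i)) :=
    ((mdp.measurable_r h).comp measurable_fst).add
      ((measurable_rewardSum mdp n (h + 1)).comp measurable_snd)
  have hFb : ∀ p : (S × A) × (Fin n → S × A),
      mdp.r h p.1 + ∑ i : Fin n, mdp.r (h + 1 + i) (p.2 i) ∈ Set.Icc (0 : ℝ) (1 + n) := fun p => by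
    have h1 := mdp.r_mem h (by omega) p.1
    have h2 := rewardSum_mem mdp n (h + 1) (by omega) p.2
    exact ⟨add_nonneg h1.1 h2.1, add_le_add h1.2 h2.2⟩
  have hq : Measurable fun z : S × A =>
      mdp.r h z + ∫ y, stepsValue mdp π n (h + 1) y ∂(mdp.P h z) := by
    refine (mdp.measurable_r h).add ?_
    exact measurable_integral_kernel (mdp.P h)
      ((measurable_stepsValue mdp π n (h + 1)).comp measurable_snd)
  unfold stepsValue
  rw [trajLaw, Kernel.map_apply _ hcons, integral_map hcons.aemeasurable
    (measurable_rewardSum mdp (n + 1) h).aestronglyMeasurable]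
  have hsum : ∀ p : (S × A) × (Fin n → S × A),
      (∑ i : Fin (n + 1), mdp.r (h + i) ((Fin.cons p.1 p.2 : Fin (n + 1) → S × A) i)) =
        mdp.r h p.1 + ∑ i : Fin n, mdp.r (h + 1 + i) (p.2 i) := fun p => by
    rw [Fin.sum_univ_succ]
    simp [add_assoc, add_comm 1]
  simp_rw [hsum]
  rw [ProbabilityTheory.integral_compProd (integrable_of_mem_Icc hF hFb)]
  have inner : ∀ z : S × A,
      ∫ τ, (mdp.r h z + ∑ i : Fin n, mdp.r (h + 1 + i) (τ i))
        ∂((Kernel.prodMkLeft S (trajLaw mdp π n (h + 1) ∘ₖ mdp.P h)) (x, z)) =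
      mdp.r h z + ∫ y, stepsValue mdp π n (h + 1) y ∂(mdp.P h z) := fun z => by
    have hi := integrable_of_mem_Icc (ν := (trajLaw mdp π n (h + 1) ∘ₖ mdp.P h) z)
        (measurable_rewardSum mdp n (h + 1)) (rewardSum_mem mdp n (h + 1) (by omega))
    rw [Kernel.prodMkLeft_apply, integral_add (integrable_const _) hi, Kernel.integral_comp hi]
    simp [stepsValue]
  simp_rw [inner]
  rw [Kernel.prod_apply, Kernel.id_apply, Measure.dirac_prod, integral_map (by fun_prop)
    hq.aestronglyMeasurable]
  rfl

theorem value_mem (h : ℕ) (hh : h ≤ H) (x : S) :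
    value mdp π h x ∈ Set.Icc (0 : ℝ) ((H : ℝ) - h) := by
  have := stepsValue_mem mdp π (H - h) h (by omega) x
  rwa [Nat.cast_sub hh] at this

theorem measurable_value (h : ℕ) : Measurable (value mdp π h) :=
  measurable_stepsValue mdp π (H - h) h

theorem value_horizon (x : S) : value mdp π H x = 0 := by
  have := value_mem mdp π H le_rfl x
  simpa using this

theorem measurable_integral_transition {f : S → ℝ} (hf : Measurable f) (h : ℕ) :
    Measurable fun z : S × A => ∫ y, f y ∂(mdp.P h z) := by
  have := mdp.markov h
  exact measurable_integral_kernel (mdp.P h) (hf.comp measurable_snd)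

/-- The Bellman equation. -/
theorem value_eq_integral (h : ℕ) (hh : h < H) (x : S) :
    value mdp π h x =
      ∫ a, (mdp.r h (x, a) + ∫ y, value mdp π (h + 1) y ∂(mdp.P h (x, a))) ∂(π.kernel h x) := by
  obtain ⟨n, rfl⟩ : ∃ n, H = h + (n + 1) := ⟨H - h - 1, by omega⟩
  simp only [value_eq_stepsValue]
  rw [show h + (n + 1) - h = n + 1 by omega, show h + (n + 1) - (h + 1) = n by omega]
  exact stepsValue_succ mdp π n h le_rfl x

theorem measurable_bellman (h : ℕ) : Measurable fun z : S × A =>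
    mdp.r h z + ∫ y, value mdp π (h + 1) y ∂(mdp.P h z) :=
  (mdp.measurable_r h).add (measurable_integral_transition mdp (measurable_value mdp π _) h)

/-- A value is at most any bound on the Bellman targets of all actions. -/
theorem value_le_of_forall (h : ℕ) (hh : h < H) (x : S) (b : ℝ)
    (hb : ∀ a, mdp.r h (x, a) + ∫ y, value mdp π (h + 1) y ∂(mdp.P h (x, a)) ≤ b) :
    value mdp π h x ≤ b := by
  have := mdp.markov h
  have := π.markov h
  rw [value_eq_integral mdp π h hh]
  have hb0 : ∀ a, mdp.r h (x, a) + ∫ y, value mdp π (h + 1) y ∂(mdp.P h (x, a)) ∈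
      Set.Icc (0 : ℝ) b := fun a => by
    refine ⟨add_nonneg (mdp.r_mem h hh _).1 ?_, hb a⟩
    exact integral_nonneg fun y => (value_mem mdp π (h + 1) hh y).1
  exact (integral_mem_Icc ((measurable_bellman mdp π h).comp measurable_prodMk_left) hb0).2

theorem value_of_deterministic [MeasurableSingletonClass A] (h : ℕ) (hh : h < H) (x : S)
    {g : S → A} (hg : Measurable g) (hπ : π.kernel h = Kernel.deterministic g hg) :
    value mdp π h x =
      mdp.r h (x, g x) + ∫ y, value mdp π (h + 1) y ∂(mdp.P h (x, g x)) := by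
  rw [value_eq_integral mdp π h hh, hπ, Kernel.deterministic_apply, integral_dirac]

end Bellman
-- Regularized Gram matrices, their inverses and determinants
section LinearAlgebra

open Matrix

set_option linter.unusedSectionVars false

variable {ι n : Type*} [Fintype n] [DecidableEq n]

/-- The identity plus the Gram matrix of a finite family of vectors. -/
noncomputable def regGram (s : Finset ι) (v : ι → n → ℝ) : Matrix n n ℝ :=
  ∑ i ∈ s, vecMulVec (v i) (v i) + 1

theorem posSemidef_sum_vecMulVec (s : Finset ι) (v : ι → n → ℝ) :
    (∑ i ∈ s, vecMulVec (v i) (v i)).PosSemidef :=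
  posSemidef_sum _ fun i _ => by simpa using posSemidef_vecMulVec_self_star (v i)

theorem regGram_posDef (s : Finset ι) (v : ι → n → ℝ) : (regGram s v).PosDef :=
  PosDef.posSemidef_add (posSemidef_sum_vecMulVec s v) PosDef.one

theorem regGram_det_pos (s : Finset ι) (v : ι → n → ℝ) : 0 < (regGram s v).det :=
  (regGram_posDef s v).det_pos

theorem regGram_isUnit_det (s : Finset ι) (v : ι → n → ℝ) : IsUnit (regGram s v).det :=
  isUnit_iff_ne_zero.2 (regGram_det_pos s v).ne'

theorem regGram_mulVec (s : Finset ι) (v : ι → n → ℝ) (x : n → ℝ) :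
    regGram s v *ᵥ x = ∑ i ∈ s, (v i ⬝ᵥ x) • v i + x := by
  rw [regGram, add_mulVec, one_mulVec, sum_mulVec]
  congr 1
  refine Finset.sum_congr rfl fun i _ => ?_
  rw [vecMulVec_mulVec]
  ext j; simp [mul_comm]

theorem dotProduct_regGram_mulVec (s : Finset ι) (v : ι → n → ℝ) (x y : n → ℝ) :
    x ⬝ᵥ (regGram s v *ᵥ y) = ∑ i ∈ s, (x ⬝ᵥ v i) * (v i ⬝ᵥ y) + x ⬝ᵥ y := by
  rw [regGram_mulVec, dotProduct_add, dotProduct_sum]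
  congr 1
  refine Finset.sum_congr rfl fun i _ => ?_
  rw [dotProduct_smul, smul_eq_mul, mul_comm]

theorem regGram_mulVec_inv (s : Finset ι) (v : ι → n → ℝ) (x : n → ℝ) :
    regGram s v *ᵥ ((regGram s v)⁻¹ *ᵥ x) = x := by
  rw [mulVec_mulVec, mul_nonsing_inv _ (regGram_isUnit_det s v), one_mulVec]

theorem regGram_inv_mulVec (s : Finset ι) (v : ι → n → ℝ) (x : n → ℝ) :
    (regGram s v)⁻¹ *ᵥ (regGram s v *ᵥ x) = x := by
  rw [mulVec_mulVec, nonsing_inv_mul _ (regGram_isUnit_det s v), one_mulVec]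

theorem regGram_inv_comm (s : Finset ι) (v : ι → n → ℝ) (x y : n → ℝ) :
    x ⬝ᵥ ((regGram s v)⁻¹ *ᵥ y) = ((regGram s v)⁻¹ *ᵥ x) ⬝ᵥ y := by
  have h : ((regGram s v)⁻¹)ᵀ = (regGram s v)⁻¹ := by
    have h := (regGram_posDef s v).inv.isHermitian
    rwa [IsHermitian, conjTranspose_eq_transpose_of_trivial] at h
  rw [dotProduct_mulVec, ← mulVec_transpose, h]

/-- The quadratic form of the inverse, in terms of the preimage of the vector. -/
theorem dotProduct_regGram_inv (s : Finset ι) (v : ι → n → ℝ) (x : n → ℝ) :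
    x ⬝ᵥ ((regGram s v)⁻¹ *ᵥ x) =
      ∑ i ∈ s, (((regGram s v)⁻¹ *ᵥ x) ⬝ᵥ v i) ^ 2 +
        ((regGram s v)⁻¹ *ᵥ x) ⬝ᵥ ((regGram s v)⁻¹ *ᵥ x) := by
  have h := dotProduct_regGram_mulVec s v ((regGram s v)⁻¹ *ᵥ x) ((regGram s v)⁻¹ *ᵥ x)
  rw [regGram_mulVec_inv, dotProduct_comm] at h
  rw [h]
  congr 1
  refine Finset.sum_congr rfl fun i _ => ?_
  rw [dotProduct_comm (v i), sq]

theorem dotProduct_self_nonneg' (x : n → ℝ) : 0 ≤ x ⬝ᵥ x :=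
  Finset.sum_nonneg fun i _ => mul_self_nonneg (x i)

theorem dotProduct_sq_le (x y : n → ℝ) : (x ⬝ᵥ y) ^ 2 ≤ (x ⬝ᵥ x) * (y ⬝ᵥ y) := by
  have := Finset.sum_mul_sq_le_sq_mul_sq Finset.univ x y
  simpa [dotProduct, sq] using this

theorem regGram_inv_quad_nonneg (s : Finset ι) (v : ι → n → ℝ) (x : n → ℝ) :
    0 ≤ x ⬝ᵥ ((regGram s v)⁻¹ *ᵥ x) := by
  rw [dotProduct_regGram_inv]
  exact add_nonneg (Finset.sum_nonneg fun i _ => sq_nonneg _) (dotProduct_self_nonneg' _)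

theorem regGram_inv_mulVec_sq_le (s : Finset ι) (v : ι → n → ℝ) (x : n → ℝ) :
    ((regGram s v)⁻¹ *ᵥ x) ⬝ᵥ ((regGram s v)⁻¹ *ᵥ x) ≤ x ⬝ᵥ ((regGram s v)⁻¹ *ᵥ x) := by
  rw [dotProduct_regGram_inv s v x]
  linarith [Finset.sum_nonneg fun i (_ : i ∈ s) =>
    sq_nonneg (((regGram s v)⁻¹ *ᵥ x) ⬝ᵥ v i)]

/-- With `u` the inverse applied to `x`, Cauchy–Schwarz gives `(x ⬝ᵥ u)² ≤ |x|² |u|²`, and `|u|² ≤ x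
⬝ᵥ u`; then one factor `x ⬝ᵥ u` cancels. -/
theorem regGram_inv_quad_le (s : Finset ι) (v : ι → n → ℝ) (x : n → ℝ) :
    x ⬝ᵥ ((regGram s v)⁻¹ *ᵥ x) ≤ x ⬝ᵥ x := by
  have h1 := dotProduct_sq_le x ((regGram s v)⁻¹ *ᵥ x)
  have h2 := regGram_inv_mulVec_sq_le s v x
  have h0 := regGram_inv_quad_nonneg s v x
  have hx := dotProduct_self_nonneg' x
  rcases h0.eq_or_lt with h | h
  · rw [← h]; exact hx
  · have h3 := mul_le_mul_of_nonneg_left h2 hx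
    nlinarith

theorem regGram_inv_mulVec_le (s : Finset ι) (v : ι → n → ℝ) (x : n → ℝ) :
    ((regGram s v)⁻¹ *ᵥ x) ⬝ᵥ ((regGram s v)⁻¹ *ᵥ x) ≤ x ⬝ᵥ x :=
  (regGram_inv_mulVec_sq_le s v x).trans (regGram_inv_quad_le s v x)

/-- The inverse contracts the Euclidean norm, so its columns have norm at most one. This puts
inverse covariances into the cube that the grid discretizes. -/
theorem abs_regGram_inv_entry_le (s : Finset ι) (v : ι → n → ℝ) (i j : n) :
    |(regGram s v)⁻¹ i j| ≤ 1 := by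
  have h := regGram_inv_mulVec_le s v (Pi.single j 1)
  have h1 : ((regGram s v)⁻¹ i j) ^ 2 ≤ 1 := by
    calc ((regGram s v)⁻¹ i j) ^ 2
        = (((regGram s v)⁻¹ *ᵥ Pi.single j 1) i) * (((regGram s v)⁻¹ *ᵥ Pi.single j 1) i) := by
          simp [sq]
      _ ≤ ((regGram s v)⁻¹ *ᵥ Pi.single j 1) ⬝ᵥ ((regGram s v)⁻¹ *ᵥ Pi.single j 1) :=
          Finset.single_le_sum (f := fun k => (((regGram s v)⁻¹ *ᵥ Pi.single j 1) k) *
            (((regGram s v)⁻¹ *ᵥ Pi.single j 1) k)) (fun k _ => mul_self_nonneg _)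
            (Finset.mem_univ i)
      _ ≤ 1 := by simpa using h
  exact (sq_le_one_iff_abs_le_one _).1 h1

/-- Adding vectors to the family decreases the quadratic form of the inverse. -/
theorem regGram_inv_antitone {s t : Finset ι} (hst : s ⊆ t) (v : ι → n → ℝ) (x : n → ℝ) :
    x ⬝ᵥ ((regGram t v)⁻¹ *ᵥ x) ≤ x ⬝ᵥ ((regGram s v)⁻¹ *ᵥ x) := by
  set u := (regGram t v)⁻¹ *ᵥ x with hu
  -- Completing the square: nonnegativity of the inverse form of `s` at `x - regGram s v *ᵥ u`
  -- bounds that form at `x` from below by `2 x·u - u·(regGram s v) u`, and the subtracted term is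
  -- at most `x·u`.
  have h1 := regGram_inv_quad_nonneg s v (x - regGram s v *ᵥ u)
  rw [mulVec_sub, regGram_inv_mulVec, sub_dotProduct, dotProduct_sub, dotProduct_sub,
    dotProduct_comm (regGram s v *ᵥ u) ((regGram s v)⁻¹ *ᵥ x), ← regGram_inv_comm,
    regGram_inv_mulVec, dotProduct_comm (regGram s v *ᵥ u) u, dotProduct_regGram_mulVec] at h1
  have h2 : x ⬝ᵥ u = ∑ i ∈ t, (u ⬝ᵥ v i) ^ 2 + u ⬝ᵥ u := dotProduct_regGram_inv t v x
  have h3 : ∑ i ∈ s, (u ⬝ᵥ v i) * (v i ⬝ᵥ u) ≤ ∑ i ∈ t, (u ⬝ᵥ v i) ^ 2 := by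
    simp_rw [dotProduct_comm (v _) u, ← sq]
    exact Finset.sum_le_sum_of_subset_of_nonneg hst fun i _ _ => sq_nonneg _
  linarith

theorem regGram_insert [DecidableEq ι] {s : Finset ι} {i : ι} (hi : i ∉ s) (v : ι → n → ℝ) :
    regGram (insert i s) v = regGram s v + vecMulVec (v i) (v i) := by
  rw [regGram, Finset.sum_insert hi, regGram]; abel

/-- The matrix determinant lemma for a rank-one update. -/
theorem regGram_det_insert [DecidableEq ι] {s : Finset ι} {i : ι} (hi : i ∉ s)
    (v : ι → n → ℝ) :
    (regGram (insert i s) v).det =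
      (regGram s v).det * (1 + v i ⬝ᵥ ((regGram s v)⁻¹ *ᵥ v i)) := by
  rw [regGram_insert hi, vecMulVec_eq Unit,
    det_add_replicateCol_mul_replicateRow (regGram_isUnit_det s v)]
  congr 1
  rw [det_unique, dotProduct_mulVec]
  simp only [Matrix.add_apply, one_apply_eq, Matrix.mul_apply, replicateRow_apply,
    replicateCol_apply, dotProduct, vecMul]

/-- The factored characteristic polynomial evaluated at `-1`; the signs on both sides agree and
cancel. -/
theorem det_one_add_eq_prod {X : Matrix n n ℝ} (hX : X.IsHermitian) :
    (1 + X).det = ∏ i, (1 + hX.eigenvalues i) := by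
  have h := congrArg (Polynomial.eval (-1)) hX.charpoly_eq
  rw [Polynomial.eval_prod, eval_charpoly] at h
  simp only [Polynomial.eval_sub, Polynomial.eval_X, Polynomial.eval_C] at h
  have e1 : (scalar n (-1 : ℝ)) - X = -(1 + X) := by
    ext i j; simp [scalar_apply, diagonal, one_apply]; split_ifs <;> ring
  have e2 : ∀ i, (-1 : ℝ) - ((hX.eigenvalues i : ℝ)) = (-1) * (1 + hX.eigenvalues i) :=
    fun i => by ring
  rw [e1, det_neg] at h
  simp only [RCLike.ofReal_real_eq_id, id_eq, e2, Finset.prod_mul_distrib, Finset.prod_const,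
    Finset.card_univ] at h
  exact mul_left_cancel₀ (pow_ne_zero _ (by norm_num)) h

theorem one_add_sum_le_prod_one_add (s : Finset ι) {f : ι → ℝ} (hf : ∀ i, 0 ≤ f i) :
    1 + ∑ i ∈ s, f i ≤ ∏ i ∈ s, (1 + f i) := by
  classical
  induction s using Finset.induction_on with
  | empty => simp
  | insert a s ha ih =>
    rw [Finset.sum_insert ha, Finset.prod_insert ha]
    have h1 : 0 ≤ ∑ i ∈ s, f i := Finset.sum_nonneg fun i _ => hf i
    nlinarith [hf a]

theorem one_add_trace_le_det {X : Matrix n n ℝ} (hX : X.PosSemidef) :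
    1 + X.trace ≤ (1 + X).det := by
  rw [det_one_add_eq_prod hX.isHermitian, hX.isHermitian.trace_eq_sum_eigenvalues]
  exact one_add_sum_le_prod_one_add _ hX.eigenvalues_nonneg

theorem det_one_add_le {X : Matrix n n ℝ} (hX : X.PosSemidef) :
    (1 + X).det ≤ (1 + X.trace) ^ Fintype.card n := by
  rw [det_one_add_eq_prod hX.isHermitian, hX.isHermitian.trace_eq_sum_eigenvalues]
  have h : ∀ i, hX.isHermitian.eigenvalues i ≤ ∑ j, hX.isHermitian.eigenvalues j := fun i =>
    Finset.single_le_sum (f := fun j => hX.isHermitian.eigenvalues j)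
      (fun j _ => hX.eigenvalues_nonneg j) (Finset.mem_univ i)
  calc ∏ i, (1 + hX.isHermitian.eigenvalues i)
      ≤ ∏ _i : n, (1 + ∑ j, hX.isHermitian.eigenvalues j) :=
        Finset.prod_le_prod (fun i _ => by linarith [hX.eigenvalues_nonneg i])
          fun i _ => by linarith [h i]
    _ = _ := by simp

theorem regGram_det_le (s : Finset ι) (v : ι → n → ℝ) (hv : ∀ i ∈ s, v i ⬝ᵥ v i ≤ 1) :
    (regGram s v).det ≤ (1 + (s.card : ℝ)) ^ Fintype.card n := by
  rw [regGram, add_comm]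
  have htr : (∑ i ∈ s, vecMulVec (v i) (v i)).trace = ∑ i ∈ s, v i ⬝ᵥ v i := by
    rw [trace_sum]; simp
  refine (det_one_add_le (posSemidef_sum_vecMulVec s v)).trans ?_
  rw [htr]
  have h0 : 0 ≤ ∑ i ∈ s, v i ⬝ᵥ v i := Finset.sum_nonneg fun i _ => dotProduct_self_nonneg' _
  have h1 : ∑ i ∈ s, v i ⬝ᵥ v i ≤ s.card := by
    simpa using Finset.sum_le_card_nsmul s _ 1 hv
  gcongr

/-- The sum of the quadratic forms of the new vectors is controlled by the growth of the
determinant. -/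
theorem sum_regGram_inv_le [DecidableEq ι] {s t : Finset ι} (hst : s ⊆ t) (v : ι → n → ℝ) :
    ∑ i ∈ t \ s, v i ⬝ᵥ ((regGram s v)⁻¹ *ᵥ v i) ≤
      (regGram t v).det / (regGram s v).det - 1 := by
  set D := regGram s v with hD
  set E := ∑ i ∈ t \ s, vecMulVec (v i) (v i) with hE
  have hDE : regGram t v = D + E := by
    rw [hD, hE, regGram, regGram, ← Finset.sum_sdiff hst]; abel
  have hdet : D.det ≠ 0 := (regGram_det_pos s v).ne'
  -- `D⁻¹ * E` need not be symmetric. Factoring `D⁻¹` replaces it by the positive semidefinite `B *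
  -- E * Bᴴ`, which has the same trace and the same `det (1 + ·)`, so that `1 + trace ≤ det (1 + ·)`
  -- applies.
  obtain ⟨B, hB⟩ : ∃ B : Matrix n n ℝ, D⁻¹ = Bᴴ * B := by
    open scoped MatrixOrder in
    exact CStarAlgebra.nonneg_iff_eq_star_mul_self.mp (regGram_posDef s v).inv.posSemidef.nonneg
  have hX : (B * E * Bᴴ).PosSemidef :=
    (posSemidef_sum_vecMulVec (t \ s) v).mul_mul_conjTranspose_same B
  have h1 := one_add_trace_le_det hX
  have h2 : (1 + B * E * Bᴴ).det = (regGram t v).det / D.det := by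
    have e : (1 + D⁻¹ * E) = D⁻¹ * (D + E) := by
      rw [mul_add, nonsing_inv_mul _ (isUnit_iff_ne_zero.2 hdet)]
    rw [hDE, det_one_add_mul_comm, ← mul_assoc, ← hB, e, det_mul, det_nonsing_inv,
      Ring.inverse_eq_inv', div_eq_inv_mul]
  have h3 : (B * E * Bᴴ).trace = ∑ i ∈ t \ s, v i ⬝ᵥ (D⁻¹ *ᵥ v i) := by
    rw [trace_mul_comm, ← mul_assoc, ← hB, hE, Finset.mul_sum, trace_sum]
    refine Finset.sum_congr rfl fun i _ => ?_
    rw [mul_vecMulVec, trace_vecMulVec, dotProduct_comm]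
  rw [h2, h3] at h1
  linarith

end LinearAlgebra

/-! ### Epochs, the log-determinant potential and the sum of widths -/

section Potential

open Matrix

variable {S A : Type*} {d M : ℕ}

/-- The transitions over which `dataSum` sums, as pairs (episode, agent). -/
def dataSet (k t : ℕ) (m : Fin M) : Finset (ℕ × Fin M) :=
  Finset.range k ×ˢ Finset.univ ∪ Finset.Ico k t ×ˢ {m}

theorem mem_dataSet {k t : ℕ} {m : Fin M} {p : ℕ × Fin M} :
    p ∈ dataSet k t m ↔ p.1 < k ∨ (k ≤ p.1 ∧ p.1 < t) ∧ p.2 = m := by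
  simp only [dataSet, Finset.mem_union, Finset.mem_product, Finset.mem_range, Finset.mem_univ,
    and_true, Finset.mem_Ico, Finset.mem_singleton]

theorem dataSum_eq_sum {E : Type*} [AddCommMonoid E] (k t : ℕ) (m : Fin M)
    (f : ℕ → Fin M → E) : dataSum k t m f = ∑ p ∈ dataSet k t m, f p.1 p.2 := by
  rw [dataSet, Finset.sum_union, Finset.sum_product, Finset.sum_product, dataSum]
  · simp
  · rw [Finset.disjoint_left]
    rintro ⟨a, b⟩ h1 h2
    simp at h1 h2
    omega

/-- The feature vectors met at step `h`. -/
def featureVec (I : Input S A d M) (R : Record S A M) (h : ℕ) (p : ℕ × Fin M) : Fin d → ℝ :=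
  (I.feature (R.pair p.1 h p.2)).ofLp

theorem gram_eq_regGram {I : Input S A d M} (hI : I.ridge = 1) (R : Record S A M) (h : ℕ)
    (m : Fin M) (k t : ℕ) :
    gram I R h m k t = regGram (dataSet k t m) (featureVec I R h) := by
  rw [gram, dataSum_eq_sum, hI, one_smul]
  rfl

theorem cov_eq_regGram {I : Input S A d M} (hI : I.ridge = 1) (R : Record S A M) (t h : ℕ)
    (m : Fin M) :
    cov I R t h m = regGram (dataSet (syncTime I R t) t m) (featureVec I R h) :=
  gram_eq_regGram hI R h m _ t

theorem dataSet_succ {k t : ℕ} (hkt : k ≤ t) (m : Fin M) :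
    dataSet k (t + 1) m = insert (t, m) (dataSet k t m) := by
  ext ⟨a, b⟩
  simp only [mem_dataSet, Finset.mem_insert, Prod.mk.injEq]
  constructor
  · rintro (h | ⟨⟨h1, h2⟩, h3⟩)
    · exact Or.inr (Or.inl h)
    · rcases Nat.lt_succ_iff_lt_or_eq.1 h2 with h | h
      · exact Or.inr (Or.inr ⟨⟨h1, h⟩, h3⟩)
      · exact Or.inl ⟨h, h3⟩
  · rintro (⟨h1, h2⟩ | h | ⟨⟨h1, h2⟩, h3⟩)
    · exact Or.inr ⟨⟨by omega, by omega⟩, h2⟩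
    · exact Or.inl h
    · exact Or.inr ⟨⟨h1, by omega⟩, h3⟩

theorem notMem_dataSet {k t : ℕ} (hkt : k ≤ t) (m : Fin M) : (t, m) ∉ dataSet k t m := by
  simp [mem_dataSet]; omega

theorem dataSet_subset {k t : ℕ} (hkt : k ≤ t) (m : Fin M) :
    dataSet k t m ⊆ Finset.range t ×ˢ Finset.univ := by
  intro p hp
  rw [mem_dataSet] at hp
  simp
  omega

theorem syncTime_le (I : Input S A d M) (R : Record S A M) (t : ℕ) : syncTime I R t ≤ t := by
  induction t with
  | zero => simp [syncTime]
  | succ t ih => rw [syncTime]; split_ifs <;> omega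

/-- The structure of an epoch: from the last synchronization up to `t` the synchronization time is
constant, and every test made before episode `t` failed. -/
theorem syncTime_stable (I : Input S A d M) (R : Record S A M) (t : ℕ) :
    ∀ τ, syncTime I R t ≤ τ → τ ≤ t →
      syncTime I R τ = syncTime I R t ∧ (τ < t → ¬ Triggered I R (syncTime I R t) τ) := by
  induction t with
  | zero =>
    intro τ _ h2
    obtain rfl : τ = 0 := by omega
    simp
  | succ t ih =>
    intro τ h1 h2
    by_cases htr : Triggered I R (syncTime I R t) t
    · have e : syncTime I R (t + 1) = t + 1 := by rw [syncTime, if_pos htr]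
      rw [e] at h1
      obtain rfl : τ = t + 1 := by omega
      simp
    · have e : syncTime I R (t + 1) = syncTime I R t := by rw [syncTime, if_neg htr]
      rw [e] at h1 ⊢
      rcases Nat.lt_succ_iff_lt_or_eq.1 (Nat.lt_succ_of_le h2) with h | h
      · have := ih τ h1 (by omega)
        refine ⟨this.1, fun _ => ?_⟩
        rcases Nat.lt_or_ge τ t with h' | h'
        · exact this.2 h'
        · obtain rfl : τ = t := by omega
          exact htr
      · subst h
        exact ⟨e, fun h => absurd h (lt_irrefl _)⟩

/-- The exploration width of the pair met by agent `m` at step `h` of episode `t`. -/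
noncomputable def width (I : Input S A d M) (R : Record S A M) (t h : ℕ) (m : Fin M) : ℝ :=
  √(featureVec I R h (t, m) ⬝ᵥ ((cov I R t h m)⁻¹ *ᵥ featureVec I R h (t, m)))

/-- The log-determinant of the covariance of all data of the first `t` episodes. -/
noncomputable def logDet (I : Input S A d M) (R : Record S A M) (h t : ℕ) : ℝ :=
  Real.log (regGram (Finset.range t ×ˢ (Finset.univ : Finset (Fin M))) (featureVec I R h)).det

section

variable {ι n : Type*} [Fintype n] [DecidableEq n]

/-- The determinant ratio minus one dominates a sum of nonnegative quadratic forms. -/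
theorem regGram_det_mono [DecidableEq ι] {s t : Finset ι} (hst : s ⊆ t) (v : ι → n → ℝ) :
    (regGram s v).det ≤ (regGram t v).det := by
  have h := sum_regGram_inv_le hst v
  have h0 := Finset.sum_nonneg fun i (_ : i ∈ t \ s) => regGram_inv_quad_nonneg s v (v i)
  have h1 : 1 ≤ (regGram t v).det / (regGram s v).det := by linarith
  rwa [one_le_div (regGram_det_pos s v)] at h1

theorem le_two_mul_log_one_add {x : ℝ} (h0 : 0 ≤ x) (h1 : x ≤ 1) :
    x ≤ 2 * Real.log (1 + x) := by
  have h := Real.le_log_one_add_of_nonneg h0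
  have : x / 2 ≤ 2 * x / (x + 2) := by
    rw [div_le_div_iff₀ (by norm_num) (by linarith)]
    nlinarith
  linarith

end

variable {I : Input S A d M}

theorem featureVec_dotProduct_le (hφ : ∀ z, ‖I.feature z‖ ≤ 1) (R : Record S A M) (h : ℕ)
    (p : ℕ × Fin M) : featureVec I R h p ⬝ᵥ featureVec I R h p ≤ 1 := by
  have h1 := hφ (R.pair p.1 h p.2)
  have h2 : featureVec I R h p ⬝ᵥ featureVec I R h p = ‖I.feature (R.pair p.1 h p.2)‖ ^ 2 := by
    rw [EuclideanSpace.real_norm_sq_eq]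
    simp [featureVec, dotProduct, sq]
  rw [h2]
  exact pow_le_one₀ (norm_nonneg _) h1

theorem width_nonneg (R : Record S A M) (t h : ℕ) (m : Fin M) : 0 ≤ width I R t h m :=
  Real.sqrt_nonneg _

theorem width_sq (hI : I.ridge = 1) (R : Record S A M) (t h : ℕ) (m : Fin M) :
    width I R t h m ^ 2 = featureVec I R h (t, m) ⬝ᵥ
      ((regGram (dataSet (syncTime I R t) t m) (featureVec I R h))⁻¹ *ᵥ
        featureVec I R h (t, m)) := by
  rw [width, cov_eq_regGram hI, Real.sq_sqrt (regGram_inv_quad_nonneg _ _ _)]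

theorem width_le_one (hI : I.ridge = 1) (hφ : ∀ z, ‖I.feature z‖ ≤ 1) (R : Record S A M)
    (t h : ℕ) (m : Fin M) : width I R t h m ≤ 1 := by
  rw [width, cov_eq_regGram hI, Real.sqrt_le_one]
  exact (regGram_inv_quad_le _ _ _).trans (featureVec_dotProduct_le hφ R h _)

/-- The elliptical potential argument for one agent within an epoch: each new vector multiplies the
determinant by `1 + q`, and `q ≤ 2 log (1 + q)` for `q` in `[0, 1]`, so the sum telescopes. -/
theorem sum_quad_le_log (hφ : ∀ z, ‖I.feature z‖ ≤ 1) (R : Record S A M) (h : ℕ) (m : Fin M)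
    (k n : ℕ) (hkn : k ≤ n) :
    ∑ τ ∈ Finset.Ico k n, featureVec I R h (τ, m) ⬝ᵥ
      ((regGram (dataSet k τ m) (featureVec I R h))⁻¹ *ᵥ featureVec I R h (τ, m)) ≤
    2 * Real.log ((regGram (dataSet k n m) (featureVec I R h)).det /
      (regGram (dataSet k k m) (featureVec I R h)).det) := by
  induction n, hkn using Nat.le_induction with
  | base => simp [div_self (regGram_det_pos (dataSet k k m) (featureVec I R h)).ne']
  | succ n hkn ih =>
    rw [Finset.sum_Ico_succ_top hkn, dataSet_succ hkn, regGram_det_insert (notMem_dataSet hkn m)]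
    set q := featureVec I R h (n, m) ⬝ᵥ
      ((regGram (dataSet k n m) (featureVec I R h))⁻¹ *ᵥ featureVec I R h (n, m)) with hq
    have hq0 : 0 ≤ q := regGram_inv_quad_nonneg _ _ _
    have hq1 : q ≤ 1 :=
      (regGram_inv_quad_le _ _ _).trans (featureVec_dotProduct_le hφ R h _)
    have hp := regGram_det_pos (dataSet k n m) (featureVec I R h)
    have hp' := regGram_det_pos (dataSet k k m) (featureVec I R h)
    rw [mul_div_right_comm, Real.log_mul (div_pos hp hp').ne' (by positivity)]
    linarith [le_two_mul_log_one_add hq0 hq1]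

theorem logDet_mono (R : Record S A M) (h : ℕ) : Monotone (logDet I R h) := by
  intro a b hab
  refine Real.log_le_log (regGram_det_pos _ _) (regGram_det_mono ?_ _)
  exact Finset.product_subset_product_left (Finset.range_mono hab)

theorem logDet_zero (R : Record S A M) (h : ℕ) : logDet I R h 0 = 0 := by
  simp [logDet, regGram]

theorem logDet_le (hφ : ∀ z, ‖I.feature z‖ ≤ 1) (R : Record S A M) (h t : ℕ) :
    logDet I R h t ≤ d * Real.log (1 + M * t) := by
  have h1 := regGram_det_le (Finset.range t ×ˢ (Finset.univ : Finset (Fin M)))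
    (featureVec I R h) fun p _ => featureVec_dotProduct_le hφ R h p
  refine (Real.log_le_log (regGram_det_pos _ _) h1).trans_eq ?_
  rw [Real.log_pow]
  simp [mul_comm]

/-- Within one epoch whose log-determinant grows by at most one, the widths are controlled as
if all agents shared all data. -/
theorem sum_width_le_of_small (hI : I.ridge = 1) (R : Record S A M) (h : ℕ) {k t : ℕ}
    (hkt : k ≤ t) (hk : ∀ τ, k ≤ τ → τ < t → syncTime I R τ = k) {ε : ℝ} (hε : 0 < ε)
    (hΔ : logDet I R h t - logDet I R h k ≤ 1) :
    ∑ τ ∈ Finset.Ico k t, ∑ m, width I R τ h m ≤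
      ε * M * (t - k) / 2 + (1 / ε) * (logDet I R h t - logDet I R h k) := by
  have hsub : Finset.range k ×ˢ (Finset.univ : Finset (Fin M)) ⊆ Finset.range t ×ˢ Finset.univ :=
    Finset.product_subset_product_left (Finset.range_mono hkt)
  have hdiff : Finset.range t ×ˢ (Finset.univ : Finset (Fin M)) \
      Finset.range k ×ˢ Finset.univ = Finset.Ico k t ×ˢ Finset.univ := by
    ext ⟨a, b⟩; simp; omega
  have hp := regGram_det_pos (Finset.range t ×ˢ (Finset.univ : Finset (Fin M)))
    (featureVec I R h)
  have hp' := regGram_det_pos (Finset.range k ×ˢ (Finset.univ : Finset (Fin M)))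
    (featureVec I R h)
  have h1 := sum_regGram_inv_le hsub (featureVec I R h)
  have hΔ0 : 0 ≤ logDet I R h t - logDet I R h k := sub_nonneg.2 (logDet_mono R h hkt)
  have hexp : (regGram (Finset.range t ×ˢ (Finset.univ : Finset (Fin M)))
      (featureVec I R h)).det / (regGram (Finset.range k ×ˢ (Finset.univ : Finset (Fin M)))
      (featureVec I R h)).det = Real.exp (logDet I R h t - logDet I R h k) := by
    rw [logDet, logDet, Real.exp_sub, Real.exp_log hp, Real.exp_log hp']
  -- This is where growth at most one enters: `exp Δ - 1 ≤ 2 Δ` turns the determinant ratio into a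
  -- bound linear in the potential.
  have h2 := Real.abs_exp_sub_one_le (x := logDet I R h t - logDet I R h k)
    (by rwa [abs_of_nonneg hΔ0])
  rw [abs_of_nonneg hΔ0] at h2
  have h3 := (le_abs_self _).trans h2
  rw [hdiff, hexp] at h1
  have hsq : ∑ p ∈ Finset.Ico k t ×ˢ (Finset.univ : Finset (Fin M)), width I R p.1 h p.2 ^ 2 ≤
      2 * (logDet I R h t - logDet I R h k) := by
    refine le_trans (Finset.sum_le_sum fun p hp => ?_) (h1.trans h3)
    rw [Finset.mem_product, Finset.mem_Ico] at hp
    rw [width_sq hI, hk _ hp.1.1 hp.1.2]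
    -- An agent's covariance contains all data of the last synchronization, so its width is at most
    -- the one computed at the start of the epoch.
    exact regGram_inv_antitone Finset.subset_union_left _ _
  rw [← Finset.sum_product']
  -- The AM–GM inequality with a free parameter `ε` replaces Cauchy–Schwarz: the resulting bound is
  -- additive in the epoch length and the potential growth, and so can be summed over epochs.
  have hpt : ∀ p ∈ Finset.Ico k t ×ˢ (Finset.univ : Finset (Fin M)),
      width I R p.1 h p.2 ≤ ε / 2 + 1 / (2 * ε) * width I R p.1 h p.2 ^ 2 := fun p _ => by
    have : 0 ≤ (ε - width I R p.1 h p.2) ^ 2 / (2 * ε) := by positivity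
    have e : (ε - width I R p.1 h p.2) ^ 2 / (2 * ε) =
      ε / 2 + 1 / (2 * ε) * width I R p.1 h p.2 ^ 2 - width I R p.1 h p.2 := by
      field_simp; ring
    linarith
  refine (Finset.sum_le_sum hpt).trans ?_
  rw [Finset.sum_add_distrib, ← Finset.mul_sum, Finset.sum_const, Finset.card_product,
    Nat.card_Ico, Finset.card_univ, Fintype.card_fin, nsmul_eq_mul, Nat.cast_mul,
    Nat.cast_sub hkt]
  have h4 := mul_le_mul_of_nonneg_left hsq (show 0 ≤ 1 / (2 * ε) by positivity)
  have e : 1 / (2 * ε) * (2 * (logDet I R h t - logDet I R h k)) =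
    1 / ε * (logDet I R h t - logDet I R h k) := by field_simp
  rw [e] at h4
  linarith

/-- Within one epoch, the synchronization test bounds the widths of each agent. -/
theorem sum_width_le_of_not_triggered (hI : I.ridge = 1) (hφ : ∀ z, ‖I.feature z‖ ≤ 1)
    (R : Record S A M) {h : ℕ} (hh : h < I.horizon) (m : Fin M)
    {k t : ℕ} (hkt : k ≤ t) (hk : ∀ τ, k ≤ τ → τ ≤ t → syncTime I R τ = k)
    (htr : ∀ τ, k ≤ τ → τ < t → ¬ Triggered I R k τ) :
    ∑ τ ∈ Finset.Ico k (t + 1), width I R τ h m ≤ √(2 * I.threshold) + 1 := by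
  rw [Finset.sum_Ico_succ_top hkt]
  -- The last episode is treated separately because its own test may succeed; its width is at most
  -- one.
  refine add_le_add ?_ (width_le_one hI hφ R t h m)
  rcases hkt.eq_or_lt with rfl | hlt
  · simp
  refine Real.le_sqrt_of_sq_le ?_
  -- The test of episode `t - 1` covers the data of episodes `k, …, t - 1` and has denominator `(t -
  -- 1) + 1 - k = t - k`.
  have h1 := htr (t - 1) (by omega) (by omega)
  have h2 : Real.log ((regGram (dataSet k t m) (featureVec I R h)).det /
      (regGram (dataSet k k m) (featureVec I R h)).det) ≤ I.threshold / ((t : ℝ) - k) := by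
    by_contra hcon
    apply h1
    refine ⟨m, h, hh, ?_⟩
    rw [gram_eq_regGram hI, gram_eq_regGram hI, Nat.sub_add_cancel (by omega)]
    rw [Nat.cast_sub (by omega)]
    push Not at hcon
    simpa using hcon
  have h3 := sum_quad_le_log hφ R h m k t hkt
  have h4 : ∑ τ ∈ Finset.Ico k t, width I R τ h m ^ 2 ≤ 2 * (I.threshold / ((t : ℝ) - k)) := by
    refine le_trans (le_of_eq (Finset.sum_congr rfl fun τ hτ => ?_))
      (h3.trans (mul_le_mul_of_nonneg_left h2 (by norm_num)))
    rw [Finset.mem_Ico] at hτ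
    rw [width_sq hI, hk _ hτ.1 hτ.2.le]
  -- The factor `t - k` from Cauchy–Schwarz cancels the denominator of the test, so the bound does
  -- not depend on the length of the epoch.
  have h5 := sq_sum_le_card_mul_sum_sq (s := Finset.Ico k t) (f := fun τ => width I R τ h m)
  rw [Nat.card_Ico, Nat.cast_sub hkt] at h5
  have hpos : (0 : ℝ) < (t : ℝ) - k := sub_pos.2 (by exact_mod_cast hlt)
  refine h5.trans ((mul_le_mul_of_nonneg_left h4 hpos.le).trans_eq ?_)
  field_simp

/-- The widths met at one step add up to the centralized amount, plus a price for each epoch in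
which the log-determinant grows by more than one. -/
theorem sum_width_le (hI : I.ridge = 1) (hφ : ∀ z, ‖I.feature z‖ ≤ 1)
    (R : Record S A M) {h : ℕ} (hh : h < I.horizon) {ε : ℝ}
    (hε : 0 < ε) (t : ℕ) :
    ∑ τ ∈ Finset.range t, ∑ m, width I R τ h m ≤
      ε * M * t / 2 + (1 / ε + M * (√(2 * I.threshold) + 1)) * logDet I R h t := by
  -- The induction removes the whole last epoch, which starts at the synchronization time `k` of
  -- episode `t - 1`.
  induction t using Nat.strong_induction_on with
  | _ t ih =>
  rcases Nat.eq_zero_or_pos t with rfl | hpos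
  · simp [logDet_zero]
  obtain ⟨s, rfl⟩ : ∃ s, t = s + 1 := ⟨t - 1, by omega⟩
  set k := syncTime I R s with hk
  have hks : k ≤ s := syncTime_le I R s
  have hstab := syncTime_stable I R s
  have hih := ih k (by omega)
  have hb : 0 ≤ (M : ℝ) * (√(2 * I.threshold) + 1) := by positivity
  have hΔ0 : 0 ≤ logDet I R h (s + 1) - logDet I R h k :=
    sub_nonneg.2 (logDet_mono R h (by omega))
  have hsplit := Finset.sum_range_add_sum_Ico (fun τ => ∑ m, width I R τ h m)
    (show k ≤ s + 1 by omega)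
  have hks' : (k : ℝ) ≤ s := by exact_mod_cast hks
  rw [← hsplit]
  have hmain : ∑ τ ∈ Finset.Ico k (s + 1), ∑ m, width I R τ h m ≤
      ε * M * (((s + 1 : ℕ) : ℝ) - k) / 2 + (1 / ε + M * (√(2 * I.threshold) + 1)) *
        (logDet I R h (s + 1) - logDet I R h k) := by
    by_cases hΔ : logDet I R h (s + 1) - logDet I R h k ≤ 1
    · refine (sum_width_le_of_small hI R h (by omega)
        (fun τ h1 h2 => (hstab τ h1 (by omega)).1) hε hΔ).trans ?_
      rw [add_mul]
      linarith [mul_nonneg hb hΔ0]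
    -- Here the potential grows by more than one, so the cost `M (√(2S) + 1)` of the epoch is at
    -- most that cost times the growth; no count of epochs is needed.
    · push Not at hΔ
      rw [Finset.sum_comm]
      have h1 : ∑ m, ∑ τ ∈ Finset.Ico k (s + 1), width I R τ h m ≤
          M * (√(2 * I.threshold) + 1) := by
        refine (Finset.sum_le_card_nsmul _ _ _ fun m _ =>
          sum_width_le_of_not_triggered hI hφ R hh m hks
            (fun τ h1 h2 => (hstab τ h1 h2).1)
            fun τ h1 h2 => (hstab τ h1 h2.le).2 h2).trans_eq ?_
        rw [Finset.card_univ, Fintype.card_fin, nsmul_eq_mul]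
      have h2 : (M : ℝ) * (√(2 * I.threshold) + 1) * 1 ≤ M * (√(2 * I.threshold) + 1) *
        (logDet I R h (s + 1) - logDet I R h k) := mul_le_mul_of_nonneg_left hΔ.le hb
      have h3 : 0 ≤ ε * M * (((s + 1 : ℕ) : ℝ) - k) / 2 := by
        have : (0 : ℝ) ≤ ((s + 1 : ℕ) : ℝ) - k := by push_cast; linarith
        positivity
      have h4 : 0 ≤ 1 / ε * (logDet I R h (s + 1) - logDet I R h k) := by positivity
      rw [add_mul]
      linarith
  refine (add_le_add hih hmain).trans_eq ?_
  ring

end Potential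

/-! ### Measurability of everything the algorithm computes from the history -/

section Measurability

open Matrix

theorem measurable_matrix_det {Ω n : Type*} [MeasurableSpace Ω] [Fintype n] [DecidableEq n]
    {F : Ω → Matrix n n ℝ} (hF : ∀ i j, Measurable fun ω => F ω i j) :
    Measurable fun ω => (F ω).det := by
  simp_rw [det_apply']
  exact Finset.measurable_sum _ fun σ _ =>
    (Finset.measurable_prod _ fun i _ => hF _ _).const_mul _

/-- By Cramer's rule an entry of the inverse is a quotient of determinants, which are polynomials in
the entries. Singular matrices cause no trouble, since the formula holds for the total inverse. -/
theorem measurable_matrix_inv {Ω n : Type*} [MeasurableSpace Ω] [Fintype n] [DecidableEq n]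
    {F : Ω → Matrix n n ℝ} (hF : ∀ i j, Measurable fun ω => F ω i j) (i j : n) :
    Measurable fun ω => (F ω)⁻¹ i j := by
  have h : ∀ ω, (F ω)⁻¹ i j = (F ω).det⁻¹ * ((F ω).updateRow j (Pi.single i 1)).det := fun ω => by
    rw [inv_def, Matrix.smul_apply, adjugate_apply, Ring.inverse_eq_inv', smul_eq_mul]
  simp_rw [h]
  refine (measurable_matrix_det hF).inv.mul (measurable_matrix_det fun a b => ?_)
  by_cases hab : a = j
  · subst hab; simp
  · simpa [updateRow_ne hab] using hF a b

/-- Used to substitute the random synchronization time into quantities known to be measurable at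
each fixed time. -/
theorem measurable_comp_bounded_nat {Ω : Type*} [MeasurableSpace Ω] {k : Ω → ℕ}
    (hk : Measurable k) {N : ℕ} (hkN : ∀ ω, k ω ≤ N) {F : ℕ → Ω → ℝ}
    (hF : ∀ n ≤ N, Measurable (F n)) : Measurable fun ω => F (k ω) ω := by
  have h : (fun ω => F (k ω) ω) =
      fun ω => ∑ n ∈ Finset.range (N + 1), if k ω = n then F n ω else 0 := by
    funext ω
    rw [Finset.sum_ite_eq, if_pos (Finset.mem_range.2 (Nat.lt_succ_of_le (hkN ω)))]
  rw [h]
  refine Finset.measurable_sum _ fun n hn => ?_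
  exact Measurable.ite (hk (measurableSet_singleton n))
    (hF n (Nat.lt_succ_iff.1 (Finset.mem_range.1 hn))) measurable_const

variable {S A Ω : Type*} [MeasurableSpace S] [MeasurableSpace A] {d M : ℕ}

/-- The states and actions of the first `t` episodes are measurable. -/
structure HistoryMeasurable [MeasurableSpace Ω] (R : Ω → Record S A M) (H t : ℕ) : Prop where
  state : ∀ τ < t, ∀ h ≤ H, ∀ m, Measurable fun ω => (R ω).state τ h m
  action : ∀ τ < t, ∀ h < H, ∀ m, Measurable fun ω => (R ω).action τ h m

variable {mΩ : MeasurableSpace Ω} {R : Ω → Record S A M} {I : Input S A d M} {t : ℕ}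

theorem HistoryMeasurable.pair (hR : HistoryMeasurable R I.horizon t) {τ h : ℕ} (hτ : τ < t)
    (hh : h < I.horizon) (m : Fin M) : Measurable fun ω => (R ω).pair τ h m :=
  (hR.state τ hτ h hh.le m).prodMk (hR.action τ hτ h hh m)

theorem HistoryMeasurable.featureVec (hR : HistoryMeasurable R I.horizon t)
    (hφ : Measurable I.feature) {τ h : ℕ} (hτ : τ < t) (hh : h < I.horizon) (m : Fin M)
    (i : Fin d) : Measurable fun ω => featureVec I (R ω) h (τ, m) i := by
  have h1 : Measurable fun z => (I.feature z).ofLp i := by fun_prop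
  exact h1.comp (hR.pair hτ hh m)

theorem measurable_dataSum {k n : ℕ} (hk : k ≤ t) (hn : n ≤ t) (m : Fin M)
    {f : ℕ → Fin M → Ω → ℝ} (hf : ∀ τ < t, ∀ a, Measurable (f τ a)) :
    Measurable fun ω => dataSum k n m fun τ a => f τ a ω := by
  unfold dataSum
  refine (Finset.measurable_sum _ fun τ hτ => Finset.measurable_sum _ fun a _ => hf τ ?_ a).add
    (Finset.measurable_sum _ fun τ hτ => hf τ ?_ m)
  · rw [Finset.mem_range] at hτ; omega
  · rw [Finset.mem_Ico] at hτ; omega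

theorem HistoryMeasurable.gram (hR : HistoryMeasurable R I.horizon t)
    (hφ : Measurable I.feature) {h : ℕ} (hh : h < I.horizon) (m : Fin M) {k n : ℕ}
    (hk : k ≤ t) (hn : n ≤ t) (i j : Fin d) :
    Measurable fun ω => gram I (R ω) h m k n i j := by
  have h1 : ∀ ω, CoopLSVI.gram I (R ω) h m k n i j =
      dataSum k n m (fun τ a => CoopLSVI.featureVec I (R ω) h (τ, a) i *
        CoopLSVI.featureVec I (R ω) h (τ, a) j) + (I.ridge • (1 : Matrix (Fin d) (Fin d) ℝ)) i j :=
    fun ω => by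
      rw [CoopLSVI.gram, Matrix.add_apply, dataSum_eq_sum, dataSum_eq_sum, Matrix.sum_apply]
      rfl
  simp_rw [h1]
  refine (measurable_dataSum hk hn m (f := fun τ a ω => CoopLSVI.featureVec I (R ω) h (τ, a) i *
        CoopLSVI.featureVec I (R ω) h (τ, a) j) fun τ hτ a => ?_).add_const _
  exact (hR.featureVec hφ hτ hh a i).mul (hR.featureVec hφ hτ hh a j)

theorem HistoryMeasurable.triggered (hR : HistoryMeasurable R I.horizon t)
    (hφ : Measurable I.feature) {k s : ℕ} (hk : k ≤ t) (hs : s < t) :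
    MeasurableSet {ω | Triggered I (R ω) k s} := by
  have h1 : {ω | Triggered I (R ω) k s} = ⋃ m : Fin M, ⋃ h : ℕ, ⋃ _ : h < I.horizon,
      {ω | I.threshold / ((s : ℝ) + 1 - (k : ℝ)) < Real.log
        ((CoopLSVI.gram I (R ω) h m k (s + 1)).det / (CoopLSVI.gram I (R ω) h m k k).det)} := by
    ext ω; simp [Triggered]
  rw [h1]
  refine MeasurableSet.iUnion fun m => MeasurableSet.iUnion fun h =>
    MeasurableSet.iUnion fun hh => measurableSet_lt measurable_const (Measurable.log ?_)
  exact (measurable_matrix_det fun i j => hR.gram hφ hh m hk hs i j).div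
    (measurable_matrix_det fun i j => hR.gram hφ hh m hk hk i j)

theorem HistoryMeasurable.syncTime (hR : HistoryMeasurable R I.horizon t)
    (hφ : Measurable I.feature) {s : ℕ} (hs : s ≤ t) :
    Measurable fun ω => syncTime I (R ω) s := by
  induction s with
  | zero => simp [CoopLSVI.syncTime]
  | succ s ih =>
    have ih := ih (by omega)
    classical
    simp only [CoopLSVI.syncTime]
    refine Measurable.ite ?_ measurable_const ih
    have h1 : {ω | Triggered I (R ω) (CoopLSVI.syncTime I (R ω) s) s} =
        ⋃ k ∈ Finset.range (t + 1), {ω | CoopLSVI.syncTime I (R ω) s = k} ∩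
          {ω | Triggered I (R ω) k s} := by
      ext ω
      simp only [Set.mem_ofPred_eq, Set.mem_iUnion, Set.mem_inter_iff, Finset.mem_range,
        exists_prop]
      constructor
      · intro h
        exact ⟨_, by have := syncTime_le I (R ω) s; omega, rfl, h⟩
      · rintro ⟨k, _, rfl, h⟩
        exact h
    rw [h1]
    refine Finset.measurableSet_biUnion _ fun k hk => ?_
    exact (ih (measurableSet_singleton k)).inter
      (hR.triggered hφ (by rw [Finset.mem_range] at hk; omega) (by omega))

theorem HistoryMeasurable.cov_inv (hR : HistoryMeasurable R I.horizon t)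
    (hφ : Measurable I.feature) {h : ℕ} (hh : h < I.horizon) (m : Fin M) (i j : Fin d) :
    Measurable fun ω => (cov I (R ω) t h m)⁻¹ i j := by
  refine measurable_matrix_inv (fun a b => ?_) i j
  exact measurable_comp_bounded_nat (F := fun k ω => CoopLSVI.gram I (R ω) h m k t a b)
    (hR.syncTime hφ le_rfl) (fun ω => syncTime_le I (R ω) t)
    fun n hn => hR.gram hφ hh m hn le_rfl a b

theorem HistoryMeasurable.weights (hR : HistoryMeasurable R I.horizon t)
    (hφ : Measurable I.feature) (hr : ∀ h, Measurable (I.reward h)) {h : ℕ}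
    (hh : h < I.horizon) (m : Fin M) {V : Ω → S → ℝ}
    (hV : Measurable fun p : Ω × S => V p.1 p.2) (i : Fin d) :
    Measurable fun ω => weights I (R ω) t h m (V ω) i := by
  have h1 : ∀ ω, CoopLSVI.weights I (R ω) t h m (V ω) i =
      ∑ j, (cov I (R ω) t h m)⁻¹ i j * dataSum (CoopLSVI.syncTime I (R ω) t) t m (fun τ a =>
        (I.reward h ((R ω).pair τ h a) + V ω ((R ω).state τ (h + 1) a)) *
          CoopLSVI.featureVec I (R ω) h (τ, a) j) := fun ω => by
    simp only [CoopLSVI.weights, mulVec, dotProduct, dataSum_eq_sum, Finset.sum_apply]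
    rfl
  simp_rw [h1]
  refine Finset.measurable_sum _ fun j _ => (hR.cov_inv hφ hh m i j).mul ?_
  refine measurable_comp_bounded_nat (F := fun k ω => dataSum k t m (fun τ a =>
        (I.reward h ((R ω).pair τ h a) + V ω ((R ω).state τ (h + 1) a)) *
          CoopLSVI.featureVec I (R ω) h (τ, a) j))
    (hR.syncTime hφ le_rfl) (fun ω => syncTime_le I (R ω) t) fun n hn => ?_
  refine measurable_dataSum hn le_rfl m (f := fun τ a ω =>
        (I.reward h ((R ω).pair τ h a) + V ω ((R ω).state τ (h + 1) a)) *
          CoopLSVI.featureVec I (R ω) h (τ, a) j) fun τ hτ a => ?_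
  exact (((hr h).comp (hR.pair hτ hh a)).add
    (hV.comp (measurable_id.prodMk (hR.state τ hτ (h + 1) hh a)))).mul
    (hR.featureVec hφ hτ hh a j)

theorem HistoryMeasurable.qStep (hR : HistoryMeasurable R I.horizon t)
    (hφ : Measurable I.feature) (hr : ∀ h, Measurable (I.reward h)) {h : ℕ}
    (hh : h < I.horizon) (m : Fin M) {V : Ω → S → ℝ}
    (hV : Measurable fun p : Ω × S => V p.1 p.2) :
    Measurable fun p : Ω × (S × A) => qStep I (R p.1) t h m (V p.1) p.2 := by
  have h1 : ∀ i, Measurable fun p : Ω × (S × A) => (I.feature p.2).ofLp i := fun i => by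
    fun_prop
  have h2 : ∀ i, Measurable fun p : Ω × (S × A) => CoopLSVI.weights I (R p.1) t h m (V p.1) i :=
    fun i => (hR.weights hφ hr hh m hV i).comp measurable_fst
  have h3 : ∀ i j, Measurable fun p : Ω × (S × A) => (cov I (R p.1) t h m)⁻¹ i j :=
    fun i j => (hR.cov_inv hφ hh m i j).comp measurable_fst
  have h4 : Measurable fun p : Ω × (S × A) =>
      (I.feature p.2).ofLp ⬝ᵥ CoopLSVI.weights I (R p.1) t h m (V p.1) :=
    Finset.measurable_sum _ fun i _ => (h1 i).mul (h2 i)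
  have h3' : ∀ i, Measurable fun p : Ω × (S × A) =>
      ((cov I (R p.1) t h m)⁻¹ *ᵥ (I.feature p.2).ofLp) i := fun i => by
    simp only [mulVec, dotProduct]
    exact Finset.measurable_sum _ fun j _ => (h3 i j).mul (h1 j)
  have h5 : Measurable fun p : Ω × (S × A) =>
      (I.feature p.2).ofLp ⬝ᵥ ((cov I (R p.1) t h m)⁻¹ *ᵥ (I.feature p.2).ofLp) :=
    Finset.measurable_sum _ fun i _ => (h1 i).mul (h3' i)
  exact (h4.add (h5.sqrt.const_mul (I.bonus t m h))).min measurable_const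

theorem HistoryMeasurable.estValue [Fintype A] (hR : HistoryMeasurable R I.horizon t)
    (hφ : Measurable I.feature) (hr : ∀ h, Measurable (I.reward h)) (m : Fin M) (j : ℕ)
    (hj : j ≤ I.horizon) :
    Measurable fun p : Ω × S => estValue I (R p.1) t m j p.2 := by
  induction j with
  | zero => simp [CoopLSVI.estValue]
  | succ j ih =>
    simp only [CoopLSVI.estValue]
    refine Measurable.iSup fun a => ?_
    have hq := hR.qStep hφ hr (show I.horizon - (j + 1) < I.horizon by omega) m
      (V := fun ω => CoopLSVI.estValue I (R ω) t m j) (ih (by omega))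
    have ha : Measurable fun p : Ω × S => (p.1, (p.2, a)) :=
      measurable_fst.prodMk (measurable_snd.prodMk measurable_const)
    simpa only [Function.comp_def] using hq.comp ha

theorem HistoryMeasurable.estQ [Fintype A] (hR : HistoryMeasurable R I.horizon t)
    (hφ : Measurable I.feature) (hr : ∀ h, Measurable (I.reward h)) {h : ℕ}
    (hh : h < I.horizon) (m : Fin M) :
    Measurable fun p : Ω × (S × A) => estQ I (R p.1) t h m p.2 :=
  hR.qStep hφ hr hh m (V := fun ω => CoopLSVI.estValue I (R ω) t m (I.horizon - (h + 1)))
    (hR.estValue hφ hr m _ (by omega))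

theorem HistoryMeasurable.greedy [Fintype A] (hR : HistoryMeasurable R I.horizon t)
    (hφ : Measurable I.feature) (hr : ∀ h, Measurable (I.reward h))
    (hsel : Measurable I.select) {h : ℕ} (hh : h < I.horizon) (m : Fin M) :
    Measurable fun p : Ω × S => greedy I (R p.1) t h m p.2 := by
  have h1 : Measurable fun p : Ω × S => fun a => CoopLSVI.estQ I (R p.1) t h m (p.2, a) := by
    refine measurable_pi_lambda _ fun a => ?_
    have ha : Measurable fun p : Ω × S => (p.1, (p.2, a)) :=
      measurable_fst.prodMk (measurable_snd.prodMk measurable_const)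
    simpa only [Function.comp_def] using (hR.estQ hφ hr hh m).comp ha
  exact hsel.comp h1

/-- The σ-algebra is a parameter because the history before episode `t` is known at `ℱ (t, 0)` and
used at the later times `ℱ (t, h)`. -/
theorem HistoryMeasurable.mono {Ω : Type*} {R : Ω → Record S A M}
    {m₁ m₂ : MeasurableSpace Ω} (hm : m₁ ≤ m₂) {N t : ℕ}
    (hR : @HistoryMeasurable S A Ω _ _ M m₁ R N t) : @HistoryMeasurable S A Ω _ _ M m₂ R N t :=
  @HistoryMeasurable.mk S A Ω _ _ M m₂ R N t
    (fun τ hτ h hh m =>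
      (@HistoryMeasurable.state S A Ω _ _ M m₁ R N t hR τ hτ h hh m).mono hm le_rfl)
    (fun τ hτ h hh m =>
      (@HistoryMeasurable.action S A Ω _ _ M m₁ R N t hR τ hτ h hh m).mono hm le_rfl)

theorem HistoryMeasurable.greedy_comp [Fintype A]
    (hR : HistoryMeasurable R I.horizon t) (hφ : Measurable I.feature)
    (hr : ∀ h, Measurable (I.reward h)) (hsel : Measurable I.select) {h : ℕ}
    (hh : h < I.horizon) (m : Fin M) {X : Ω → S} (hX : Measurable X) :
    Measurable fun ω => CoopLSVI.greedy I (R ω) t h m (X ω) := by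
  simpa only [Function.comp_def, id_eq] using
    (hR.greedy hφ hr hsel hh m).comp (measurable_id.prodMk hX)

/-- The value of the greedy policy is a measurable function of the history and the state. -/
theorem HistoryMeasurable.value_greedyPolicy [Fintype A] [MeasurableSingletonClass A] {H : ℕ}
    (mdp : EpisodicMDP S A H) (hR : HistoryMeasurable R H t) (hI : I.horizon = H)
    (hφ : Measurable I.feature) (hr : ∀ h, Measurable (I.reward h))
    (hsel : Measurable I.select) (m : Fin M) (j : ℕ) (hj : j ≤ H) :
    Measurable fun p : Ω × S =>
      value mdp (greedyPolicy I hφ hsel (R p.1) t m) (H - j) p.2 := by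
  subst hI
  induction j with
  | zero =>
    simp only [Nat.sub_zero, value_horizon]
    exact measurable_const
  | succ j ih =>
    have ih := ih (by omega)
    set h := I.horizon - (j + 1) with hh
    have hh1 : I.horizon - j = h + 1 := by omega
    rw [hh1] at ih
    have hg := hR.greedy hφ hr hsel (show h < I.horizon by omega) m
    have hval : ∀ p : Ω × S, value mdp (greedyPolicy I hφ hsel (R p.1) t m) h p.2 =
        mdp.r h (p.2, CoopLSVI.greedy I (R p.1) t h m p.2) +
          ∫ y, value mdp (greedyPolicy I hφ hsel (R p.1) t m) (h + 1) y
            ∂(mdp.P h (p.2, CoopLSVI.greedy I (R p.1) t h m p.2)) := fun p =>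
      value_of_deterministic mdp _ h (by omega) p.2 (measurable_greedy hφ hsel (R p.1) t h m) rfl
    simp_rw [hval]
    have hpair : Measurable fun p : Ω × S =>
        (p.2, CoopLSVI.greedy I (R p.1) t h m p.2) := measurable_snd.prodMk hg
    have := mdp.markov h
    refine ((mdp.measurable_r h).comp hpair).add ?_
    -- The policy depends on the outcome, so the induction claims joint measurability in outcome and
    -- state; the transition is then a kernel from that product, pulled back along the greedy pair.
    exact measurable_integral_kernel ((mdp.P h).comap _ hpair)
      (f := fun q : (Ω × S) × S =>
        value mdp (greedyPolicy I hφ hsel (R q.1.1) t m) (h + 1) q.2)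
      (ih.comp ((measurable_fst.comp measurable_fst).prodMk measurable_snd))

end Measurability

/-! ### Conditional laws and one step of the exponential supermartingale -/

section Conditioning

open scoped ENNReal

/-- A product of kernels from a common source. -/
theorem measurable_measure_pi {Ω S ι : Type*} [Fintype ι] {mΩ : MeasurableSpace Ω}
    [MeasurableSpace S] (ν : ι → Kernel Ω S) [∀ n, IsMarkovKernel (ν n)] :
    Measurable fun ω => Measure.pi fun n => ν n ω := by
  refine Measurable.measure_of_isPiSystem_of_isProbabilityMeasure
    generateFrom_pi.symm isPiSystem_pi ?_
  rintro _ ⟨s, hs, rfl⟩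
  simp_rw [Measure.pi_pi]
  exact Finset.measurable_prod _ fun n _ => (ν n).measurable_coe (hs n (Set.mem_univ n))

/-- If `κ` is the conditional law of `X` given `p`, integrals of functions of `(p, X)` are
iterated integrals. -/
theorem lintegral_eq_of_condLaw {Ω Ω' Y : Type*} {mΩ : MeasurableSpace Ω}
    {mΩ' : MeasurableSpace Ω'} [MeasurableSpace Y] {μ : Measure Ω} [IsProbabilityMeasure μ]
    {p : Ω → Ω'} (hp : Measurable p) {X : Ω → Y} (hX : Measurable X) (κ : Kernel Ω' Y)
    [IsMarkovKernel κ]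
    (hcond : ∀ A B, MeasurableSet A → MeasurableSet B →
      μ (p ⁻¹' A ∩ X ⁻¹' B) = ∫⁻ ω in p ⁻¹' A, κ (p ω) B ∂μ)
    {F : Ω' × Y → ℝ≥0∞} (hF : Measurable F) :
    ∫⁻ ω, F (p ω, X ω) ∂μ = ∫⁻ ω, ∫⁻ y, F (p ω, y) ∂(κ (p ω)) ∂μ := by
  -- The hypothesis on rectangles identifies the joint law of `(p, X)` with the composition product
  -- of the law of `p` and `κ`.
  have hmap : μ.map (fun ω => (p ω, X ω)) = (μ.map p) ⊗ₘ κ := by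
    have := Measure.isProbabilityMeasure_map (μ := μ) hp.aemeasurable
    have := Measure.isProbabilityMeasure_map (μ := μ) (hp.prodMk hX).aemeasurable
    refine Measure.ext_prod fun {A B} hA hB => ?_
    rw [Measure.map_apply (hp.prodMk hX) (hA.prod hB), Measure.compProd_apply_prod hA hB,
      setLIntegral_map hA (κ.measurable_coe hB) hp, ← hcond A B hA hB]
    rfl
  rw [← lintegral_map hF (hp.prodMk hX), hmap, Measure.lintegral_compProd hF,
    lintegral_map hF.lintegral_kernel_prod_right' hp]

/-- Hoeffding's lemma: a variable with range of length `ρ` is sub-Gaussian with variance proxy `ρ² /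
4`; at parameter one this costs `ρ² / 8`. -/
theorem integral_exp_sub_le_one {S : Type*} [MeasurableSpace S] {ν : Measure S}
    [IsProbabilityMeasure ν] {f : S → ℝ} (hf : Measurable f) {a ρ : ℝ}
    (hfb : ∀ s, f s ∈ Set.Icc a (a + ρ)) :
    ∫ s, Real.exp (f s - ∫ s', f s' ∂ν - ρ ^ 2 / 8) ∂ν ≤ 1 := by
  have h := (hasSubgaussianMGF_of_mem_Icc (μ := ν) hf.aemeasurable
    (Filter.Eventually.of_forall hfb)).mgf_le 1
  simp only [mgf, one_mul, add_sub_cancel_left] at h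
  have h2 : ((‖ρ‖₊ / 2) ^ 2 : NNReal) * (1 : ℝ) ^ 2 / 2 = ρ ^ 2 / 8 := by
    push_cast
    rw [Real.norm_eq_abs, div_pow, sq_abs]; ring
  rw [h2] at h
  simp_rw [Real.exp_sub _ (ρ ^ 2 / 8)]
  rw [integral_div, div_le_one (Real.exp_pos _)]
  exact h

/-- Under a product measure the exponential of a sum factorizes, and each factor is at most one. -/
theorem lintegral_pi_exp_le_one {S : Type*} [MeasurableSpace S] {M : ℕ} {ν : Fin M → Measure S}
    [∀ n, IsProbabilityMeasure (ν n)] {f : Fin M → S → ℝ} (hf : ∀ n, Measurable (f n))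
    {ρ : Fin M → ℝ} (hfb : ∀ n, ∃ a, ∀ s, f n s ∈ Set.Icc a (a + ρ n)) :
    ∫⁻ y, ENNReal.ofReal (Real.exp (∑ n, (f n (y n) - ∫ s, f n s ∂(ν n) - ρ n ^ 2 / 8)))
      ∂(Measure.pi ν) ≤ 1 := by
  choose a ha using hfb
  have hmeas : Measurable fun y : Fin M → S =>
      ∑ n, (f n (y n) - ∫ s, f n s ∂(ν n) - ρ n ^ 2 / 8) :=
    Finset.measurable_sum _ fun n _ =>
      (((hf n).comp (measurable_pi_apply n)).sub_const _).sub_const _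
  have hint : Integrable (fun y : Fin M → S =>
      Real.exp (∑ n, (f n (y n) - ∫ s, f n s ∂(ν n) - ρ n ^ 2 / 8))) (Measure.pi ν) := by
    refine integrable_of_mem_Icc hmeas.exp (a := 0)
      (b := Real.exp (∑ n, (a n + ρ n - ∫ s, f n s ∂(ν n) - ρ n ^ 2 / 8)))
      fun y => ⟨(Real.exp_pos _).le, Real.exp_le_exp.2 (Finset.sum_le_sum fun n _ => ?_)⟩
    linarith [(ha n (y n)).2]
  rw [← ofReal_integral_eq_lintegral_ofReal hint
    (Filter.Eventually.of_forall fun _ => (Real.exp_pos _).le)]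
  refine ENNReal.ofReal_le_one.2 ?_
  simp_rw [Real.exp_sum]
  rw [integral_fintype_prod_eq_prod
    (f := fun n x => Real.exp (f n x - ∫ s, f n s ∂(ν n) - ρ n ^ 2 / 8))]
  exact Finset.prod_le_one (fun n _ => integral_nonneg fun _ => (Real.exp_pos _).le)
    fun n _ => integral_exp_sub_le_one (hf n) (ha n)

/-- One step of the exponential supermartingale: given the past, the coordinates of `X` are
independent. -/
theorem lintegral_mul_exp_le {Ω Ω' S : Type*} {mΩ : MeasurableSpace Ω}
    {mΩ' : MeasurableSpace Ω'} [MeasurableSpace S] {M : ℕ} {μ : Measure Ω}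
    [IsProbabilityMeasure μ] {p : Ω → Ω'} (hp : Measurable p) {X : Ω → Fin M → S}
    (hX : Measurable X) (ν : Fin M → Kernel Ω' S) [∀ n, IsMarkovKernel (ν n)]
    (hcond : ∀ A B, MeasurableSet A → MeasurableSet B →
      μ (p ⁻¹' A ∩ X ⁻¹' B) = ∫⁻ ω in p ⁻¹' A, Measure.pi (fun n => ν n (p ω)) B ∂μ)
    {W : Ω' → ℝ≥0∞} (hW : Measurable W) {f : Fin M → Ω' → S → ℝ}
    (hf : ∀ n, Measurable fun q : Ω' × S => f n q.1 q.2) {ρ : Fin M → Ω' → ℝ}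
    (hρ : ∀ n, Measurable (ρ n))
    (hfb : ∀ n ω, ∃ a, ∀ s, f n ω s ∈ Set.Icc a (a + ρ n ω)) :
    ∫⁻ ω, W (p ω) * ENNReal.ofReal (Real.exp (∑ n, (f n (p ω) (X ω n) -
      ∫ s, f n (p ω) s ∂(ν n (p ω)) - ρ n (p ω) ^ 2 / 8))) ∂μ ≤ ∫⁻ ω, W (p ω) ∂μ := by
  let κ : Kernel Ω' (Fin M → S) := ⟨fun ω => Measure.pi fun n => ν n ω, measurable_measure_pi ν⟩
  have hκ : IsMarkovKernel κ := ⟨fun ω => by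
    change IsProbabilityMeasure (Measure.pi fun n => ν n ω); infer_instance⟩
  have hE : Measurable fun q : Ω' × (Fin M → S) => ENNReal.ofReal (Real.exp
      (∑ n, (f n q.1 (q.2 n) - ∫ s, f n q.1 s ∂(ν n q.1) - ρ n q.1 ^ 2 / 8))) := by
    refine (Measurable.exp (Finset.measurable_sum _ fun n _ => ?_)).ennreal_ofReal
    have h1 : Measurable fun q : Ω' × (Fin M → S) => f n q.1 (q.2 n) :=
      (hf n).comp (measurable_fst.prodMk ((measurable_pi_apply n).comp measurable_snd))
    have h2 : Measurable fun ω : Ω' => ∫ s, f n ω s ∂(ν n ω) :=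
      measurable_integral_kernel (ν n) (hf n)
    exact (h1.sub (h2.comp measurable_fst)).sub
      ((((hρ n).comp measurable_fst).pow_const 2).div_const 8)
  have hF := (hW.comp (measurable_fst (α := Ω') (β := Fin M → S))).mul hE
  have h := lintegral_eq_of_condLaw hp hX κ hcond hF
  simp only [Function.comp_def, Pi.mul_apply] at h
  rw [h]
  refine lintegral_mono fun ω => ?_
  have hE' : Measurable fun y : Fin M → S => ENNReal.ofReal (Real.exp
      (∑ n, (f n (p ω) (y n) - ∫ s, f n (p ω) s ∂(ν n (p ω)) - ρ n (p ω) ^ 2 / 8))) := by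
    simpa only [Function.comp_def] using hE.comp (measurable_prodMk_left (x := p ω))
  rw [lintegral_const_mul _ hE']
  have h3 := lintegral_pi_exp_le_one (ν := fun n => ν n (p ω)) (f := fun n => f n (p ω))
    (fun n => (hf n).of_uncurry_left) (ρ := fun n => ρ n (p ω))
    (fun n => hfb n (p ω))
  exact (mul_le_mul' le_rfl h3).trans_eq (mul_one _)

end Conditioning

/-! ### Exponential martingale inequality along a run of the algorithm -/

section Run

open scoped ENNReal

variable {S A Ω : Type*} [MeasurableSpace S] [MeasurableSpace A] [mΩ : MeasurableSpace Ω]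
  {d M H T : ℕ} {mdp : EpisodicMDP S A H} {I : Input S A d M} {μ : Measure Ω}
  {ℱ : Filtration (ℕ ×ₗ ℕ) mΩ} {R : Ω → Record S A M}

theorem filtration_le {t t' h h' : ℕ} (h1 : t < t' ∨ t = t' ∧ h ≤ h') :
    ℱ (toLex (t, h)) ≤ ℱ (toLex (t', h')) :=
  ℱ.mono (Prod.Lex.le_iff.2 (by simpa using h1))

section

set_option linter.unusedSectionVars false

variable [Fintype A] (hrun : IsRun mdp I T μ ℱ R) (hI : I.horizon = H)
  (hφ : Measurable I.feature) (hr : ∀ h, Measurable (I.reward h)) (hsel : Measurable I.select)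

include hrun

theorem IsRun.state {t h : ℕ} (ht : t < T) (hh : h ≤ H) (m : Fin M) :
    Measurable[ℱ (toLex (t, h))] fun ω => (R ω).state t h m :=
  (measurable_pi_apply m).comp (hrun.adapted t ht h hh)

include hI hφ hr hsel

/-- Only states are assumed adapted. Actions are greedy, hence functions of earlier episodes and the
current state, so their measurability follows by strong induction on the episode. -/
theorem IsRun.history {t : ℕ} (ht : t < T) :
    @HistoryMeasurable S A Ω _ _ M (ℱ (toLex (t, 0))) R I.horizon t := by
  induction t using Nat.strong_induction_on with
  | _ t ih =>
  refine @HistoryMeasurable.mk S A Ω _ _ M (ℱ (toLex (t, 0))) R I.horizon t ?_ ?_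
  · intro τ hτ h hh m
    exact (hrun.state (by omega) (hI ▸ hh) m).mono (filtration_le (Or.inl hτ)) le_rfl
  · intro τ hτ h hh m
    have h1 := (ih τ hτ (by omega)).mono (filtration_le (ℱ := ℱ) (h' := h)
      (Or.inr ⟨rfl, Nat.zero_le h⟩))
    have h2 := h1.greedy_comp hφ hr hsel hh m (hrun.state (by omega) (hI ▸ hh.le) m)
    have h3 : (fun ω => (R ω).action τ h m) =
        fun ω => greedy I (R ω) τ h m ((R ω).state τ h m) := by
      funext ω
      exact hrun.acts τ (by omega) h (hI ▸ hh) m ω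
    rw [h3]
    exact h2.mono (filtration_le (Or.inl hτ)) le_rfl

theorem IsRun.action {t h : ℕ} (ht : t < T) (hh : h < H) (m : Fin M) :
    Measurable[ℱ (toLex (t, h))] fun ω => (R ω).action t h m := by
  have h1 := (hrun.history hI hφ hr hsel ht).mono (filtration_le (ℱ := ℱ) (h' := h)
      (Or.inr ⟨rfl, Nat.zero_le h⟩))
  have h2 := h1.greedy_comp hφ hr hsel (hI ▸ hh) m (hrun.state ht hh.le m)
  have h3 : (fun ω => (R ω).action t h m) =
      fun ω => greedy I (R ω) t h m ((R ω).state t h m) := by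
    funext ω
    exact hrun.acts t ht h hh m ω
  rwa [h3]

theorem IsRun.pair {t h : ℕ} (ht : t < T) (hh : h < H) (m : Fin M) :
    Measurable[ℱ (toLex (t, h))] fun ω => (R ω).pair t h m :=
  (hrun.state ht hh.le m).prodMk (hrun.action hI hφ hr hsel ht hh m)

/-- The conditional expectation in `IsRun.moves`, integrated over an event of the past, becomes an
identity of measures, which is the form the supermartingale step uses. -/
theorem IsRun.condLaw [IsProbabilityMeasure μ] {t h : ℕ} (ht : t < T) (hh : h < H) (F : Set Ω)
    (B : Set (Fin M → S)) (hF : MeasurableSet[ℱ (toLex (t, h))] F) (hB : MeasurableSet B) :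
    μ (F ∩ (fun ω => (R ω).state t (h + 1)) ⁻¹' B) =
      ∫⁻ ω in F, Measure.pi (fun n => mdp.P h ((R ω).pair t h n)) B ∂μ := by
  have hle : ℱ (toLex (t, h)) ≤ mΩ := ℱ.le _
  have := mdp.markov h
  have hB' : MeasurableSet ((fun ω => (R ω).state t (h + 1)) ⁻¹' B) :=
    ((hrun.adapted t ht (h + 1) hh).mono (ℱ.le _) le_rfl) hB
  have hF' : MeasurableSet F := hle _ hF
  have h1 := setIntegral_condExp hle (μ := μ)
    (f := Set.indicator {ω | (R ω).state t (h + 1) ∈ B} (fun _ => (1 : ℝ)))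
    ((integrable_const 1).indicator hB') hF
  have h2 := hrun.moves t ht h hh B hB
  rw [setIntegral_congr_ae (g := fun ω =>
    (Measure.pi fun m => mdp.P h ((R ω).pair t h m)).real B) hF'
    (h2.mono fun ω hω _ => hω)] at h1
  have hmeas : Measurable fun ω => (Measure.pi fun m => mdp.P h ((R ω).pair t h m)) B := by
    have h3 := measurable_measure_pi fun n => (mdp.P h).comap (fun ω => (R ω).pair t h n)
      ((hrun.pair hI hφ hr hsel ht hh n).mono hle le_rfl)
    exact (Measure.measurable_coe hB).comp h3
  have h4 : ∫ ω in F, Set.indicator {ω | (R ω).state t (h + 1) ∈ B} (fun _ => (1 : ℝ)) ω ∂μ =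
      μ.real (F ∩ (fun ω => (R ω).state t (h + 1)) ⁻¹' B) := by
    have h6 := setIntegral_indicator (μ := μ) (s := F) hB' (f := fun _ => (1 : ℝ))
    simp only [integral_const, smul_eq_mul, mul_one, measureReal_restrict_apply_univ] at h6
    exact h6
  rw [h4] at h1
  have h5 : ∫⁻ ω in F, Measure.pi (fun n => mdp.P h ((R ω).pair t h n)) B ∂μ =
      ENNReal.ofReal (∫ ω in F, (Measure.pi fun m => mdp.P h ((R ω).pair t h m)).real B ∂μ) := by
    rw [ofReal_integral_eq_lintegral_ofReal (f := fun ω =>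
        (Measure.pi fun m => mdp.P h ((R ω).pair t h m)).real B)
      (integrable_of_mem_Icc hmeas.ennreal_toReal (a := 0) (b := 1)
        fun ω => ⟨measureReal_nonneg, measureReal_le_one⟩)
      (Filter.Eventually.of_forall fun _ => measureReal_nonneg)]
    simp [ofReal_measureReal]
  rw [h5, h1, ofReal_measureReal]

theorem IsRun.measurable_deviation [IsProbabilityMeasure μ] {h : ℕ} (hh : h < H)
    {f : ℕ → Fin M → Ω → S → ℝ} {ρ : ℕ → Fin M → Ω → ℝ} {t : ℕ} (ht : t ≤ T)
    (hf : ∀ τ < t, ∀ n,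
      @Measurable (Ω × S) ℝ (@Prod.instMeasurableSpace Ω S (ℱ (toLex (τ, h))) _) _
        fun q => f τ n q.1 q.2)
    (hρ : ∀ τ < t, ∀ n, Measurable[ℱ (toLex (τ, h))] (ρ τ n)) :
    Measurable[ℱ (toLex (t, h))] fun ω => ∑ τ ∈ Finset.range t, ∑ n,
      (f τ n ω ((R ω).state τ (h + 1) n) - ∫ s, f τ n ω s ∂(mdp.P h ((R ω).pair τ h n)) -
        ρ τ n ω ^ 2 / 8) := by
  refine Finset.measurable_sum _ fun τ hτ => Finset.measurable_sum _ fun n _ => ?_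
  have hτ' := Finset.mem_range.1 hτ
  have hle : ℱ (toLex (τ, h)) ≤ ℱ (toLex (t, h)) := filtration_le (Or.inl hτ')
  have := mdp.markov h
  have h1 : Measurable[ℱ (toLex (t, h))] fun ω => (R ω).state τ (h + 1) n :=
    (hrun.state (by omega) hh n).mono (filtration_le (Or.inl hτ')) le_rfl
  have h2 : @Measurable Ω Ω (ℱ (toLex (t, h))) (ℱ (toLex (τ, h))) id := measurable_id'' hle
  have h3 : Measurable[ℱ (toLex (t, h))] fun ω => f τ n ω ((R ω).state τ (h + 1) n) :=
    (hf τ hτ' n).comp (h2.prodMk h1)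
  have h4 : Measurable[ℱ (toLex (τ, h))] fun ω =>
      ∫ s, f τ n ω s ∂(mdp.P h ((R ω).pair τ h n)) :=
    measurable_integral_kernel ((mdp.P h).comap (fun ω => (R ω).pair τ h n)
      (hrun.pair hI hφ hr hsel (by omega) hh n)) (hf τ hτ' n)
  exact (h3.sub (h4.mono hle le_rfl)).sub
    ((((hρ τ hτ' n).mono hle le_rfl).pow_const 2).div_const 8)

/-- The exponential supermartingale of the transitions made at step `h`. -/
theorem IsRun.lintegral_exp_le_one [IsProbabilityMeasure μ] {h : ℕ} (hh : h < H)
    {f : ℕ → Fin M → Ω → S → ℝ} {ρ : ℕ → Fin M → Ω → ℝ} {t : ℕ} (ht : t ≤ T)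
    (hf : ∀ τ < t, ∀ n,
      @Measurable (Ω × S) ℝ (@Prod.instMeasurableSpace Ω S (ℱ (toLex (τ, h))) _) _
        fun q => f τ n q.1 q.2)
    (hρ : ∀ τ < t, ∀ n, Measurable[ℱ (toLex (τ, h))] (ρ τ n))
    (hfb : ∀ τ < t, ∀ n ω, ∃ a, ∀ s, f τ n ω s ∈ Set.Icc a (a + ρ τ n ω)) :
    ∫⁻ ω, ENNReal.ofReal (Real.exp (∑ τ ∈ Finset.range t, ∑ n,
      (f τ n ω ((R ω).state τ (h + 1) n) - ∫ s, f τ n ω s ∂(mdp.P h ((R ω).pair τ h n)) -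
        ρ τ n ω ^ 2 / 8))) ∂μ ≤ 1 := by
  induction t with
  | zero => simp
  | succ t ih =>
    have ih := ih (by omega) (fun τ hτ => hf τ (by omega)) (fun τ hτ => hρ τ (by omega))
      (fun τ hτ => hfb τ (by omega))
    refine le_trans ?_ ih
    have := mdp.markov h
    let ν : Fin M → @Kernel Ω S (ℱ (toLex (t, h))) _ := fun n =>
      (mdp.P h).comap (fun ω => (R ω).pair t h n) (hrun.pair hI hφ hr hsel (by omega) hh n)
    have hν : ∀ n, IsMarkovKernel (ν n) := fun n => inferInstance
    have hW := (hrun.measurable_deviation (t := t) hI hφ hr hsel hh (by omega)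
      (fun τ hτ => hf τ (by omega))
      (fun τ hτ => hρ τ (by omega))).exp.ennreal_ofReal 
    -- The past is represented by the identity map into `Ω` with the smaller σ-algebra `ℱ (t, h)`;
    -- the explicit transition kernels then serve as conditional laws, and `Ω` may be an arbitrary
    -- probability space.
    have key := lintegral_mul_exp_le (μ := μ) (p := id)
      (measurable_id'' (ℱ.le (toLex (t, h)))) (X := fun ω => (R ω).state t (h + 1))
      ((hrun.adapted t (by omega) (h + 1) hh).mono (ℱ.le _) le_rfl) ν
      (fun F B hF hB => hrun.condLaw hI hφ hr hsel (by omega) hh F B hF hB)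
      hW (f := f t) (hf t (by omega)) (hρ t (by omega)) (hfb t (by omega))
    refine le_trans (le_of_eq (lintegral_congr fun ω => ?_)) key
    rw [Finset.sum_range_succ, Real.exp_add, ENNReal.ofReal_mul (Real.exp_pos _).le]
    rfl

/-- The corresponding deviation bound. -/
theorem IsRun.measure_le_exp [IsProbabilityMeasure μ] {h : ℕ} (hh : h < H)
    {f : ℕ → Fin M → Ω → S → ℝ} {ρ : ℕ → Fin M → Ω → ℝ} {t : ℕ} (ht : t ≤ T)
    (hf : ∀ τ < t, ∀ n,
      @Measurable (Ω × S) ℝ (@Prod.instMeasurableSpace Ω S (ℱ (toLex (τ, h))) _) _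
        fun q => f τ n q.1 q.2)
    (hρ : ∀ τ < t, ∀ n, Measurable[ℱ (toLex (τ, h))] (ρ τ n))
    (hfb : ∀ τ < t, ∀ n ω, ∃ a, ∀ s, f τ n ω s ∈ Set.Icc a (a + ρ τ n ω)) {δ : ℝ} (hδ : 0 < δ) :
    μ {ω | Real.log (1 / δ) < ∑ τ ∈ Finset.range t, ∑ n,
      (f τ n ω ((R ω).state τ (h + 1) n) - ∫ s, f τ n ω s ∂(mdp.P h ((R ω).pair τ h n)) -
        ρ τ n ω ^ 2 / 8)} ≤ ENNReal.ofReal δ := by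
  have h1 := hrun.lintegral_exp_le_one hI hφ hr hsel hh ht hf hρ hfb
  set Z : Ω → ℝ := fun ω => ∑ τ ∈ Finset.range t, ∑ n,
      (f τ n ω ((R ω).state τ (h + 1) n) - ∫ s, f τ n ω s ∂(mdp.P h ((R ω).pair τ h n)) -
        ρ τ n ω ^ 2 / 8) with hZ
  have hmeas : Measurable Z := (hrun.measurable_deviation hI hφ hr hsel hh ht hf hρ).mono
    (ℱ.le _) le_rfl
  have h2 := meas_ge_le_lintegral_div (μ := μ) hmeas.exp.ennreal_ofReal.aemeasurable
    (ε := ENNReal.ofReal (1 / δ)) (by simpa using hδ) ENNReal.ofReal_ne_top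
  refine (measure_mono fun ω hω => ?_).trans (h2.trans ?_)
  · refine ENNReal.ofReal_le_ofReal ?_
    rw [← Real.log_le_iff_le_exp (by positivity)]
    exact (show Real.log (1 / δ) < Z ω from hω).le
  · refine (ENNReal.div_le_div_right h1 _).trans_eq ?_
    rw [← ENNReal.ofReal_one, ← ENNReal.ofReal_div_of_pos (by positivity)]
    simp

end

end Run

/-! ### Discretization of directions, weights and inverse covariances -/

section Cover

open Matrix

variable {S A : Type*} {d : ℕ}

/-- The point of `[-1, 1]` with index `j` in a grid of mesh `1 / K`. -/
noncomputable def gridPoint (K : ℕ) (j : Fin (2 * K + 1)) : ℝ := ((j : ℝ) - K) / K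

theorem exists_gridPoint {K : ℕ} (hK : 0 < K) {x : ℝ} (hx : |x| ≤ 1) :
    ∃ j, |x - gridPoint K j| ≤ 1 / K := by
  have hK' : (0 : ℝ) < K := by exact_mod_cast hK
  obtain ⟨h1, h2⟩ := abs_le.1 hx
  have h3 : (0 : ℝ) ≤ x * K + K := by nlinarith
  have h4 : x * K + K ≤ ((2 * K : ℕ) : ℝ) := by push_cast; nlinarith
  have h5 : ⌊x * K + K⌋₊ ≤ 2 * K := Nat.floor_le_of_le h4
  refine ⟨⟨⌊x * K + K⌋₊, by omega⟩, ?_⟩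
  have h6 := Nat.floor_le h3
  have h7 := Nat.lt_floor_add_one (x * K + K)
  have e : x - gridPoint K ⟨⌊x * K + K⌋₊, by omega⟩ =
      (x * K + K - (⌊x * K + K⌋₊ : ℝ)) / K := by
    rw [gridPoint]; field_simp; ring
  rw [e, abs_div, abs_of_pos hK', abs_of_nonneg (by linarith)]
  gcongr
  linarith

/-- Indices for the grid of all (direction, weights, inverse covariance). -/
abbrev GridIndex (d K : ℕ) : Type :=
  (Fin d → Fin (2 * K + 1)) × (Fin d → Fin (2 * K + 1)) × (Fin d → Fin d → Fin (2 * K + 1))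

theorem card_gridIndex (d K : ℕ) :
    Fintype.card (GridIndex d K) = (2 * K + 1) ^ (2 * d + d ^ 2) := by
  simp only [GridIndex, Fintype.card_prod, Fintype.card_fun, Fintype.card_fin, ← pow_mul,
    ← pow_add]
  congr 1
  ring

/-- The value function with parameters `w` and `A`, truncated to `[0, cap]`. -/
noncomputable def clipValue (φ : S × A → EuclideanSpace ℝ (Fin d)) (β cap : ℝ) (w : Fin d → ℝ)
    (Λinv : Matrix (Fin d) (Fin d) ℝ) (s : S) : ℝ :=
  max 0 (⨆ a, min ((φ (s, a)).ofLp ⬝ᵥ w +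
    β * √((φ (s, a)).ofLp ⬝ᵥ (Λinv *ᵥ (φ (s, a)).ofLp))) cap)

theorem clipValue_mem [Nonempty A] (φ : S × A → EuclideanSpace ℝ (Fin d)) (β : ℝ) {cap : ℝ}
    (hcap : 0 ≤ cap) (w : Fin d → ℝ) (Λinv : Matrix (Fin d) (Fin d) ℝ) (s : S) :
    clipValue φ β cap w Λinv s ∈ Set.Icc 0 cap :=
  ⟨le_max_left _ _, max_le hcap (ciSup_le fun _ => min_le_right _ _)⟩

theorem measurable_clipValue [MeasurableSpace S] [MeasurableSpace A] [Fintype A]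
    {φ : S × A → EuclideanSpace ℝ (Fin d)} (hφ : Measurable φ) (β cap : ℝ) (w : Fin d → ℝ)
    (Λinv : Matrix (Fin d) (Fin d) ℝ) : Measurable (clipValue φ β cap w Λinv) := by
  have h1 : ∀ i, Measurable fun z => (φ z).ofLp i := fun i => by fun_prop
  have h2 : Measurable fun z => min ((φ z).ofLp ⬝ᵥ w +
    β * √((φ z).ofLp ⬝ᵥ (Λinv *ᵥ (φ z).ofLp))) cap := by
    simp only [dotProduct, Matrix.mulVec]
    fun_prop
  refine measurable_const.max (Measurable.iSup fun a => ?_)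
  simpa only [Function.comp_def] using h2.comp (measurable_prodMk_right (y := a))

theorem abs_ciSup_sub_ciSup_le {ι : Type*} [Finite ι] [Nonempty ι] {f g : ι → ℝ} {e : ℝ}
    (h : ∀ i, |f i - g i| ≤ e) : |(⨆ i, f i) - ⨆ i, g i| ≤ e := by
  have hf := Set.finite_range f |>.bddAbove
  have hg := Set.finite_range g |>.bddAbove
  rw [abs_le]
  constructor
  · have : (⨆ i, g i) ≤ (⨆ i, f i) + e := ciSup_le fun i => by
      linarith [le_ciSup hf i, (abs_le.1 (h i)).1]
    linarith
  · have : (⨆ i, f i) ≤ (⨆ i, g i) + e := ciSup_le fun i => by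
      linarith [le_ciSup hg i, (abs_le.1 (h i)).2]
    linarith

/-- Negative arguments must be allowed: a grid matrix near a positive semidefinite one may itself
have negative quadratic forms. -/
theorem abs_sqrt_sub_sqrt_le {x y b : ℝ} (h : |x - y| ≤ b) : |√x - √y| ≤ √b := by
  have key : ∀ {x y : ℝ}, |x - y| ≤ b → √x ≤ √y + √b := fun {x y} h => by
    refine (Real.sqrt_le_sqrt (?_ : x ≤ max y 0 + b)).trans ?_
    · linarith [(abs_le.1 h).2, le_max_left y 0]
    · have h0 := (abs_nonneg _).trans h
      have h1 : √(max y 0 + b) ≤ √(max y 0) + √b := by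
        refine Real.sqrt_le_iff.2 ⟨by positivity, ?_⟩
        rw [add_sq, Real.sq_sqrt (le_max_right _ _), Real.sq_sqrt h0]
        linarith [show 0 ≤ 2 * √(max y 0) * √b by positivity]
      refine h1.trans ?_
      rcases le_total y 0 with hy | hy
      · simp [max_eq_right hy, Real.sqrt_eq_zero_of_nonpos hy]
      · simp [max_eq_left hy]
  rw [abs_le]
  constructor
  · linarith [key (by rwa [abs_sub_comm] at h : |y - x| ≤ b)]
  · linarith [key h]

theorem abs_dotProduct_le {x y : Fin d → ℝ} {a : ℝ} (hx : ∀ i, |x i| ≤ 1)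
    (hy : ∀ i, |y i| ≤ a) : |x ⬝ᵥ y| ≤ d * a := by
  refine (Finset.abs_sum_le_sum_abs _ _).trans ?_
  refine (Finset.sum_le_card_nsmul _ _ a fun i _ => ?_).trans_eq (by simp)
  rw [abs_mul]
  exact (mul_le_of_le_one_left (abs_nonneg _) (hx i)).trans (hy i)

/-- Truncations and suprema are 1-Lipschitz, so only the linear term and the bonus matter. The bonus
is merely 1/2-Hölder in the matrix, whence `√b`. -/
theorem abs_clipValue_sub_le [Finite A] [Nonempty A] {φ : S × A → EuclideanSpace ℝ (Fin d)}
    (hφ : ∀ z i, |(φ z).ofLp i| ≤ 1) {β : ℝ} (hβ : 0 ≤ β) (cap : ℝ) {w w' : Fin d → ℝ}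
    {B B' : Matrix (Fin d) (Fin d) ℝ} {a b : ℝ} (hw : ∀ i, |w i - w' i| ≤ a)
    (hB : ∀ i j, |B i j - B' i j| ≤ b) (s : S) :
    |clipValue φ β cap w B s - clipValue φ β cap w' B' s| ≤ d * a + β * (d * √b) := by
  refine (abs_max_sub_max_le_max _ _ _ _).trans ?_
  rw [sub_self, abs_zero]
  refine max_le ?_ (abs_ciSup_sub_ciSup_le fun x => ?_)
  · rcases Nat.eq_zero_or_pos d with rfl | hd
    · simp
    · have := (abs_nonneg _).trans (hw ⟨0, hd⟩)
      positivity
  refine (abs_min_sub_min_le_max _ _ _ _).trans ?_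
  rw [sub_self, abs_zero]
  have h1 : |(φ (s, x)).ofLp ⬝ᵥ w - (φ (s, x)).ofLp ⬝ᵥ w'| ≤ d * a := by
    rw [← dotProduct_sub]
    exact abs_dotProduct_le (hφ _) hw
  have h2 : |√((φ (s, x)).ofLp ⬝ᵥ (B *ᵥ (φ (s, x)).ofLp)) -
      √((φ (s, x)).ofLp ⬝ᵥ (B' *ᵥ (φ (s, x)).ofLp))| ≤ d * √b := by
    have h3 : |(φ (s, x)).ofLp ⬝ᵥ (B *ᵥ (φ (s, x)).ofLp) -
        (φ (s, x)).ofLp ⬝ᵥ (B' *ᵥ (φ (s, x)).ofLp)| ≤ d ^ 2 * b := by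
      rw [← dotProduct_sub, ← sub_mulVec, sq, mul_assoc]
      refine abs_dotProduct_le (hφ _) fun i => ?_
      rw [mulVec, dotProduct_comm]
      exact abs_dotProduct_le (hφ _) (hB i)
    have h4 := abs_sqrt_sub_sqrt_le h3
    rwa [Real.sqrt_mul (by positivity), Real.sqrt_sq (by positivity)] at h4
  have h0 : 0 ≤ d * a := (abs_nonneg _).trans h1
  have h0' : 0 ≤ β * (d * √b) := by positivity
  refine max_le ?_ (by linarith)
  rw [add_sub_add_comm, ← mul_sub]
  refine (abs_add_le _ _).trans (add_le_add h1 ?_)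
  rw [abs_mul, abs_of_nonneg hβ]
  exact mul_le_mul_of_nonneg_left h2 hβ

/-- From a deviation bound at a grid point to a nearby direction and noise. -/
theorem sum_le_of_grid {ι : Type*} (s : Finset ι) {v : ι → Fin d → ℝ} {η η' : ι → ℝ}
    {u u' : Fin d → ℝ} {N H e r ℓ : ℝ} (hs : (s.card : ℝ) ≤ N) (hH : 0 < H) (hℓ : 0 < ℓ)
    (hv : ∀ p ∈ s, v p ⬝ᵥ v p ≤ 1) (hη : ∀ p ∈ s, |η p| ≤ H)
    (hηη' : ∀ p ∈ s, |η p - η' p| ≤ e) (huu' : ∀ i, |u i - u' i| ≤ r) (he : 0 ≤ e)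
    (hu : ∑ p ∈ s, (u ⬝ᵥ v p) ^ 2 + u ⬝ᵥ u ≤ 1) (hr : 0 ≤ r)
    (hN : N * (d * r) ^ 2 ≤ 1) (herr : N * (d * r * H + (1 + d * r) * e) ≤ 1)
    (hdev : ∑ p ∈ s, (√(2 * ℓ) / H * (u' ⬝ᵥ v p) * η' p -
      (√(2 * ℓ) / H * (u' ⬝ᵥ v p) * H) ^ 2 / 8) ≤ ℓ) :
    ∑ p ∈ s, (u ⬝ᵥ v p) * η p ≤ 1 + H * √(2 * ℓ) := by
  have hvi : ∀ p ∈ s, ∀ i, |v p i| ≤ 1 := fun p hp i => by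
    rw [← sq_le_one_iff_abs_le_one]
    refine le_trans ?_ (hv p hp)
    rw [sq]
    exact Finset.single_le_sum (f := fun i => v p i * v p i) (fun j _ => mul_self_nonneg _)
      (Finset.mem_univ i)
  have hu1 : u ⬝ᵥ u ≤ 1 := by
    linarith [Finset.sum_nonneg fun p (_ : p ∈ s) => sq_nonneg (u ⬝ᵥ v p)]
  have huv : ∀ p ∈ s, |u ⬝ᵥ v p| ≤ 1 := fun p hp => by
    rw [← sq_le_one_iff_abs_le_one]
    exact (dotProduct_sq_le _ _).trans
      (mul_le_one₀ hu1 (dotProduct_self_nonneg' _) (hv p hp))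
  have hd : ∀ p ∈ s, |u ⬝ᵥ v p - u' ⬝ᵥ v p| ≤ d * r := fun p hp => by
    rw [← sub_dotProduct, dotProduct_comm]
    exact abs_dotProduct_le (hvi p hp) huu'
  have hcard0 : (0 : ℝ) ≤ s.card := Nat.cast_nonneg _
  set x := √(2 * ℓ) with hx
  have hxpos : 0 < x := Real.sqrt_pos.2 (by linarith)
  have hxsq : x ^ 2 = 2 * ℓ := Real.sq_sqrt (by linarith)
  -- The constant is `2 * 1 + 2 * 1`: twice the normalized energy of `u`, plus twice the total
  -- rounding error `N (d r)²`.
  have hsum : ∑ p ∈ s, (u' ⬝ᵥ v p) ^ 2 ≤ 4 := by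
    have h1 : ∀ p ∈ s, (u' ⬝ᵥ v p) ^ 2 ≤ 2 * (u ⬝ᵥ v p) ^ 2 + 2 * (d * r) ^ 2 := fun p hp => by
      have h2 : (u ⬝ᵥ v p - u' ⬝ᵥ v p) ^ 2 ≤ (d * r) ^ 2 := by
        rw [← sq_abs]; exact pow_le_pow_left₀ (abs_nonneg _) (hd p hp) 2
      nlinarith [sq_nonneg (2 * (u ⬝ᵥ v p) - u' ⬝ᵥ v p)]
    refine (Finset.sum_le_sum h1).trans ?_
    rw [Finset.sum_add_distrib, ← Finset.mul_sum, Finset.sum_const, nsmul_eq_mul]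
    have h3 : (s.card : ℝ) * (d * r) ^ 2 ≤ 1 :=
      (mul_le_mul_of_nonneg_right hs (sq_nonneg _)).trans hN
    nlinarith [dotProduct_self_nonneg' u]
  -- With `x = √(2ℓ)` the level is `ℓ = x²/2`, and the quadratic compensator is at most `4 x²/8 =
  -- x²/2`; together they give `x²`, and division by `x / H` leaves `H x`.
  have hmain : ∑ p ∈ s, (u' ⬝ᵥ v p) * η' p ≤ H * x := by
    have e1 : ∑ p ∈ s, (x / H * (u' ⬝ᵥ v p) * η' p - (x / H * (u' ⬝ᵥ v p) * H) ^ 2 / 8) =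
        x / H * ∑ p ∈ s, (u' ⬝ᵥ v p) * η' p - x ^ 2 / 8 * ∑ p ∈ s, (u' ⬝ᵥ v p) ^ 2 := by
      rw [Finset.sum_sub_distrib, Finset.mul_sum, Finset.mul_sum]
      congr 1 <;> refine Finset.sum_congr rfl fun p _ => ?_
      · ring
      · field_simp
    rw [e1] at hdev
    have h1 : x / H * ∑ p ∈ s, (u' ⬝ᵥ v p) * η' p ≤ x ^ 2 := by
      have := mul_le_mul_of_nonneg_left hsum (show 0 ≤ x ^ 2 / 8 by positivity)
      linarith
    rw [div_mul_eq_mul_div, div_le_iff₀ hH, sq, mul_assoc] at h1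
    have := le_of_mul_le_mul_left h1 hxpos
    linarith
  have hdiff : ∑ p ∈ s, ((u ⬝ᵥ v p) * η p - (u' ⬝ᵥ v p) * η' p) ≤ 1 := by
    have h1 : ∀ p ∈ s, (u ⬝ᵥ v p) * η p - (u' ⬝ᵥ v p) * η' p ≤
        d * r * H + (1 + d * r) * e := fun p hp => by
      have e1 : (u ⬝ᵥ v p) * η p - (u' ⬝ᵥ v p) * η' p =
          (u ⬝ᵥ v p - u' ⬝ᵥ v p) * η p + (u' ⬝ᵥ v p) * (η p - η' p) := by ring
      have h2 : |u' ⬝ᵥ v p| ≤ 1 + d * r := by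
        have h3 := abs_sub_abs_le_abs_sub (u' ⬝ᵥ v p) (u ⬝ᵥ v p)
        rw [abs_sub_comm] at h3
        linarith [hd p hp, huv p hp]
      rw [e1]
      refine add_le_add ((le_abs_self _).trans ?_) ((le_abs_self _).trans ?_)
      · rw [abs_mul]
        exact mul_le_mul (hd p hp) (hη p hp) (abs_nonneg _) (by positivity)
      · rw [abs_mul]
        exact mul_le_mul h2 (hηη' p hp) (abs_nonneg _) (by positivity)
    refine (Finset.sum_le_sum h1).trans ?_
    rw [Finset.sum_const, nsmul_eq_mul]
    exact (mul_le_mul_of_nonneg_right hs (by positivity)).trans herr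
  rw [Finset.sum_sub_distrib] at hdiff
  linarith

end Cover

/-! ### Deviation bounds on the grid -/

section Concentration

open Matrix

variable {S A Ω : Type*} [MeasurableSpace S] [MeasurableSpace A] [Fintype A]
  [mΩ : MeasurableSpace Ω] {d M H T : ℕ} {mdp : EpisodicMDP S A H} {I : Input S A d M}
  {μ : Measure Ω} [IsProbabilityMeasure μ] {ℱ : Filtration (ℕ ×ₗ ℕ) mΩ} {R : Ω → Record S A M}

/-- The noise of the regression target `V` at the transition `p` of step `h`. -/
noncomputable def noise (mdp : EpisodicMDP S A H) (R : Record S A M) (h : ℕ) (V : S → ℝ)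
    (p : ℕ × Fin M) : ℝ :=
  V (R.state p.1 (h + 1) p.2) - ∫ s, V s ∂(mdp.P h (R.pair p.1 h p.2))

/-- Hoeffding's lemma sees only the length of the range, so the sign of `c` is irrelevant. -/
theorem exists_Icc_mul {S : Type*} {c H : ℝ} {g : S → ℝ} (hg : ∀ s, g s ∈ Set.Icc 0 H) :
    ∃ a, ∀ s, c * g s ∈ Set.Icc a (a + |c * H|) := by
  refine ⟨min 0 (c * H), fun s => ?_⟩
  obtain ⟨h1, h2⟩ := hg s
  rcases le_total 0 c with hc | hc
  · have hcH : 0 ≤ c * H := mul_nonneg hc (h1.trans h2)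
    rw [min_eq_left hcH, abs_of_nonneg hcH, zero_add]
    exact ⟨mul_nonneg hc h1, mul_le_mul_of_nonneg_left h2 hc⟩
  · have hcH : c * H ≤ 0 := mul_nonpos_of_nonpos_of_nonneg hc (h1.trans h2)
    rw [min_eq_right hcH, abs_of_nonpos hcH, add_neg_cancel]
    exact ⟨mul_le_mul_of_nonpos_left h2 hc, mul_nonpos_of_nonpos_of_nonneg hc h1⟩

/-- Deviation bound for a fixed direction and a fixed target. -/
theorem IsRun.measure_noise_le (hrun : IsRun mdp I T μ ℱ R) (hI : I.horizon = H)
    (hφ : Measurable I.feature) (hr : ∀ h, Measurable (I.reward h)) (hsel : Measurable I.select)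
    {t h k : ℕ} (ht : t < T) (hh : h < H) (hk : k ≤ t) (m : Fin M) (u : Fin d → ℝ) (θ : ℝ)
    {g : S → ℝ} (hg : Measurable g) (hg01 : ∀ s, g s ∈ Set.Icc (0 : ℝ) H) {δ : ℝ}
    (hδ : 0 < δ) :
    μ {ω | Real.log (1 / δ) < ∑ p ∈ dataSet k t m,
      (θ * (u ⬝ᵥ featureVec I (R ω) h p) * noise mdp (R ω) h g p -
        (θ * (u ⬝ᵥ featureVec I (R ω) h p) * H) ^ 2 / 8)} ≤ ENNReal.ofReal δ := by
  classical
  have hc : ∀ τ < t, ∀ n, Measurable[ℱ (toLex (τ, h))]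
      fun ω => θ * (u ⬝ᵥ featureVec I (R ω) h (τ, n)) := fun τ hτ n => by
    have h1 : Measurable fun z => θ * (u ⬝ᵥ (I.feature z).ofLp) := by
      simp only [dotProduct]; fun_prop
    exact h1.comp (hrun.pair hI hφ hr hsel (by omega) hh n)
  -- For fixed `k` and `m` the available data is a deterministic set of transitions; all others get
  -- weight zero, which keeps the sum over all agents and episodes a martingale.
  have key := hrun.measure_le_exp hI hφ hr hsel hh ht.le
    (f := fun τ n ω s => if (τ, n) ∈ dataSet k t m then
      θ * (u ⬝ᵥ featureVec I (R ω) h (τ, n)) * g s else 0)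
    (ρ := fun τ n ω => if (τ, n) ∈ dataSet k t m then
      |θ * (u ⬝ᵥ featureVec I (R ω) h (τ, n)) * H| else 0)
    (fun τ hτ n => ?_) (fun τ hτ n => ?_) (fun τ hτ n ω => ?_) hδ
  · refine le_trans (le_of_eq (congrArg μ ?_)) key
    ext ω
    rw [Set.mem_ofPred_eq, Set.mem_ofPred_eq]
    rw [← Finset.sum_product', ← Finset.sum_subset (dataSet_subset hk m)]
    · have e : ∑ p ∈ dataSet k t m,
          (θ * (u ⬝ᵥ featureVec I (R ω) h p) * noise mdp (R ω) h g p -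
            (θ * (u ⬝ᵥ featureVec I (R ω) h p) * H) ^ 2 / 8) =
          ∑ p ∈ dataSet k t m, ((if (p.1, p.2) ∈ dataSet k t m then
            θ * (u ⬝ᵥ featureVec I (R ω) h (p.1, p.2)) * g ((R ω).state p.1 (h + 1) p.2)
              else 0) -
            (∫ s, (if (p.1, p.2) ∈ dataSet k t m then
              θ * (u ⬝ᵥ featureVec I (R ω) h (p.1, p.2)) * g s else 0)
              ∂(mdp.P h ((R ω).pair p.1 h p.2))) -
            (if (p.1, p.2) ∈ dataSet k t m then
              |θ * (u ⬝ᵥ featureVec I (R ω) h (p.1, p.2)) * H| else 0) ^ 2 / 8) := by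
        refine Finset.sum_congr rfl fun p hp => ?_
        simp only [Prod.mk.eta, if_pos hp, noise, integral_const_mul, sq_abs]
        ring
      rw [e]
    · intro p _ hp
      simp [hp]
  · by_cases hp : (τ, n) ∈ dataSet k t m
    · simp only [hp, if_true]
      exact ((hc τ hτ n).comp measurable_fst).mul (hg.comp measurable_snd)
    · simp only [hp, if_false]
      exact measurable_const
  · by_cases hp : (τ, n) ∈ dataSet k t m
    · simp only [hp, if_true]
      exact measurable_abs.comp ((hc τ hτ n).mul_const _)
    · simp only [hp, if_false]
      exact measurable_const
  · by_cases hp : (τ, n) ∈ dataSet k t m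
    · simp only [hp, if_true]
      exact exists_Icc_mul hg01
    · exact ⟨0, by simp [hp]⟩

/-- The target indexed by a grid point. -/
noncomputable def gridValue (φ : S × A → EuclideanSpace ℝ (Fin d)) (β cap W : ℝ) {K : ℕ}
    (g : GridIndex d K) : S → ℝ :=
  clipValue φ β cap (fun i => W * gridPoint K (g.2.1 i))
    (Matrix.of fun i j => gridPoint K (g.2.2 i j))

/-- All deviation bounds hold at all grid points in one episode. -/
def GridBound (mdp : EpisodicMDP S A H) (I : Input S A d M) (R : Record S A M) (t K : ℕ)
    (β W θ ℓ : ℝ) : Prop :=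
  ∀ (m : Fin M) (h : Fin H) (k : Fin (t + 1)) (g : GridIndex d K),
    ∑ p ∈ dataSet k t m,
      (θ * ((fun i => gridPoint K (g.1 i)) ⬝ᵥ featureVec I R h p) *
          noise mdp R h (gridValue I.feature β ((H : ℝ) - ((h : ℕ) + 1 : ℕ)) W g) p -
        (θ * ((fun i => gridPoint K (g.1 i)) ⬝ᵥ featureVec I R h p) * H) ^ 2 / 8) ≤ ℓ

/-- A union bound over agents, steps, grid points and all `k ≤ t`. The true synchronization time is
random and depends on the transitions being summed, so it can only be inserted after the bound holds
for every `k`. -/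
theorem IsRun.measure_not_gridBound_le [Nonempty A] (hrun : IsRun mdp I T μ ℱ R)
    (hI : I.horizon = H)
    (hφ : Measurable I.feature) (hr : ∀ h, Measurable (I.reward h)) (hsel : Measurable I.select)
    {t : ℕ} (ht : t < T) (K : ℕ) (β W θ : ℝ) {δ : ℝ} (hδ : 0 < δ) :
    μ {ω | ¬ GridBound mdp I (R ω) t K β W θ (Real.log (1 / δ))} ≤
      ENNReal.ofReal (M * H * (t + 1) * (2 * K + 1) ^ (2 * d + d ^ 2) * δ) := by
  have hsub : {ω | ¬ GridBound mdp I (R ω) t K β W θ (Real.log (1 / δ))} ⊆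
      ⋃ q : Fin M × Fin H × Fin (t + 1) × GridIndex d K, {ω | Real.log (1 / δ) <
        ∑ p ∈ dataSet q.2.2.1 t q.1, (θ * ((fun i => gridPoint K (q.2.2.2.1 i)) ⬝ᵥ
            featureVec I (R ω) q.2.1 p) * noise mdp (R ω) q.2.1
              (gridValue I.feature β ((H : ℝ) - ((q.2.1 : ℕ) + 1 : ℕ)) W q.2.2.2) p -
          (θ * ((fun i => gridPoint K (q.2.2.2.1 i)) ⬝ᵥ featureVec I (R ω) q.2.1 p) * H) ^ 2
            / 8)} := by
    intro ω hω
    simp only [Set.mem_ofPred_eq, GridBound, not_forall, not_le] at hω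
    obtain ⟨m, h, k, g, hlt⟩ := hω
    exact Set.mem_iUnion.2 ⟨(m, h, k, g), hlt⟩
  refine (measure_mono hsub).trans ((measure_iUnion_fintype_le _ _).trans ?_)
  refine (Finset.sum_le_card_nsmul _ _ (ENNReal.ofReal δ) fun q _ => ?_).trans ?_
  · have hcap : (0 : ℝ) ≤ (H : ℝ) - ((q.2.1 : ℕ) + 1 : ℕ) :=
      sub_nonneg.2 (by exact_mod_cast q.2.1.2)
    refine hrun.measure_noise_le hI hφ hr hsel ht q.2.1.2 (by omega) _ _ _
      (measurable_clipValue hφ _ _ _ _) (fun s => ?_) hδ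
    have h1 := clipValue_mem I.feature β hcap (fun i => W * gridPoint K (q.2.2.2.2.1 i))
      (Matrix.of fun i j => gridPoint K (q.2.2.2.2.2 i j)) s
    exact ⟨h1.1, h1.2.trans (sub_le_self _ (by positivity))⟩
  · rw [nsmul_eq_mul, Finset.card_univ, ← ENNReal.ofReal_natCast,
      ← ENNReal.ofReal_mul (by positivity)]
    refine ENNReal.ofReal_le_ofReal (le_of_eq ?_)
    rw [Fintype.card_prod, Fintype.card_prod, Fintype.card_prod, card_gridIndex]
    simp only [Fintype.card_fin]
    push_cast
    ring

end Concentration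

/-! ### Linearity of Bellman backups -/

section Linear

open Matrix

variable {S A : Type*} [MeasurableSpace S] [MeasurableSpace A] {d H : ℕ}

/-- By the Jordan decomposition this is a difference of two antitone functions of the level. -/
theorem measurable_signedMeasure_superlevel (μ : SignedMeasure S) {V : S → ℝ}
    (hV : Measurable V) : Measurable fun s : ℝ => μ {x | s < V x} := by
  have h1 : ∀ s : ℝ, μ {x | s < V x} =
      μ.toJordanDecomposition.posPart.real {x | s < V x} -
        μ.toJordanDecomposition.negPart.real {x | s < V x} := fun s => by
    have hm : MeasurableSet {x | s < V x} := measurableSet_lt measurable_const hV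
    conv_lhs => rw [← μ.toSignedMeasure_toJordanDecomposition]
    rw [JordanDecomposition.toSignedMeasure, _root_.sub_apply,
      Measure.toSignedMeasure_apply_measurable hm, Measure.toSignedMeasure_apply_measurable hm]
  have h2 : ∀ ν : Measure S, IsFiniteMeasure ν →
      Measurable fun s : ℝ => ν.real {x | s < V x} := fun ν _ => by
    refine Antitone.measurable fun a b hab => measureReal_mono fun x hx => ?_
    exact lt_of_le_of_lt hab hx
  simp_rw [h1]
  exact (h2 _ inferInstance).sub (h2 _ inferInstance)

/-- In a linear MDP the Bellman backup of a bounded function is linear in the features. -/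
theorem IsLinear.exists_backup {mdp : EpisodicMDP S A H}
    {φ : S × A → EuclideanSpace ℝ (Fin d)} (hlin : IsLinear mdp φ) {h : ℕ} (hh : h < H)
    {V : S → ℝ} (hV : Measurable V) (hV01 : ∀ s, V s ∈ Set.Icc (0 : ℝ) H) :
    ∃ w : Fin d → ℝ, (∀ z, mdp.r h z + ∫ s, V s ∂(mdp.P h z) = (φ z).ofLp ⬝ᵥ w) ∧
      w ⬝ᵥ w ≤ (2 * d * H) ^ 2 := by
  obtain ⟨ν, θ, hP, hr, hν, hθ⟩ := hlin.linear h hh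
  have := mdp.markov h
  have hH0 : (0 : ℝ) ≤ H := Nat.cast_nonneg _
  have hH1 : (1 : ℝ) ≤ H := by exact_mod_cast (by omega : 1 ≤ H)
  have hm : ∀ s : ℝ, MeasurableSet {x | s < V x} := fun s => measurableSet_lt measurable_const hV
  have hνi : ∀ i s, |ν i {x | s < V x}| ≤ √(d : ℝ) := fun i s => by
    refine le_trans ?_ (hν _ (hm s))
    simpa using PiLp.norm_apply_le (WithLp.toLp 2 (fun i => ν i {x | s < V x})) i
  have hint : ∀ i, IntegrableOn (fun s : ℝ => ν i {x | s < V x}) (Set.Ioc 0 (H : ℝ)) := fun i =>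
    Measure.integrableOn_of_bounded (by simp)
      (measurable_signedMeasure_superlevel (ν i) hV).aestronglyMeasurable
      (Filter.Eventually.of_forall fun s => hνi i s)
  -- The layer-cake formula: linearity is assumed for measures of sets, so the integral of `V` is
  -- written through its superlevel sets. The weights become integrals over levels in `(0, H]`, and
  -- no integration against a signed measure is needed.
  have hlayer : ∀ z, ∫ s, V s ∂(mdp.P h z) =
      ∑ i, φ z i * ∫ s in Set.Ioc 0 (H : ℝ), ν i {x | s < V x} := fun z => by
    rw [(integrable_of_mem_Icc hV hV01).integral_eq_integral_meas_lt
      (Filter.Eventually.of_forall fun s => (hV01 s).1)]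
    have h1 : ∫ s in Set.Ioi (0 : ℝ), (mdp.P h z).real {x | s < V x} =
        ∫ s in Set.Ioc 0 (H : ℝ), (mdp.P h z).real {x | s < V x} := by
      refine setIntegral_eq_of_subset_of_forall_sdiff_eq_zero measurableSet_Ioi
        Set.Ioc_subset_Ioi_self fun s hs => ?_
      have hs' : (H : ℝ) < s := by
        by_contra hcon
        exact hs.2 ⟨hs.1, not_lt.1 hcon⟩
      have : {x | s < V x} = ∅ := by
        ext x
        simp only [Set.mem_ofPred_eq, Set.mem_empty_iff_false, iff_false, not_lt]
        exact (hV01 x).2.trans hs'.le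
      rw [this, measureReal_empty]
    rw [h1]
    simp_rw [fun s => hP z _ (hm s)]
    rw [integral_finsetSum _ fun i _ => (hint i).const_mul _]
    simp_rw [integral_const_mul]
  refine ⟨θ.ofLp + fun i => ∫ s in Set.Ioc 0 (H : ℝ), ν i {x | s < V x}, fun z => ?_, ?_⟩
  · rw [hr, hlayer, dotProduct_add]
    congr 1
    rw [EuclideanSpace.inner_eq_star_dotProduct, dotProduct_comm]
    simp
  · set y : Fin d → ℝ := fun i => ∫ s in Set.Ioc 0 (H : ℝ), ν i {x | s < V x} with hy
    have hyi : ∀ i, |y i| ≤ √(d : ℝ) * H := fun i => by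
      have := norm_setIntegral_le_of_norm_le_const (μ := volume) (s := Set.Ioc 0 (H : ℝ))
        (f := fun s => ν i {x | s < V x}) (C := √(d : ℝ)) (by simp) fun s _ => hνi i s
      simpa using this
    -- Each of the `d` squared coordinates is at most `d H²`.
    have hyy : y ⬝ᵥ y ≤ (d * H) ^ 2 := by
      refine (Finset.sum_le_card_nsmul _ _ (d * (H : ℝ) ^ 2) fun i _ => ?_).trans_eq ?_
      · rw [← sq, ← sq_abs]
        refine (pow_le_pow_left₀ (abs_nonneg _) (hyi i) 2).trans_eq ?_
        rw [mul_pow, Real.sq_sqrt (by positivity)]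
      · simp; ring
    have hθθ : θ.ofLp ⬝ᵥ θ.ofLp ≤ d := by
      have h1 : θ.ofLp ⬝ᵥ θ.ofLp = ‖θ‖ ^ 2 := by
        rw [EuclideanSpace.real_norm_sq_eq]; simp [dotProduct, sq]
      rw [h1]
      exact (pow_le_pow_left₀ (norm_nonneg _) hθ 2).trans_eq (Real.sq_sqrt (by positivity))
    have hd : (d : ℝ) ≤ (d * H) ^ 2 := by
      have h1 : (d : ℝ) ≤ (d : ℝ) ^ 2 := by
        exact_mod_cast Nat.le_self_pow (by norm_num) d
      rw [mul_pow]
      have h2 : (1 : ℝ) ≤ (H : ℝ) ^ 2 := one_le_pow₀ hH1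
      nlinarith [sq_nonneg (d : ℝ)]
    have hcross : 2 * (θ.ofLp ⬝ᵥ y) ≤ θ.ofLp ⬝ᵥ θ.ofLp + y ⬝ᵥ y := by
      have := dotProduct_self_nonneg' (θ.ofLp - y)
      rw [sub_dotProduct, dotProduct_sub, dotProduct_sub, dotProduct_comm y θ.ofLp] at this
      linarith
    rw [add_dotProduct, dotProduct_add, dotProduct_add, dotProduct_comm y θ.ofLp]
    nlinarith

end Linear

/-! ### Regression error within the bonus, and optimism -/

section Optimism

set_option linter.unusedSectionVars false

open Matrix

variable {S A : Type*} [MeasurableSpace S] [MeasurableSpace A] [Fintype A] {d M H : ℕ}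
  {mdp : EpisodicMDP S A H} {I : Input S A d M} {R : Record S A M}

theorem card_dataSet_le {k t : ℕ} (hk : k ≤ t) (m : Fin M) :
    ((dataSet k t m).card : ℝ) ≤ M * (t + 1) := by
  have h := Finset.card_le_card (dataSet_subset hk m)
  rw [Finset.card_product, Finset.card_range, Finset.card_univ, Fintype.card_fin] at h
  have h' : ((dataSet k t m).card : ℝ) ≤ t * M := by exact_mod_cast h
  have hM : (0 : ℝ) ≤ M := Nat.cast_nonneg _
  nlinarith

/-- The conditions on grid and bonus that make the deviation bounds usable in episode `t`. -/
structure Calibrated (d M H t K : ℕ) (β W ℓ : ℝ) : Prop where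
  pos_grid : 0 < K
  bonus_nonneg : 0 ≤ β
  weight_eq : W = d * (M * (t + 1) * (1 + H))
  pos_level : 0 < ℓ
  direction : M * (t + 1) * ((d : ℝ) * (1 / K)) ^ 2 ≤ 1
  error : M * (t + 1) * ((d : ℝ) * (1 / K) * H +
    (1 + d * (1 / K)) * (2 * (d * (W / K) + β * (d * √(1 / K))))) ≤ 1
  bonus : 1 + H * √(2 * ℓ) + 2 * d * H ≤ β

theorem abs_noise_le {h : ℕ} {V : S → ℝ} (hV : Measurable V)
    (hV01 : ∀ s, V s ∈ Set.Icc (0 : ℝ) H) (p : ℕ × Fin M) : |noise mdp R h V p| ≤ H := by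
  have := mdp.markov h
  have h1 := integral_mem_Icc (ν := mdp.P h (R.pair p.1 h p.2)) hV hV01
  have h2 := hV01 (R.state p.1 (h + 1) p.2)
  rw [noise, abs_le]
  constructor <;> linarith [h1.1, h1.2, h2.1, h2.2]

theorem abs_noise_sub_le {h : ℕ} {V V' : S → ℝ} (hV : Measurable V) (hV' : Measurable V')
    (hV01 : ∀ s, V s ∈ Set.Icc (0 : ℝ) H) (hV01' : ∀ s, V' s ∈ Set.Icc (0 : ℝ) H) {e : ℝ}
    (he : ∀ s, |V s - V' s| ≤ e) (p : ℕ × Fin M) :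
    |noise mdp R h V p - noise mdp R h V' p| ≤ 2 * e := by
  have := mdp.markov h
  have h1 : |∫ s, V s ∂(mdp.P h (R.pair p.1 h p.2)) -
      ∫ s, V' s ∂(mdp.P h (R.pair p.1 h p.2))| ≤ e := by
    rw [← integral_sub (integrable_of_mem_Icc hV hV01) (integrable_of_mem_Icc hV' hV01')]
    have h2 := integral_mem_Icc (ν := mdp.P h (R.pair p.1 h p.2)) (hV.sub hV')
      fun s => abs_le.1 (he s)
    exact abs_le.2 h2
  have h3 := he (R.state p.1 (h + 1) p.2)
  rw [noise, noise]
  rw [abs_le] at h1 h3 ⊢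
  constructor <;> linarith

theorem abs_le_one_of_dotProduct_le {x : Fin d → ℝ} (hx : x ⬝ᵥ x ≤ 1) (i : Fin d) :
    |x i| ≤ 1 := by
  rw [← sq_le_one_iff_abs_le_one]
  refine le_trans ?_ hx
  rw [sq]
  exact Finset.single_le_sum (f := fun i => x i * x i) (fun j _ => mul_self_nonneg _)
    (Finset.mem_univ i)

/-- The noise in the regression is small in every direction. -/
theorem GridBound.dotProduct_noise_le [Nonempty A] {t K : ℕ} {β W ℓ : ℝ}
    (hgood : GridBound mdp I R t K β W (√(2 * ℓ) / H) ℓ) (hcal : Calibrated d M H t K β W ℓ)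
    (hφm : Measurable I.feature) (hφ : ∀ z, ‖I.feature z‖ ≤ 1) (m : Fin M) {h k : ℕ}
    (hh : h < H) (hk : k ≤ t) {w : Fin d → ℝ} {B : Matrix (Fin d) (Fin d) ℝ}
    (hw : ∀ i, |w i| ≤ W) (hB : ∀ i j, |B i j| ≤ 1) {u : Fin d → ℝ}
    (hu : ∑ p ∈ dataSet k t m, (u ⬝ᵥ featureVec I R h p) ^ 2 + u ⬝ᵥ u ≤ 1) :
    ∑ p ∈ dataSet k t m, (u ⬝ᵥ featureVec I R h p) *
      noise mdp R h (clipValue I.feature β ((H : ℝ) - (h + 1 : ℕ)) w B) p ≤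
    1 + H * √(2 * ℓ) := by
  have hH : (0 : ℝ) < H := by exact_mod_cast (by omega : 0 < H)
  have hK : (0 : ℝ) < K := by exact_mod_cast hcal.pos_grid
  have hcap : (0 : ℝ) ≤ (H : ℝ) - (h + 1 : ℕ) := sub_nonneg.2 (by exact_mod_cast hh)
  have hφi : ∀ z i, |(I.feature z).ofLp i| ≤ 1 := fun z i =>
    (PiLp.norm_apply_le (I.feature z) i).trans (hφ z)
  have huu : u ⬝ᵥ u ≤ 1 := by
    linarith [Finset.sum_nonneg fun p (_ : p ∈ dataSet k t m) =>
      sq_nonneg (u ⬝ᵥ featureVec I R h p)]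
  -- As the ridge parameter is one, the ellipsoid of admissible directions lies in the unit ball,
  -- hence in the cube covered by the grid.
  choose gu hgu using fun i => exists_gridPoint hcal.pos_grid (abs_le_one_of_dotProduct_le huu i)
  have hW0 : 0 ≤ W := by rw [hcal.weight_eq]; positivity
  have hwW : ∀ i, |w i / W| ≤ 1 := fun i => by
    rw [abs_div, abs_of_nonneg hW0]
    exact div_le_one_of_le₀ (hw i) hW0
  choose gw hgw using fun i => exists_gridPoint hcal.pos_grid (hwW i)
  choose gB hgB using fun i j => exists_gridPoint hcal.pos_grid (hB i j)
  have hclip : ∀ (w' : Fin d → ℝ) (B' : Matrix (Fin d) (Fin d) ℝ) s,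
      clipValue I.feature β ((H : ℝ) - (h + 1 : ℕ)) w' B' s ∈ Set.Icc (0 : ℝ) H :=
    fun w' B' s => by
      have h1 := clipValue_mem I.feature β hcap w' B' s
      exact ⟨h1.1, h1.2.trans (sub_le_self _ (by positivity))⟩
  have hnear : ∀ s, |clipValue I.feature β ((H : ℝ) - (h + 1 : ℕ)) w B s -
      gridValue I.feature β ((H : ℝ) - (h + 1 : ℕ)) W (gu, gw, gB) s| ≤
        d * (W / K) + β * (d * √(1 / K)) := fun s => by
    refine abs_clipValue_sub_le hφi hcal.bonus_nonneg _ (fun i => ?_) (fun i j => hgB i j) s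
    -- If `W = 0` the rescaled weights `w i / W` carry no information, but then `w` itself vanishes.
    rcases hW0.eq_or_lt with h0 | h0
    · have := hw i
      rw [← h0] at this ⊢
      simpa using this
    · have e : w i - W * gridPoint K (gw i) = W * (w i / W - gridPoint K (gw i)) := by
        field_simp
      rw [e, abs_mul, abs_of_pos h0, div_eq_mul_one_div W]
      exact mul_le_mul_of_nonneg_left (hgw i) hW0
  refine sum_le_of_grid (dataSet k t m) (v := featureVec I R h)
    (η' := fun p => noise mdp R h
      (gridValue I.feature β ((H : ℝ) - (h + 1 : ℕ)) W (gu, gw, gB)) p)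
    (card_dataSet_le hk m) hH hcal.pos_level
    (fun p _ => featureVec_dotProduct_le hφ R h p)
    (fun p _ => abs_noise_le (measurable_clipValue hφm _ _ _ _) (hclip _ _) p)
    (fun p _ => abs_noise_sub_le (measurable_clipValue hφm _ _ _ _)
      (measurable_clipValue hφm _ _ _ _) (hclip _ _) (hclip _ _) hnear p)
    (fun i => hgu i) ?_ hu (by positivity) hcal.direction hcal.error ?_
  · have := hcal.bonus_nonneg
    positivity
  · exact hgood m ⟨h, hh⟩ ⟨k, by omega⟩ (gu, gw, gB)

/-- The same bound for the self-normalized noise. -/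
theorem GridBound.abs_inv_mulVec_noise_le [Nonempty A] {t K : ℕ} {β W ℓ : ℝ}
    (hgood : GridBound mdp I R t K β W (√(2 * ℓ) / H) ℓ) (hcal : Calibrated d M H t K β W ℓ)
    (hφm : Measurable I.feature) (hφ : ∀ z, ‖I.feature z‖ ≤ 1) (m : Fin M) {h k : ℕ}
    (hh : h < H) (hk : k ≤ t) {w : Fin d → ℝ} {B : Matrix (Fin d) (Fin d) ℝ}
    (hw : ∀ i, |w i| ≤ W) (hB : ∀ i j, |B i j| ≤ 1) (x : Fin d → ℝ) :
    |∑ p ∈ dataSet k t m,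
      (((regGram (dataSet k t m) (featureVec I R h))⁻¹ *ᵥ x) ⬝ᵥ featureVec I R h p) *
      noise mdp R h (clipValue I.feature β ((H : ℝ) - (h + 1 : ℕ)) w B) p| ≤
    (1 + H * √(2 * ℓ)) * √(x ⬝ᵥ ((regGram (dataSet k t m) (featureVec I R h))⁻¹ *ᵥ x)) := by
  set y := (regGram (dataSet k t m) (featureVec I R h))⁻¹ *ᵥ x with hy
  set q := x ⬝ᵥ y with hq
  have hquad : q = ∑ p ∈ dataSet k t m, (y ⬝ᵥ featureVec I R h p) ^ 2 + y ⬝ᵥ y :=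
    dotProduct_regGram_inv _ _ x
  have hq0 : 0 ≤ q := regGram_inv_quad_nonneg _ _ x
  rcases hq0.eq_or_lt with h0 | hpos
  · have hyy : y ⬝ᵥ y = 0 := by
      have h1 := dotProduct_self_nonneg' y
      have h2 := Finset.sum_nonneg fun p (_ : p ∈ dataSet k t m) =>
        sq_nonneg (y ⬝ᵥ featureVec I R h p)
      linarith
    have hy0 : y = 0 := dotProduct_self_eq_zero.1 hyy
    simp [hy0, ← h0]
  · have hs : 0 < √q := Real.sqrt_pos.2 hpos
    have key : ∀ c : ℝ, c ^ 2 = 1 → c * ∑ p ∈ dataSet k t m, (y ⬝ᵥ featureVec I R h p) *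
        noise mdp R h (clipValue I.feature β ((H : ℝ) - (h + 1 : ℕ)) w B) p ≤
        (1 + H * √(2 * ℓ)) * √q := fun c hc => by
      -- The direction `y`, divided by `√q` and taken with either sign, satisfies the normalization
      -- with equality.
      have h1 := hgood.dotProduct_noise_le hcal hφm hφ m hh hk hw hB (u := (c / √q) • y) (by
        simp only [smul_dotProduct, dotProduct_smul, smul_eq_mul, mul_pow]
        rw [← Finset.mul_sum, ← mul_assoc, ← sq, ← mul_add, ← hquad, div_pow, hc,
          Real.sq_sqrt hq0, one_div, inv_mul_cancel₀ hpos.ne'])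
      simp only [smul_dotProduct, smul_eq_mul, mul_assoc] at h1
      rw [← Finset.mul_sum, div_mul_eq_mul_div, div_le_iff₀ hs] at h1
      exact h1
    rw [abs_le]
    constructor
    · linarith [key (-1) (by norm_num)]
    · linarith [key 1 (by norm_num)]

/-- The estimated Bellman backup is within the bonus of the true one. -/
theorem GridBound.abs_backup_sub_le [Nonempty A] {t K : ℕ} {β W ℓ : ℝ}
    (hgood : GridBound mdp I R t K β W (√(2 * ℓ) / H) ℓ) (hcal : Calibrated d M H t K β W ℓ)
    (hlin : IsLinear mdp I.feature) (hI : I.ridge = 1) (hr : I.reward = mdp.r) (m : Fin M)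
    {h : ℕ} (hh : h < H) {w : Fin d → ℝ} {B : Matrix (Fin d) (Fin d) ℝ}
    (hw : ∀ i, |w i| ≤ W) (hB : ∀ i j, |B i j| ≤ 1) (z : S × A) :
    |(I.feature z).ofLp ⬝ᵥ weights I R t h m
        (clipValue I.feature β ((H : ℝ) - (h + 1 : ℕ)) w B) -
      (mdp.r h z + ∫ s, clipValue I.feature β ((H : ℝ) - (h + 1 : ℕ)) w B s ∂(mdp.P h z))| ≤
    β * √((I.feature z).ofLp ⬝ᵥ ((cov I R t h m)⁻¹ *ᵥ (I.feature z).ofLp)) := by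
  have hcap : (0 : ℝ) ≤ (H : ℝ) - (h + 1 : ℕ) := sub_nonneg.2 (by exact_mod_cast hh)
  set V := clipValue I.feature β ((H : ℝ) - (h + 1 : ℕ)) w B with hV
  have hVm : Measurable V := measurable_clipValue hlin.measurable_feature _ _ _ _
  have hV01 : ∀ s, V s ∈ Set.Icc (0 : ℝ) H := fun s => by
    have h1 := clipValue_mem I.feature β hcap w B s
    exact ⟨h1.1, h1.2.trans (sub_le_self _ (by positivity))⟩
  obtain ⟨ws, hws, hwsn⟩ := hlin.exists_backup hh hVm hV01
  set k := syncTime I R t with hk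
  have hkt : k ≤ t := syncTime_le I R t
  rw [cov_eq_regGram hI, ← hk]
  set Λ := regGram (dataSet k t m) (featureVec I R h) with hΛ
  set x := (I.feature z).ofLp with hx
  have htarget : ∀ p : ℕ × Fin M, I.reward h (R.pair p.1 h p.2) + V (R.state p.1 (h + 1) p.2) =
      featureVec I R h p ⬝ᵥ ws + noise mdp R h V p := fun p => by
    rw [featureVec, ← hws, noise, hr]; ring
  -- The targets equal `φ·ws` plus noise, and the noiseless part sums to `(Λ - 1) ws`. Hence ridge
  -- regression recovers `ws` up to the bias `-Λ⁻¹ ws` and the averaged noise.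
  have hweights : weights I R t h m V = ws - Λ⁻¹ *ᵥ ws + Λ⁻¹ *ᵥ
      ∑ p ∈ dataSet k t m, noise mdp R h V p • featureVec I R h p := by
    have h1 : dataSum k t m (fun τ n => (I.reward h (R.pair τ h n) +
        V (R.state τ (h + 1) n)) • (I.feature (R.pair τ h n)).ofLp) =
        Λ *ᵥ ws - ws + ∑ p ∈ dataSet k t m, noise mdp R h V p • featureVec I R h p := by
      rw [dataSum_eq_sum, hΛ, regGram_mulVec, add_sub_cancel_right, ← Finset.sum_add_distrib]
      refine Finset.sum_congr rfl fun p _ => ?_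
      rw [← add_smul, ← htarget]
      rfl
    rw [weights, cov_eq_regGram hI, ← hk, h1, mulVec_add, mulVec_sub, regGram_inv_mulVec]
  have hnoise := hgood.abs_inv_mulVec_noise_le hcal hlin.measurable_feature
    hlin.norm_feature_le m hh hkt hw hB x
  -- Cauchy–Schwarz, with `|Λ⁻¹ x|² ≤ x·Λ⁻¹ x` and `|ws| ≤ 2 d H`.
  have hbias : |(Λ⁻¹ *ᵥ x) ⬝ᵥ ws| ≤ 2 * d * H * √(x ⬝ᵥ (Λ⁻¹ *ᵥ x)) := by
    refine Real.abs_le_sqrt (dotProduct_sq_le _ _) |>.trans ?_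
    rw [Real.sqrt_le_iff]
    refine ⟨by positivity, ?_⟩
    rw [mul_pow, Real.sq_sqrt (regGram_inv_quad_nonneg _ _ x), mul_comm]
    exact mul_le_mul hwsn (regGram_inv_mulVec_sq_le _ _ x) (dotProduct_self_nonneg' _)
      (by positivity)
  have hsplit : x ⬝ᵥ weights I R t h m V - (mdp.r h z + ∫ s, V s ∂(mdp.P h z)) =
      -((Λ⁻¹ *ᵥ x) ⬝ᵥ ws) + ∑ p ∈ dataSet k t m,
        ((Λ⁻¹ *ᵥ x) ⬝ᵥ featureVec I R h p) * noise mdp R h V p := by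
    rw [hws, hweights, dotProduct_add, dotProduct_sub, regGram_inv_comm, regGram_inv_comm,
      dotProduct_sum]
    simp_rw [dotProduct_smul, smul_eq_mul, mul_comm (noise mdp R h V _)]
    ring
  rw [hsplit]
  refine (abs_add_le _ _).trans ?_
  rw [abs_neg]
  refine (add_le_add hbias hnoise).trans ?_
  rw [← add_mul]
  exact mul_le_mul_of_nonneg_right (by linarith [hcal.bonus]) (Real.sqrt_nonneg _)

/-- A crude polynomial bound is enough: it sets the side of the box of weights that the grid
discretizes, which enters the bonus only through a logarithm. -/
theorem abs_weights_le {t h : ℕ} (hI : I.ridge = 1) (hr : I.reward = mdp.r)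
    (hφ : ∀ z, ‖I.feature z‖ ≤ 1) (hh : h < H) (m : Fin M) {V : S → ℝ}
    (hV01 : ∀ s, V s ∈ Set.Icc (0 : ℝ) H) (i : Fin d) :
    |weights I R t h m V i| ≤ d * (M * (t + 1) * (1 + H)) := by
  have hd : (1 : ℝ) ≤ d := by
    exact_mod_cast Nat.one_le_iff_ne_zero.2 fun h0 => by subst h0; exact i.elim0
  set y := dataSum (syncTime I R t) t m (fun τ n => (I.reward h (R.pair τ h n) +
        V (R.state τ (h + 1) n)) • (I.feature (R.pair τ h n)).ofLp) with hy
  have hyi : ∀ j, |y j| ≤ M * (t + 1) * (1 + H) := fun j => by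
    rw [hy, dataSum_eq_sum, Finset.sum_apply]
    refine (Finset.abs_sum_le_sum_abs _ _).trans ?_
    refine (Finset.sum_le_card_nsmul _ _ (1 + (H : ℝ)) fun p _ => ?_).trans ?_
    · have h1 : |(I.feature (R.pair p.1 h p.2)).ofLp j| ≤ 1 :=
        (PiLp.norm_apply_le (I.feature _) j).trans (hφ _)
      have h2 := mdp.r_mem h hh (R.pair p.1 h p.2)
      have h3 := hV01 (R.state p.1 (h + 1) p.2)
      rw [Pi.smul_apply, smul_eq_mul, abs_mul, hr]
      refine (mul_le_of_le_one_right (abs_nonneg _) h1).trans ?_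
      rw [abs_of_nonneg (add_nonneg h2.1 h3.1)]
      exact add_le_add h2.2 h3.2
    · rw [nsmul_eq_mul]
      exact mul_le_mul_of_nonneg_right (card_dataSet_le (syncTime_le I R t) m) (by positivity)
  have hyy : y ⬝ᵥ y ≤ (d * (M * (t + 1) * (1 + H))) ^ 2 := by
    refine (Finset.sum_le_card_nsmul _ _ ((M * (t + 1) * (1 + (H : ℝ))) ^ 2)
      fun j _ => ?_).trans ?_
    · rw [← sq, ← sq_abs]
      exact pow_le_pow_left₀ (abs_nonneg _) (hyi j) 2
    · rw [Finset.card_univ, Fintype.card_fin, nsmul_eq_mul, mul_pow (d : ℝ)]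
      exact mul_le_mul_of_nonneg_right (by nlinarith : (d : ℝ) ≤ (d : ℝ) ^ 2) (sq_nonneg _)
  have hww : weights I R t h m V ⬝ᵥ weights I R t h m V ≤ y ⬝ᵥ y := by
    rw [weights, cov_eq_regGram hI, ← hy]
    exact regGram_inv_mulVec_le _ _ y
  have hnn : (0 : ℝ) ≤ d * (M * (t + 1) * (1 + H)) := by positivity
  refine abs_le_of_sq_le_sq (le_trans ?_ (hww.trans hyy)) hnn
  rw [sq]
  exact Finset.single_le_sum (f := fun i => weights I R t h m V i * weights I R t h m V i)
    (fun j _ => mul_self_nonneg _) (Finset.mem_univ i)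

theorem estValue_succ_eq {t j : ℕ} (hH : I.horizon = H) (hj : j < H) (m : Fin M) {β : ℝ}
    (hβ : ∀ h, I.bonus t m h = β) (s : S) :
    estValue I R t m (j + 1) s = ⨆ a, min ((I.feature (s, a)).ofLp ⬝ᵥ
      weights I R t (H - (j + 1)) m (estValue I R t m j) + β * √((I.feature (s, a)).ofLp ⬝ᵥ
        ((cov I R t (H - (j + 1)) m)⁻¹ *ᵥ (I.feature (s, a)).ofLp))) ((j + 1 : ℕ) : ℝ) := by
  have h1 : ((H : ℝ) - ((H - (j + 1) : ℕ) : ℝ)) = ((j + 1 : ℕ) : ℝ) := by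
    rw [Nat.cast_sub (by omega)]; ring
  simp only [estValue, qStep, ucb, hβ, hH, h1]

/-- Optimism: on the good event the estimated values have the form for which the deviation bounds
hold, and dominate the values of all policies. -/
theorem GridBound.optimism [Nonempty A] {t K : ℕ} {β W ℓ : ℝ}
    (hgood : GridBound mdp I R t K β W (√(2 * ℓ) / H) ℓ) (hcal : Calibrated d M H t K β W ℓ)
    (hlin : IsLinear mdp I.feature) (hI : I.ridge = 1) (hr : I.reward = mdp.r)
    (hH : I.horizon = H) (m : Fin M) (hβ : ∀ h, I.bonus t m h = β) (j : ℕ) (hj : j ≤ H) :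
    (∃ w B, (∀ i, |w i| ≤ W) ∧ (∀ i k, |B i k| ≤ 1) ∧
      estValue I R t m j = clipValue I.feature β j w B) ∧
    ∀ (π : Policy S A) s, value mdp π (H - j) s ≤ estValue I R t m j s := by
  induction j with
  | zero =>
    refine ⟨⟨0, 0, fun i => ?_, fun i k => by simp, ?_⟩, fun π s => ?_⟩
    · rw [hcal.weight_eq, Pi.zero_apply, abs_zero]; positivity
    · funext s
      simp [estValue, clipValue]
    · simp [value_horizon, estValue]
  | succ j ih =>
    obtain ⟨⟨w, B, hw, hB, hest⟩, hopt⟩ := ih (by omega)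
    set h := H - (j + 1) with hh
    have hhH : h < H := by omega
    have hcast : (H : ℝ) - ((h + 1 : ℕ) : ℝ) = j := by
      rw [show h + 1 = H - j by omega, Nat.cast_sub (by omega)]; ring
    have hback := hgood.abs_backup_sub_le hcal hlin hI hr m hhH hw hB
    rw [hcast, ← hest] at hback
    have hj0 : (0 : ℝ) ≤ j := Nat.cast_nonneg _
    have hVj : ∀ s, estValue I R t m j s ∈ Set.Icc (0 : ℝ) j := fun s => by
      rw [hest]; exact clipValue_mem _ _ hj0 _ _ s
    have hVm : Measurable (estValue I R t m j) := by
      rw [hest]; exact measurable_clipValue hlin.measurable_feature _ _ _ _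
    have := mdp.markov h
    have hsucc := estValue_succ_eq (R := R) hH (by omega : j < H) m hβ
    -- Domination at `j + 1` is proved before the description as a `clipValue`, which depends on it;
    -- conversely, the description at `j` is what makes the deviation bounds applicable here. Hence
    -- the joint induction.
    have hdom : ∀ (π : Policy S A) s, value mdp π h s ≤ estValue I R t m (j + 1) s := by
      intro π s
      refine value_le_of_forall mdp π h hhH s _ fun a => ?_
      rw [hsucc]
      refine le_trans ?_ (le_ciSup (Set.finite_range _).bddAbove a)
      have hval : ∀ y, value mdp π (h + 1) y ∈ Set.Icc (0 : ℝ) j := fun y => by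
        have := value_mem mdp π (h + 1) (by omega) y
        rwa [hcast] at this
      refine le_min ?_ ?_
      · have h1 := (abs_le.1 (hback (s, a))).1
        have h2 : ∫ y, value mdp π (h + 1) y ∂(mdp.P h (s, a)) ≤
            ∫ y, estValue I R t m j y ∂(mdp.P h (s, a)) := by
          refine integral_mono (integrable_of_mem_Icc (measurable_value mdp π _) hval)
            (integrable_of_mem_Icc hVm hVj) fun y => ?_
          have := hopt π y
          rwa [show H - j = h + 1 by omega] at this
        linarith
      -- Truncation preserves optimism, since no policy can earn more than `j + 1` in the remaining
      -- steps.
      · have h1 := (mdp.r_mem h hhH (s, a)).2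
        have h2 := (integral_mem_Icc (ν := mdp.P h (s, a)) (measurable_value mdp π (h + 1))
          hval).2
        push_cast
        linarith
    refine ⟨⟨weights I R t h m (estValue I R t m j), (cov I R t h m)⁻¹, fun i => ?_,
      fun i k => ?_, ?_⟩, hdom⟩
    · rw [hcal.weight_eq]
      refine abs_weights_le hI hr hlin.norm_feature_le hhH m (fun s => ?_) i
      exact ⟨(hVj s).1, (hVj s).2.trans (by exact_mod_cast (by omega : j ≤ H))⟩
    · rw [cov_eq_regGram hI]
      exact abs_regGram_inv_entry_le _ _ i k
    -- The truncation at zero in `clipValue` is inactive: the estimate dominates the value of a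
    -- constant policy, which is nonnegative.
    · funext s
      have a0 : A := Classical.arbitrary A
      let π : Policy S A := ⟨fun _ => Kernel.deterministic (fun _ => a0) measurable_const,
        fun _ => inferInstance⟩
      have h0 := (value_mem mdp π h hhH.le s).1.trans (hdom π s)
      rw [clipValue, ← hsucc, max_eq_right h0]

end Optimism

/-! ### Regret decomposition on the good event -/

section Regret

open Matrix

set_option linter.unusedSectionVars false

variable {S A : Type*} [MeasurableSpace S] [MeasurableSpace A] [MeasurableSingletonClass A]
  [Fintype A] {d M H : ℕ}

/-- The gap between the estimated value and the value of the policy in use. -/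
noncomputable def gap (mdp : EpisodicMDP S A H) (I : Input S A d M) (hφ : Measurable I.feature)
    (hsel : Measurable I.select) (R : Record S A M) (t : ℕ) (m : Fin M) (h : ℕ) (s : S) : ℝ :=
  estValue I R t m (H - h) s - value mdp (greedyPolicy I hφ hsel R t m) h s

/-- The gap, truncated to its range on the good event. -/
noncomputable def clipGap (mdp : EpisodicMDP S A H) (I : Input S A d M)
    (hφ : Measurable I.feature) (hsel : Measurable I.select) (R : Record S A M) (t : ℕ)
    (m : Fin M) (h : ℕ) (s : S) : ℝ :=
  max 0 (min (gap mdp I hφ hsel R t m h s) H)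

variable {mdp : EpisodicMDP S A H} {I : Input S A d M} {R : Record S A M}
  {hsel : Measurable I.select}

theorem clipGap_mem (hφ : Measurable I.feature) (t : ℕ) (m : Fin M) (h : ℕ) (s : S) :
    clipGap mdp I hφ hsel R t m h s ∈ Set.Icc (0 : ℝ) H :=
  ⟨le_max_left _ _, max_le (Nat.cast_nonneg _) (min_le_right _ _)⟩

section

variable {t K : ℕ} {β W ℓ : ℝ}
  (hgood : GridBound mdp I R t K β W (√(2 * ℓ) / H) ℓ) (hcal : Calibrated d M H t K β W ℓ)
  (hlin : IsLinear mdp I.feature) (hI : I.ridge = 1) (hr : I.reward = mdp.r)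
  (hH : I.horizon = H) (m : Fin M) (hβ : ∀ h, I.bonus t m h = β)

include hgood hcal hlin hI hr hH hβ

/-- Optimism gives the lower bound and the truncation of the estimates the upper one. The martingale
inequality needs increments bounded for every outcome, so it is proved for the clipped gap and
transferred to the gap here. -/
theorem GridBound.clipGap_eq [Nonempty A] {h : ℕ} (hh : h ≤ H) :
    clipGap mdp I hlin.measurable_feature hsel R t m h =
      gap mdp I hlin.measurable_feature hsel R t m h := by
  funext s
  obtain ⟨⟨w, B, -, -, hest⟩, hopt⟩ :=
    hgood.optimism hcal hlin hI hr hH m hβ (H - h) (by omega)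
  have h1 := hopt (greedyPolicy I hlin.measurable_feature hsel R t m) s
  rw [show H - (H - h) = h by omega] at h1
  have h2 := (clipValue_mem I.feature β (Nat.cast_nonneg (H - h)) w B s).2
  rw [← hest] at h2
  have h3 := (value_mem mdp (greedyPolicy I hlin.measurable_feature hsel R t m) h hh s).1
  have h4 : ((H - h : ℕ) : ℝ) ≤ H := by exact_mod_cast Nat.sub_le H h
  rw [clipGap, min_eq_left, max_eq_right]
  · rw [gap]; linarith
  · rw [gap]; linarith

/-- At the greedy action the estimate exceeds the true backup of the estimated next value by at most
two bonuses: one is added on purpose, the other bounds the regression error. What remains is the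
expected next gap, which differs from the realized one by the noise. -/
theorem GridBound.gap_le [Nonempty A] (hmax : ∀ (f : A → ℝ) (a : A), f a ≤ f (I.select f))
    {h : ℕ} (hh : h < H)
    (hact : R.action t h m = greedy I R t h m (R.state t h m)) :
    gap mdp I hlin.measurable_feature hsel R t m h (R.state t h m) ≤
      2 * β * width I R t h m -
        noise mdp R h (clipGap mdp I hlin.measurable_feature hsel R t m (h + 1)) (t, m) +
        gap mdp I hlin.measurable_feature hsel R t m (h + 1) (R.state t (h + 1) m) := by
  have := mdp.markov h
  obtain ⟨⟨w, B, hw, hB, hest⟩, -⟩ :=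
    hgood.optimism hcal hlin hI hr hH m hβ (H - (h + 1)) (by omega)
  set V := estValue I R t m (H - (h + 1)) with hV
  set π := greedyPolicy I hlin.measurable_feature hsel R t m with hπ
  set x := R.state t h m with hx
  have hz : R.pair t h m = (x, greedy I R t h m x) := by rw [Record.pair, hact]
  have hcast : (H : ℝ) - ((h + 1 : ℕ) : ℝ) = ((H - (h + 1) : ℕ) : ℝ) := by
    rw [Nat.cast_sub (by omega)]
  have hback := hgood.abs_backup_sub_le hcal hlin hI hr m hh hw hB (R.pair t h m)
  rw [hcast, ← hest] at hback
  have hwidth : √((I.feature (R.pair t h m)).ofLp ⬝ᵥ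
      ((cov I R t h m)⁻¹ *ᵥ (I.feature (R.pair t h m)).ofLp)) = width I R t h m := rfl
  rw [hwidth] at hback
  have hV01 : ∀ s, V s ∈ Set.Icc (0 : ℝ) ((H - (h + 1) : ℕ) : ℝ) := fun s => by
    rw [hest]; exact clipValue_mem _ _ (Nat.cast_nonneg _) _ _ s
  have hVm : Measurable V := by
    rw [hest]; exact measurable_clipValue hlin.measurable_feature _ _ _ _
  have hestle : estValue I R t m (H - h) x ≤ (I.feature (R.pair t h m)).ofLp ⬝ᵥ
      weights I R t h m V + β * width I R t h m := by
    have e : H - h = (H - (h + 1)) + 1 := by omega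
    have hsel' : ∀ a, estQ I R t h m (x, a) ≤ estQ I R t h m (x, greedy I R t h m x) :=
      fun a => hmax (fun a => estQ I R t h m (x, a)) a
    have h1 : estValue I R t m (H - h) x = ⨆ a, estQ I R t h m (x, a) := by
      rw [e, estValue, hH, show H - (H - (h + 1) + 1) = h by omega]
      simp only [estQ, hH]
    rw [h1]
    refine (ciSup_le hsel').trans ?_
    rw [← hz, estQ, hH, qStep, ucb, hβ]
    exact min_le_left _ _
  have hval : value mdp π h x = mdp.r h (R.pair t h m) +
      ∫ y, value mdp π (h + 1) y ∂(mdp.P h (R.pair t h m)) := by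
    rw [hz]
    exact value_of_deterministic mdp π h hh x
      (measurable_greedy hlin.measurable_feature hsel R t h m) rfl
  have hint : ∫ s, gap mdp I hlin.measurable_feature hsel R t m (h + 1) s
      ∂(mdp.P h (R.pair t h m)) = ∫ s, V s ∂(mdp.P h (R.pair t h m)) -
        ∫ y, value mdp π (h + 1) y ∂(mdp.P h (R.pair t h m)) :=
    integral_sub (integrable_of_mem_Icc hVm hV01)
      (integrable_of_mem_Icc (measurable_value mdp π _) fun y => value_mem mdp π (h + 1) hh y)
  rw [hgood.clipGap_eq hcal hlin hI hr hH m hβ (h := h + 1) (by omega), noise]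
  simp only
  rw [hint, gap, hval]
  linarith [(abs_le.1 hback).2]

/-- The one-step inequality telescopes along the visited states, and the gap vanishes at the
horizon. -/
theorem GridBound.gap_zero_le [Nonempty A]
    (hmax : ∀ (f : A → ℝ) (a : A), f a ≤ f (I.select f))
    (hact : ∀ h < H, R.action t h m = greedy I R t h m (R.state t h m)) :
    gap mdp I hlin.measurable_feature hsel R t m 0 (R.state t 0 m) ≤
      ∑ h ∈ Finset.range H, (2 * β * width I R t h m -
        noise mdp R h (clipGap mdp I hlin.measurable_feature hsel R t m (h + 1)) (t, m)) := by
  have key : ∀ n ≤ H, gap mdp I hlin.measurable_feature hsel R t m 0 (R.state t 0 m) ≤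
      ∑ h ∈ Finset.range n, (2 * β * width I R t h m -
        noise mdp R h (clipGap mdp I hlin.measurable_feature hsel R t m (h + 1)) (t, m)) +
      gap mdp I hlin.measurable_feature hsel R t m n (R.state t n m) := by
    intro n hn
    induction n with
    | zero => simp
    | succ n ih =>
      rw [Finset.sum_range_succ]
      have h1 := hgood.gap_le (hsel := hsel) hcal hlin hI hr hH m hβ hmax
        (show n < H by omega) (hact n (by omega))
      linarith [ih (by omega)]
  have h1 := key H le_rfl
  have h2 : gap mdp I hlin.measurable_feature hsel R t m H (R.state t H m) = 0 := by
    simp [gap, value_horizon, estValue]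
  linarith

theorem GridBound.optValue_sub_le [Nonempty A]
    (hmax : ∀ (f : A → ℝ) (a : A), f a ≤ f (I.select f))
    (hact : ∀ h < H, R.action t h m = greedy I R t h m (R.state t h m)) :
    optValue mdp 0 (R.state t 0 m) -
        value mdp (greedyPolicy I hlin.measurable_feature hsel R t m) 0 (R.state t 0 m) ≤
      ∑ h ∈ Finset.range H, (2 * β * width I R t h m -
        noise mdp R h (clipGap mdp I hlin.measurable_feature hsel R t m (h + 1)) (t, m)) := by
  refine le_trans ?_
    (hgood.gap_zero_le (hsel := hsel) hcal hlin hI hr hH m hβ hmax hact)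
  have hne : Nonempty (Policy S A) := ⟨greedyPolicy I hlin.measurable_feature hsel R t m⟩
  obtain ⟨-, hopt⟩ := hgood.optimism hcal hlin hI hr hH m hβ H le_rfl
  refine sub_le_sub_right (ciSup_le fun π => ?_) _
  have := hopt π (R.state t 0 m)
  rwa [Nat.sub_self] at this

end

/-- Deviation of the regret martingale at one step. -/
theorem IsRun.measure_gap_noise_le {Ω : Type*} [mΩ : MeasurableSpace Ω] {T : ℕ} {μ : Measure Ω}
    [IsProbabilityMeasure μ] {ℱ : Filtration (ℕ ×ₗ ℕ) mΩ} {R : Ω → Record S A M}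
    (hrun : IsRun mdp I T μ ℱ R) (hI : I.horizon = H)
    (hφ : Measurable I.feature) (hr : ∀ h, Measurable (I.reward h)) (hsel : Measurable I.select)
    {h : ℕ} (hh : h < H) (c : ℝ) {δ : ℝ} (hδ : 0 < δ) :
    μ {ω | Real.log (1 / δ) < ∑ τ ∈ Finset.range T, ∑ n,
      (c * noise mdp (R ω) h (clipGap mdp I hφ hsel (R ω) τ n (h + 1)) (τ, n) -
        (c * H) ^ 2 / 8)} ≤ ENNReal.ofReal δ := by
  -- The estimates and the policy of episode `τ` are functions of earlier episodes only, so the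
  -- clipped gap is a predictable integrand and no covering is needed.
  have key := hrun.measure_le_exp hI hφ hr hsel hh le_rfl
    (f := fun τ n ω s => c * clipGap mdp I hφ hsel (R ω) τ n (h + 1) s)
    (ρ := fun _ _ _ => |c * H|) (fun τ hτ n => ?_) (fun τ hτ n => measurable_const)
    (fun τ hτ n ω => exists_Icc_mul (clipGap_mem hφ τ n (h + 1))) hδ
  · refine le_trans (le_of_eq (congrArg μ ?_)) key
    ext ω
    simp only [noise, integral_const_mul, sq_abs, mul_sub]
  · have hhist := (hrun.history hI hφ hr hsel hτ).mono (filtration_le (ℱ := ℱ) (h' := h)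
      (Or.inr ⟨rfl, Nat.zero_le h⟩))
    have h1 := hhist.estValue hφ hr n (H - (h + 1)) (by omega)
    have h2 := HistoryMeasurable.value_greedyPolicy mdp (hI ▸ hhist) hI hφ hr hsel n
      (H - (h + 1)) (Nat.sub_le _ _)
    rw [show H - (H - (h + 1)) = h + 1 by omega] at h2
    exact (measurable_const.max ((h1.sub h2).min measurable_const)).const_mul c

/-- The regret on the good event. -/
theorem groupRegret_le [Nonempty A] {T : ℕ} {K : ℕ → ℕ} {β W ℓ : ℕ → ℝ}
    (hgood : ∀ t < T, GridBound mdp I R t (K t) (β t) (W t) (√(2 * ℓ t) / H) (ℓ t))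
    (hcal : ∀ t < T, Calibrated d M H t (K t) (β t) (W t) (ℓ t))
    (hlin : IsLinear mdp I.feature) (hI : I.ridge = 1) (hr : I.reward = mdp.r)
    (hH : I.horizon = H) (hβ : ∀ t m h, I.bonus t m h = β t)
    (hmax : ∀ (f : A → ℝ) (a : A), f a ≤ f (I.select f))
    (hact : ∀ t < T, ∀ h < H, ∀ m, R.action t h m = greedy I R t h m (R.state t h m))
    {b e : ℝ} (hb : ∀ t < T, β t ≤ b) (hb0 : 0 ≤ b)
    (hnoise : ∀ h < H, -∑ t ∈ Finset.range T, ∑ m,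
      noise mdp R h (clipGap mdp I hlin.measurable_feature hsel R t m (h + 1)) (t, m) ≤ e)
    {ε : ℝ} (hε : 0 < ε) :
    groupRegret mdp I hlin.measurable_feature hsel R T ≤
      H * (2 * b * (ε * M * T / 2 + (1 / ε + M * (√(2 * I.threshold) + 1)) *
        (d * Real.log (1 + M * T))) + e) := by
  have h1 : groupRegret mdp I hlin.measurable_feature hsel R T ≤
      ∑ h ∈ Finset.range H, (2 * b * (∑ t ∈ Finset.range T, ∑ m, width I R t h m) +
        -∑ t ∈ Finset.range T, ∑ m,
          noise mdp R h (clipGap mdp I hlin.measurable_feature hsel R t m (h + 1)) (t, m)) := by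
    have h2 : groupRegret mdp I hlin.measurable_feature hsel R T ≤
        ∑ m, ∑ t ∈ Finset.range T, ∑ h ∈ Finset.range H, (2 * b * width I R t h m -
        noise mdp R h (clipGap mdp I hlin.measurable_feature hsel R t m (h + 1)) (t, m)) := by
      refine Finset.sum_le_sum fun m _ => Finset.sum_le_sum fun t ht => ?_
      have ht' := Finset.mem_range.1 ht
      refine ((hgood t ht').optValue_sub_le (hsel := hsel) (hcal t ht') hlin hI hr hH m
        (hβ t m) hmax fun h hh => hact t ht' h hh m).trans (Finset.sum_le_sum fun h _ => ?_)
      have := mul_le_mul_of_nonneg_right (hb t ht') (width_nonneg (I := I) R t h m)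
      linarith
    refine h2.trans (le_of_eq ?_)
    rw [Finset.sum_comm]
    simp_rw [Finset.sum_comm (s := Finset.univ) (t := Finset.range H)]
    rw [Finset.sum_comm]
    refine Finset.sum_congr rfl fun h _ => ?_
    simp_rw [Finset.sum_sub_distrib, Finset.mul_sum]
    ring
  refine h1.trans ((Finset.sum_le_card_nsmul _ _ (2 * b * (ε * M * T / 2 +
    (1 / ε + M * (√(2 * I.threshold) + 1)) * (d * Real.log (1 + M * T))) + e)
    fun h hh => ?_).trans_eq (by rw [Finset.card_range, nsmul_eq_mul]))
  have hh' := Finset.mem_range.1 hh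
  refine add_le_add (mul_le_mul_of_nonneg_left ?_ (by positivity)) (hnoise h hh')
  refine (sum_width_le hI hlin.norm_feature_le R (hH ▸ hh') hε T).trans ?_
  have := mul_le_mul_of_nonneg_left (logDet_le hlin.norm_feature_le R h T)
    (show 0 ≤ 1 / ε + M * (√(2 * I.threshold) + 1) by positivity)
  linarith

end Regret

/-! ### Choice of grid and confidence level for given bonuses -/

theorem log_two_gt_half : (1 / 2 : ℝ) < Real.log 2 := by
  linarith [Real.log_two_gt_d9]

/-- A grid of polynomial size is fine enough. -/
theorem grid_errors {d M H t : ℕ} (hd : 0 < d) (hM : 0 < M) (hH : 0 < H) {β κ W : ℝ}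
    (hβ : 0 ≤ β) (hκ : (24 * (d * M * H * ((t : ℝ) + 1)) ^ 2 * (1 + β)) ^ 2 ≤ κ)
    (hW : W = d * (M * (t + 1) * (1 + H))) :
    M * ((t : ℝ) + 1) * ((d : ℝ) * (1 / κ)) ^ 2 ≤ 1 ∧
      M * ((t : ℝ) + 1) * ((d : ℝ) * (1 / κ) * H +
        (1 + d * (1 / κ)) * (2 * (d * (W / κ) + β * (d * √(1 / κ))))) ≤ 1 := by
  have hd' : (1 : ℝ) ≤ d := by exact_mod_cast hd
  have hM' : (1 : ℝ) ≤ M := by exact_mod_cast hM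
  have hH' : (1 : ℝ) ≤ H := by exact_mod_cast hH
  set N : ℝ := M * ((t : ℝ) + 1) with hN
  have hN1 : 1 ≤ N := one_le_mul_of_one_le_of_one_le hM'
    (by linarith [(Nat.cast_nonneg t : (0 : ℝ) ≤ t)])
  set Y : ℝ := d * M * H * ((t : ℝ) + 1) with hY
  have hYN : Y = d * H * N := by rw [hY, hN]; ring
  have hdH : (1 : ℝ) ≤ d * H := one_le_mul_of_one_le_of_one_le hd' hH'
  have hdN : (1 : ℝ) ≤ d * N := one_le_mul_of_one_le_of_one_le hd' hN1
  have hYdN : d * N ≤ Y := by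
    rw [hYN, show (d : ℝ) * H * N = d * N * H by ring]
    exact le_mul_of_one_le_right (by positivity) hH'
  have hY1 : 1 ≤ Y := hdN.trans hYdN
  have hNY : N ≤ Y := (le_mul_of_one_le_left (by positivity) hd').trans hYdN
  have hdY : (d : ℝ) ≤ Y := (le_mul_of_one_le_right (by positivity) hN1).trans hYdN
  have hYY : Y ≤ Y ^ 2 := by nlinarith
  -- The mesh must be of order `1 / x²` because the covariance rounding enters through `√(1 / κ) ≤ 1
  -- / x`; the factor `1 + β` absorbs the bonus in front of that square root.
  set x : ℝ := 24 * Y ^ 2 * (1 + β) with hx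
  clear_value Y N x
  have hx0 : 0 < x := by rw [hx]; positivity
  have hx24 : 24 * Y ^ 2 ≤ x := hx ▸ le_mul_of_one_le_right (by positivity) (by linarith)
  have hκ0 : 0 < κ := lt_of_lt_of_le (by positivity) hκ
  have hxκ : 24 * x ≤ κ := by nlinarith
  have hr : √(1 / κ) ≤ 1 / x := by
    rw [Real.sqrt_le_left (by positivity), div_pow, one_pow]
    exact one_div_le_one_div_of_le (by positivity) hκ
  have hdκ : d * (1 / κ) ≤ 1 := by
    rw [mul_one_div, div_le_one hκ0]; nlinarith
  have hY2κ : Y ^ 2 * (1 / κ) ≤ 1 / 576 := by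
    rw [mul_one_div, div_le_iff₀ hκ0]; linarith
  have hW2 : d * W * N ≤ 2 * Y ^ 2 := by
    rw [hW, hYN]
    have : d * (d * (N * (1 + H))) * N ≤ d * (d * (N * (2 * H ^ 2))) * N := by
      gcongr; nlinarith
    linarith
  have hβx : Y ^ 2 * β * (1 / x) ≤ 1 / 24 := by
    rw [mul_one_div, div_le_iff₀ hx0, hx]; nlinarith [sq_nonneg Y]
  constructor
  · have h1 : N * (d * (1 / κ)) ^ 2 ≤ Y * (d * (1 / κ)) := by
      rw [pow_two]
      exact mul_le_mul hNY (mul_le_of_le_one_left (by positivity) hdκ) (by positivity)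
        (by positivity)
    have h2 : Y * (d * (1 / κ)) ≤ Y ^ 2 * (1 / κ) := by
      have := mul_le_mul_of_nonneg_left (mul_le_mul_of_nonneg_right hdY
        (show 0 ≤ 1 / κ by positivity)) (show 0 ≤ Y by positivity)
      linarith
    linarith
  · have h1 : N * (d * (1 / κ) * H) ≤ Y ^ 2 * (1 / κ) := by
      calc N * (d * (1 / κ) * H) = Y * (1 / κ) := by rw [hYN]; ring
        _ ≤ _ := by gcongr
    have hWnn : 0 ≤ W := by rw [hW]; positivity
    have h2 : N * (d * (W / κ)) ≤ 2 * Y ^ 2 * (1 / κ) := by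
      calc N * (d * (W / κ)) = d * W * N * (1 / κ) := by ring
        _ ≤ _ := by gcongr
    have h3 : N * (β * (d * √(1 / κ))) ≤ Y ^ 2 * β * (1 / x) := by
      calc N * (β * (d * √(1 / κ))) = d * N * β * √(1 / κ) := by ring
        _ ≤ Y ^ 2 * β * (1 / x) := by
          gcongr; exact hYdN.trans hYY
    have h4 : N * ((1 + d * (1 / κ)) * (2 * (d * (W / κ) + β * (d * √(1 / κ))))) ≤
        2 * (2 * (2 * Y ^ 2 * (1 / κ) + Y ^ 2 * β * (1 / x))) := by
      calc N * ((1 + d * (1 / κ)) * (2 * (d * (W / κ) + β * (d * √(1 / κ))))) =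
          (1 + d * (1 / κ)) * (2 * (N * (d * (W / κ)) + N * (β * (d * √(1 / κ))))) := by ring
        _ ≤ _ := by
          gcongr
          linarith
    rw [mul_add]
    linarith

/-- The size of the bonus dominates the deviation level of a union bound over the grid. -/
theorem bonus_dominates {d H : ℕ} (hd : 0 < d) (hH : 0 < H) {β Λ ℓ : ℝ}
    (hΛ : 1 / 2 ≤ Λ) (hβ : 100 * d * H * √Λ ≤ β)
    (hℓ : ℓ ≤ (d : ℝ) ^ 2 * (57 * Λ + 6 * (β / (d * H)))) :
    1 + H * √(2 * ℓ) + 2 * d * H ≤ β := by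
  have hd' : (1 : ℝ) ≤ d := by exact_mod_cast hd
  have hH' : (1 : ℝ) ≤ H := by exact_mod_cast hH
  have hdH : (1 : ℝ) ≤ d * H := one_le_mul_of_one_le_of_one_le hd' hH'
  -- In the scaled bonus `b` the claim reduces to `57 Λ + 6 b ≤ b² / 8`, which follows from `b ≥ 100
  -- √Λ ≥ 70`.
  set b := β / (d * H) with hb
  have hβb : β = d * H * b := by rw [hb]; field_simp
  have hbΛ : 100 * √Λ ≤ b := by
    rw [hb, le_div_iff₀ (by positivity)]; linarith
  have hs : √Λ ^ 2 = Λ := Real.sq_sqrt (by linarith)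
  have hs1 : (7 / 10 : ℝ) ≤ √Λ := by
    rw [Real.le_sqrt' (by norm_num)]; linarith
  have hb70 : 70 ≤ b := by linarith
  have hΛb : 10000 * Λ ≤ b ^ 2 := by nlinarith
  have h1 : √(2 * ℓ) ≤ d * b / 2 := by
    rw [Real.sqrt_le_left (by positivity)]
    have : (d : ℝ) ^ 2 * (57 * Λ + 6 * b) ≤ (d : ℝ) ^ 2 * (b ^ 2 / 8) := by
      gcongr; nlinarith
    calc 2 * ℓ ≤ 2 * ((d : ℝ) ^ 2 * (b ^ 2 / 8)) := by linarith
      _ = (d * b / 2) ^ 2 := by ring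
  have h2 : H * √(2 * ℓ) ≤ H * (d * b / 2) := by gcongr
  rw [hβb]
  nlinarith

/-- Admissible bonuses are calibrated for a union bound of total mass `α / (4 (t + 1)²)`. -/
theorem exists_calibrated {d M H t : ℕ} (hd : 0 < d) (hM : 0 < M) (hH : 0 < H) {α β : ℝ}
    (hα : 0 < α) (hα1 : α < 1)
    (hβ : 100 * d * H * √(Real.log (2 * d * M * H * ((t : ℝ) + 1) / α)) ≤ β) :
    ∃ (K : ℕ) (W δ : ℝ), 0 < δ ∧
      M * H * ((t : ℝ) + 1) * (2 * K + 1) ^ (2 * d + d ^ 2) * δ = α / (4 * ((t : ℝ) + 1) ^ 2) ∧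
      Calibrated d M H t K β W (Real.log (1 / δ)) := by
  have hd' : (1 : ℝ) ≤ d := by exact_mod_cast hd
  have hM' : (1 : ℝ) ≤ M := by exact_mod_cast hM
  have hH' : (1 : ℝ) ≤ H := by exact_mod_cast hH
  have ht' : (1 : ℝ) ≤ (t : ℝ) + 1 := by linarith [(Nat.cast_nonneg t : (0 : ℝ) ≤ t)]
  have hdH : (1 : ℝ) ≤ d * H := one_le_mul_of_one_le_of_one_le hd' hH'
  have hMt : (1 : ℝ) ≤ M * ((t : ℝ) + 1) := one_le_mul_of_one_le_of_one_le hM' ht'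
  have hMH : (1 : ℝ) ≤ M * H := one_le_mul_of_one_le_of_one_le hM' hH'
  set Y : ℝ := d * M * H * ((t : ℝ) + 1) with hY
  have hYe : Y = (d * H) * (M * ((t : ℝ) + 1)) := by rw [hY]; ring
  have hdHY : d * H ≤ Y := by rw [hYe]; exact le_mul_of_one_le_right (by positivity) hMt
  have hY1 : 1 ≤ Y := hdH.trans hdHY
  rw [show 2 * (d : ℝ) * M * H * ((t : ℝ) + 1) / α = 2 * Y / α by rw [hY]; ring] at hβ
  set Λ := Real.log (2 * Y / α) with hΛ
  have hYα : 2 * Y ≤ 2 * Y / α := le_div_self (by positivity) hα hα1.le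
  have hlog2 : Real.log 2 ≤ Λ := Real.log_le_log (by norm_num) (by linarith)
  have hlogY : Real.log Y ≤ Λ := Real.log_le_log (by positivity) (by linarith)
  have hΛ2 : 1 / 2 ≤ Λ := log_two_gt_half.le.trans hlog2
  have hβ0 : 0 ≤ β := le_trans (by positivity) hβ
  set b := β / (d * H) with hb
  have hβb : β = d * H * b := by rw [hb]; field_simp
  have hb0 : 0 ≤ b := by positivity
  set x : ℝ := 24 * Y ^ 2 * (1 + β) with hx
  have hx24 : 24 ≤ x := by
    rw [hx, mul_assoc]
    exact le_mul_of_one_le_right (by norm_num)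
      (one_le_mul_of_one_le_of_one_le (one_le_pow₀ hY1) (by linarith))
  set K : ℕ := ⌈x ^ 2⌉₊ with hK
  have hKx : x ^ 2 ≤ K := Nat.le_ceil _
  have hK0 : 0 < K := Nat.ceil_pos.2 (by positivity)
  have hKlt : (K : ℝ) < x ^ 2 + 1 := Nat.ceil_lt_add_one (by positivity)
  -- The grid depends on `β`, and `β` must dominate the level set by the grid size. The circle is
  -- harmless: `log (1 + β) ≤ Λ + b` is linear in `b`, whereas the level is compared with a multiple
  -- of `b²`. No upper bound on `β` is needed.
  have hlogK : Real.log (2 * K + 1) ≤ 18 * Λ + 2 * b := by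
    have h1 : Real.log (1 + β) ≤ Λ + b := by
      have : 1 + β ≤ Y * (1 + b) := by
        have := mul_le_mul_of_nonneg_right hdHY hb0
        rw [hβb]; linarith
      calc Real.log (1 + β) ≤ Real.log (Y * (1 + b)) :=
            Real.log_le_log (by positivity) this
        _ = Real.log Y + Real.log (1 + b) := Real.log_mul (by positivity) (by positivity)
        _ ≤ Λ + b := by
          have := Real.log_le_sub_one_of_pos (show 0 < 1 + b by positivity)
          linarith
    calc Real.log (2 * K + 1) ≤ Real.log (2 ^ 12 * Y ^ 4 * (1 + β) ^ 2) := by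
          refine Real.log_le_log (by positivity) ?_
          have : 2 * (K : ℝ) + 1 ≤ 4 * x ^ 2 := by
            have : (24 : ℝ) ^ 2 ≤ x ^ 2 := by gcongr
            linarith
          refine this.trans ?_
          have : 4 * x ^ 2 = 2304 * (Y ^ 4 * (1 + β) ^ 2) := by rw [hx]; ring
          rw [this, mul_assoc]
          gcongr
          norm_num
      _ = 12 * Real.log 2 + 4 * Real.log Y + 2 * Real.log (1 + β) := by
          rw [Real.log_mul (by positivity) (by positivity),
            Real.log_mul (by positivity) (by positivity), Real.log_pow, Real.log_pow,
            Real.log_pow]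
          norm_num
      _ ≤ _ := by linarith
  have hK1 : (1 : ℝ) ≤ 2 * K + 1 := by linarith [(Nat.cast_nonneg K : (0 : ℝ) ≤ K)]
  set n := 2 * d + d ^ 2 with hn
  have hn3 : (n : ℝ) ≤ 3 * (d : ℝ) ^ 2 := by
    have : (d : ℝ) ≤ (d : ℝ) ^ 2 := le_self_pow₀ hd' two_ne_zero
    rw [hn]; push_cast; linarith
  -- Chosen so that `δ = 1 / (q (2K+1)ⁿ)` makes the union bound over agents, steps, synchronization
  -- times and grid points equal to `α / (4 (t+1)²)`.
  set q : ℝ := 4 * (M * H) * ((t : ℝ) + 1) ^ 3 / α with hq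
  have hq1 : 1 < q := by
    rw [hq, lt_div_iff₀ hα]
    have := one_le_mul_of_one_le_of_one_le hMH (one_le_pow₀ ht' (n := 3))
    linarith
  have hlogq : Real.log q ≤ 3 * Λ := by
    have h1 : q ≤ (2 * Y / α) ^ 3 := by
      have hα3 : α ^ 3 ≤ α := by
        calc α ^ 3 ≤ α ^ 1 := pow_le_pow_of_le_one hα.le hα1.le (by norm_num)
          _ = α := pow_one α
      have h2 : (M : ℝ) * H * ((t : ℝ) + 1) ^ 3 ≤ Y ^ 3 := by
        have : M * H ≤ ((d : ℝ) * M * H) ^ 3 := by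
          have e : (d : ℝ) * M * H = d * (M * H) := by ring
          have h3 : M * H ≤ (d : ℝ) * M * H := by
            rw [e]; exact le_mul_of_one_le_left (by positivity) hd'
          exact h3.trans (le_self_pow₀ (hMH.trans h3) (by norm_num))
        rw [hY, mul_pow]
        gcongr
      rw [hq, div_pow]
      have : 4 * ((M : ℝ) * H) * ((t : ℝ) + 1) ^ 3 ≤ (2 * Y) ^ 3 := by
        rw [mul_pow]
        have : 0 ≤ Y ^ 3 := by positivity
        linarith
      gcongr
    calc Real.log q ≤ Real.log ((2 * Y / α) ^ 3) := Real.log_le_log (by positivity) h1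
      _ = 3 * Λ := by rw [Real.log_pow, ← hΛ]; norm_num
  set δ : ℝ := (q * (2 * K + 1) ^ n)⁻¹ with hδ
  have hlogδ : Real.log (1 / δ) = Real.log q + n * Real.log (2 * K + 1) := by
    rw [hδ, one_div, inv_inv, Real.log_mul (by positivity) (by positivity), Real.log_pow]
  obtain ⟨h1, h2⟩ := grid_errors (t := t) hd hM hH hβ0 hKx rfl
  refine ⟨K, _, δ, by positivity, ?_, hK0, hβ0, rfl, ?_, h1, h2, ?_⟩
  · rw [hδ, hq]; field_simp
  · rw [hδ, one_div, inv_inv]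
    exact Real.log_pos (one_lt_mul_of_lt_of_le hq1 (one_le_pow₀ hK1))
  · refine bonus_dominates hd hH hΛ2 hβ ?_
    rw [← hb, hlogδ]
    have hlogK0 : 0 ≤ Real.log (2 * K + 1) := Real.log_nonneg hK1
    have h3 : n * Real.log (2 * K + 1) ≤ 3 * (d : ℝ) ^ 2 * (18 * Λ + 2 * b) := by gcongr
    have h4 : Λ ≤ (d : ℝ) ^ 2 * Λ := le_mul_of_one_le_left (by linarith) (one_le_pow₀ hd')
    clear_value Λ b n q K
    linarith

/-! ### Union over episodes, and the final numerical bounds -/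

theorem sum_inv_sq_le (T : ℕ) :
    ∑ t ∈ Finset.range (T + 1), 1 / ((t : ℝ) + 1) ^ 2 ≤ 2 - 1 / ((T : ℝ) + 1) := by
  induction T with
  | zero => norm_num
  | succ T ih =>
    rw [Finset.sum_range_succ]
    have h : 1 / ((T : ℝ) + 1 + 1) ^ 2 ≤ 1 / ((T : ℝ) + 1) - 1 / ((T : ℝ) + 1 + 1) := by
      rw [div_sub_div _ _ (by positivity) (by positivity),
        div_le_div_iff₀ (by positivity) (by positivity)]
      nlinarith [(Nat.cast_nonneg T : (0 : ℝ) ≤ T)]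
    push_cast
    linarith

/-- With the scale `2√L / (√N H)` the compensators add up to `L / 2`, so the scaled sum is at most
`3L/2`, and the constant becomes `3/4 ≤ 1`. The scale is negative because the lower tail is wanted.
-/
theorem neg_le_of_exp_level {ι : Type*} (s : Finset ι) (f : ι → ℝ) {L N H : ℝ} (hL : 0 < L)
    (hN : 0 < N) (hH : 0 < H) (hcard : (s.card : ℝ) = N)
    (h : ∑ i ∈ s, ((-(2 * √L / (√N * H))) * f i - (-(2 * √L / (√N * H)) * H) ^ 2 / 8) ≤ L) :
    -∑ i ∈ s, f i ≤ H * √N * √L := by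
  have hy : 0 < √L := Real.sqrt_pos.2 hL
  have hs : 0 < √N := Real.sqrt_pos.2 hN
  have hyL : √L ^ 2 = L := Real.sq_sqrt hL.le
  have hsN : √N ^ 2 = N := Real.sq_sqrt hN.le
  rw [Finset.sum_sub_distrib, ← Finset.mul_sum, Finset.sum_const, nsmul_eq_mul, hcard] at h
  have h1 : N * ((-(2 * √L / (√N * H)) * H) ^ 2 / 8) = L / 2 := by
    field_simp
    rw [hyL, hsN]; ring
  rw [h1] at h
  set X := ∑ i ∈ s, f i
  have h2 : -(2 * √L / (√N * H)) * X = 2 * √L * (-X) / (√N * H) := by ring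
  have h3 : 2 * √L * (-X) / (√N * H) ≤ 3 / 2 * √L ^ 2 := by linarith
  rw [div_le_iff₀ (by positivity)] at h3
  have h4 : √L * (-X) ≤ √L * (3 / 4 * (H * √N * √L)) := by linarith
  have h5 := le_of_mul_le_mul_left h4 hy
  have : 0 < H * √N * √L := by positivity
  linarith

/-- The regret bound before simplification of its numerical form. -/
theorem IsRun.measure_groupRegret_le {S A Ω : Type*} [MeasurableSpace S] [MeasurableSpace A]
    [MeasurableSingletonClass A] [Fintype A] [mΩ : MeasurableSpace Ω] {μ : Measure Ω}
    [IsProbabilityMeasure μ] {d M H T : ℕ} (hd : 0 < d) (hM : 0 < M) (hH : 0 < H) (hT : 0 < T)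
    {α : ℝ} (hα : 0 < α) (hα1 : α < 1) {mdp : EpisodicMDP S A H}
    {φ : S × A → EuclideanSpace ℝ (Fin d)} (hlin : IsLinear mdp φ) (thr : ℝ) {β : ℕ → ℝ} {b : ℝ}
    (hβ : ∀ t < T, 100 * d * H * √(Real.log (2 * d * M * H * ((t : ℝ) + 1) / α)) ≤ β t)
    (hb : ∀ t < T, β t ≤ b) {select : (A → ℝ) → A} (hsel : Measurable select)
    (hmax : ∀ (f : A → ℝ) (a : A), f a ≤ f (select f))
    {ℱ : Filtration (ℕ ×ₗ ℕ) mΩ} {R : Ω → Record S A M}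
    (hrun : IsRun mdp (mkInput mdp φ 1 thr (fun t _ _ => β t) select) T μ ℱ R)
    {ε : ℝ} (hε : 0 < ε) :
    μ {ω | H * (2 * b * (ε * M * T / 2 + (1 / ε + M * (√(2 * thr) + 1)) *
        (d * Real.log (1 + M * T))) + H * √(M * T) * √(Real.log (2 * H / α))) <
      groupRegret mdp (mkInput mdp φ 1 thr (fun t _ _ => β t) select)
        hlin.measurable_feature hsel (R ω) T} ≤ ENNReal.ofReal α := by
  have : Nonempty A := ⟨select 0⟩
  set I : Input S A d M := mkInput mdp φ 1 thr (fun t _ _ => β t) select with hI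
  have hφ : Measurable I.feature := hlin.measurable_feature
  have hr : ∀ h, Measurable (I.reward h) := mdp.measurable_r
  have hselI : Measurable I.select := hsel
  have hM' : (0 : ℝ) < M := by exact_mod_cast hM
  have hT' : (0 : ℝ) < T := by exact_mod_cast hT
  have hH' : (1 : ℝ) ≤ H := by exact_mod_cast hH
  have hH0 : (0 : ℝ) < H := by linarith
  -- Bonuses are controlled only for `t < T`; later episodes receive dummy parameters so that the
  -- choice can be made for all `t`.
  have hcal : ∀ t, ∃ (K : ℕ) (W δ : ℝ), t < T → 0 < δ ∧
      M * H * ((t : ℝ) + 1) * (2 * K + 1) ^ (2 * d + d ^ 2) * δ = α / (4 * ((t : ℝ) + 1) ^ 2) ∧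
      Calibrated d M H t K (β t) W (Real.log (1 / δ)) := fun t => by
    by_cases ht : t < T
    · obtain ⟨K, W, δ, h⟩ := exists_calibrated hd hM hH hα hα1 (hβ t ht)
      exact ⟨K, W, δ, fun _ => h⟩
    · exact ⟨0, 0, 0, fun h => absurd h ht⟩
  choose K W δ hcal using hcal
  set L : ℝ := Real.log (2 * H / α) with hL
  have hLpos : 0 < L := Real.log_pos (by rw [lt_div_iff₀ hα]; linarith)
  have hMT : (0 : ℝ) < M * T := by positivity
  set c : ℝ := -(2 * √L / (√(M * T) * H)) with hc
  have hL1 : L = Real.log (1 / (α / (2 * H))) := by rw [hL, one_div_div]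
  -- A large regret forces a failure of some grid bound or of some regret martingale; each of the
  -- two families has probability at most `α / 2`.
  have hsub : {ω | H * (2 * b * (ε * M * T / 2 + (1 / ε + M * (√(2 * thr) + 1)) *
        (d * Real.log (1 + M * T))) + H * √(M * T) * √L) <
      groupRegret mdp I hφ hselI (R ω) T} ⊆
      (⋃ t ∈ Finset.range T, {ω | ¬ GridBound mdp I (R ω) t (K t) (β t) (W t)
        (√(2 * Real.log (1 / δ t)) / H) (Real.log (1 / δ t))}) ∪
      ⋃ h ∈ Finset.range H, {ω | Real.log (1 / (α / (2 * H))) <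
        ∑ τ ∈ Finset.range T, ∑ n,
          (c * noise mdp (R ω) h (clipGap mdp I hφ hselI (R ω) τ n (h + 1)) (τ, n) -
            (c * H) ^ 2 / 8)} := by
    intro ω hω
    by_contra hcon
    simp only [Set.mem_union, Set.mem_iUnion, Finset.mem_range, Set.mem_ofPred_eq, not_or,
      not_exists, not_not, not_lt, exists_prop, not_and] at hcon
    refine absurd (show _ < groupRegret mdp I hφ hselI (R ω) T from hω) (not_lt.2 ?_)
    refine groupRegret_le (I := I) (hsel := hselI) (ℓ := fun t => Real.log (1 / δ t)) hcon.1
      (fun t ht => (hcal t ht).2.2) hlin rfl rfl rfl (fun _ _ _ => rfl) hmax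
      (fun t ht h hh m => hrun.acts t ht h hh m ω) hb
      ((hcal 0 hT).2.2.bonus_nonneg.trans (hb 0 hT)) (fun h hh => ?_) hε
    have h1 := hcon.2 h hh
    rw [← hL1] at h1
    simp_rw [← Finset.sum_product'] at h1 ⊢
    exact neg_le_of_exp_level _ _ hLpos hMT hH0 (by simp [mul_comm]) h1
  refine (measure_mono hsub).trans ((measure_union_le _ _).trans ?_)
  have h1 : μ (⋃ t ∈ Finset.range T, {ω | ¬ GridBound mdp I (R ω) t (K t) (β t) (W t)
      (√(2 * Real.log (1 / δ t)) / H) (Real.log (1 / δ t))}) ≤ ENNReal.ofReal (α / 2) := by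
    calc _ ≤ ∑ t ∈ Finset.range T, ENNReal.ofReal (α / 4 * (1 / ((t : ℝ) + 1) ^ 2)) := by
          refine (measure_biUnion_finset_le _ _).trans (Finset.sum_le_sum fun t ht => ?_)
          obtain ⟨hδ, he, -⟩ := hcal t (Finset.mem_range.1 ht)
          refine (hrun.measure_not_gridBound_le rfl hφ hr hselI (Finset.mem_range.1 ht) (K t) (β t)
            (W t) _ hδ).trans_eq ?_
          rw [he, div_mul_div_comm, mul_one]
      _ = ENNReal.ofReal (∑ t ∈ Finset.range T, α / 4 * (1 / ((t : ℝ) + 1) ^ 2)) :=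
          (ENNReal.ofReal_sum_of_nonneg fun t _ => by positivity).symm
      _ ≤ _ := by
          refine ENNReal.ofReal_le_ofReal ?_
          rw [← Finset.mul_sum]
          obtain ⟨n, rfl⟩ : ∃ n, T = n + 1 := ⟨T - 1, by omega⟩
          have h2 := sum_inv_sq_le n
          have h3 : 0 < 1 / ((n : ℝ) + 1) := by positivity
          nlinarith
  have h2 : μ (⋃ h ∈ Finset.range H, {ω | Real.log (1 / (α / (2 * H))) <
        ∑ τ ∈ Finset.range T, ∑ n,
          (c * noise mdp (R ω) h (clipGap mdp I hφ hselI (R ω) τ n (h + 1)) (τ, n) -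
            (c * H) ^ 2 / 8)}) ≤ ENNReal.ofReal (α / 2) := by
    calc _ ≤ ∑ h ∈ Finset.range H, ENNReal.ofReal (α / (2 * H)) :=
          (measure_biUnion_finset_le _ _).trans (Finset.sum_le_sum fun h hh =>
            hrun.measure_gap_noise_le rfl hφ hr hselI (Finset.mem_range.1 hh) c (by positivity))
      _ = ENNReal.ofReal (α / 2) := by
          rw [← ENNReal.ofReal_sum_of_nonneg fun _ _ => by positivity, Finset.sum_const,
            Finset.card_range, nsmul_eq_mul]
          congr 1
          field_simp
  refine (add_le_add h1 h2).trans_eq ?_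
  rw [← ENNReal.ofReal_add (by positivity) (by positivity), add_halves]

/-- The regret bound in terms of the logarithmic factors. -/
theorem regret_bound_numerics {d M H T : ℕ} (hd : 0 < d) (hM : 0 < M) (hH : 0 < H) (hT : 0 < T)
    {α thr c : ℝ} (hα : 0 < α) (hα1 : α < 1) (hthr : 0 ≤ thr) (hc : 0 ≤ c) :
    ∃ ε : ℝ, 0 < ε ∧
    H * (2 * (c * d * H * √(Real.log (2 * d * M * H * T / α))) *
      (ε * M * T / 2 + (1 / ε + M * (√(2 * thr) + 1)) * (d * Real.log (1 + M * T))) +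
        H * √(M * T) * √(Real.log (2 * H / α))) ≤
      (24 * c + 8) * (d * H ^ 2 * (d * M * √(max 1 thr) + √(d * M * T)) * √(Real.log (2 / α))) *
        Real.log (2 * d * M * H * T) ^ 2 := by
  have hd' : (1 : ℝ) ≤ d := by exact_mod_cast hd
  have hM' : (1 : ℝ) ≤ M := by exact_mod_cast hM
  have hH' : (1 : ℝ) ≤ H := by exact_mod_cast hH
  have hT' : (1 : ℝ) ≤ T := by exact_mod_cast hT
  have hMT : (1 : ℝ) ≤ M * T := one_le_mul_of_one_le_of_one_le hM' hT'
  have hdH : (1 : ℝ) ≤ d * H := one_le_mul_of_one_le_of_one_le hd' hH'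
  have hdMT : (1 : ℝ) ≤ d * (M * T) := one_le_mul_of_one_le_of_one_le hd' hMT
  have hNe : (2 : ℝ) * d * M * H * T = 2 * ((d * H) * (M * T)) := by ring
  have hN1 : 1 + (M : ℝ) * T ≤ 2 * d * M * H * T := by
    have := le_mul_of_one_le_left (show (0 : ℝ) ≤ M * T by positivity) hdH
    rw [hNe]; linarith
  have hN2 : 2 * (H : ℝ) ≤ 2 * d * M * H * T := by
    have := le_mul_of_one_le_right (show (0 : ℝ) ≤ H by positivity) hdMT
    calc 2 * (H : ℝ) ≤ 2 * (H * (d * (M * T))) := by linarith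
      _ = _ := by ring
  set N : ℝ := 2 * d * M * H * T with hN
  have hN0 : 0 < N := by positivity
  set G := Real.log N with hG
  set E := Real.log (2 / α) with hE
  have hG2 : 1 / 2 ≤ G :=
    log_two_gt_half.le.trans (Real.log_le_log (by norm_num) (by linarith))
  have hE2 : 1 / 2 ≤ E := log_two_gt_half.le.trans
    (Real.log_le_log (by norm_num) (le_div_self (by norm_num) hα hα1.le))
  -- Both logarithms are at least `1/2`, so their sum is at most four times their product; this
  -- separates the dependence on `α` from that on the dimensions.
  have hlogN : Real.log (N / α) ≤ 4 * (G * E) := by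
    have h1 : Real.log (N / α) ≤ G + E := by
      rw [hG, hE, ← Real.log_mul (by positivity) (by positivity)]
      refine Real.log_le_log (by positivity) ?_
      rw [mul_div_assoc']
      gcongr
      linarith
    nlinarith
  have hlogH : Real.log (2 * H / α) ≤ 4 * (G * E) :=
    (Real.log_le_log (by positivity) (by gcongr)).trans hlogN
  have hlogMT : Real.log (1 + M * T) ≤ G := Real.log_le_log (by positivity) hN1
  have hlogMT0 : 0 ≤ Real.log (1 + (M : ℝ) * T) := Real.log_nonneg (by linarith)
  have hsG : √G ≤ 2 * G := by
    rw [Real.sqrt_le_left (by linarith)]; nlinarith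
  have hsplit : √(4 * (G * E)) = 2 * √G * √E := by
    rw [Real.sqrt_mul (by norm_num), Real.sqrt_mul (by linarith), show (4 : ℝ) = 2 ^ 2 by norm_num,
      Real.sqrt_sq (by norm_num)]
    ring
  have hsN : √(Real.log (N / α)) ≤ 2 * √G * √E := hsplit ▸ Real.sqrt_le_sqrt hlogN
  have hsH : √(Real.log (2 * H / α)) ≤ 2 * √G * √E := hsplit ▸ Real.sqrt_le_sqrt hlogH
  set P : ℝ := M * T with hP
  set r : ℝ := √(d * G) with hr
  have hr0 : 0 < r := Real.sqrt_pos.2 (by positivity)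
  have hp0 : 0 < √P := Real.sqrt_pos.2 (by linarith)
  have hr2 : r ^ 2 = d * G := Real.sq_sqrt (by positivity)
  have hp2 : √P ^ 2 = P := Real.sq_sqrt (by linarith)
  set B : ℝ := d * M * √(max 1 thr) + √(d * M * T) with hB
  have hrp : r * √P = √(d * M * T) * √G := by
    rw [hr, ← Real.sqrt_mul (by positivity), ← Real.sqrt_mul (by positivity)]
    congr 1
    rw [hP]; ring
  have hthr2 : √(2 * thr) + 1 ≤ 3 * √(max 1 thr) := by
    have h1 : 1 ≤ √(max 1 thr) := Real.one_le_sqrt.2 (le_max_left _ _)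
    have h2 : √(2 * thr) ≤ 2 * √(max 1 thr) := by
      rw [Real.sqrt_le_left (by positivity), mul_pow, Real.sq_sqrt (by positivity)]
      linarith [le_max_right 1 thr]
    linarith
  have hPB : √P ≤ B := by
    have h1 : √P ≤ √(d * M * T) := by
      refine Real.sqrt_le_sqrt ?_
      rw [mul_assoc]
      exact le_mul_of_one_le_left (by positivity) hd'
    have : 0 ≤ d * M * √(max 1 thr) := by positivity
    linarith
  have hB0 : 0 < B := hp0.trans_le hPB
  clear_value N G E P r B
  -- This `ε` balances the two centralized terms: `ε M T` and `d G / ε` both equal `r √P = √(d M T)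
  -- √G`.
  refine ⟨r / √P, by positivity, ?_⟩
  have hsum : r / √P * M * T / 2 + (1 / (r / √P) + M * (√(2 * thr) + 1)) *
      (d * Real.log (1 + P)) ≤ 3 * B * G := by
    have h1 : r / √P * M * T = r * √P := by
      rw [mul_assoc, ← hP]; field_simp
      exact hp2.symm
    have h2 : 1 / (r / √P) * (d * G) = r * √P := by
      rw [← hr2]; field_simp
    have h3 : (1 / (r / √P) + M * (√(2 * thr) + 1)) * (d * Real.log (1 + P)) ≤
        (1 / (r / √P) + M * (3 * √(max 1 thr))) * (d * G) := by gcongr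
    have h4 : r * √P ≤ √(d * M * T) * (2 * G) := by rw [hrp]; gcongr
    rw [h1, hB]
    rw [add_mul _ _ (d * G), h2] at h3
    linarith
  -- The logarithms contribute at most the power `3/2`, half a power from the bonus and one from the
  -- widths, rounded up to the integer exponent two.
  have hsq : √G * G ≤ 2 * G ^ 2 :=
    (mul_le_mul_of_nonneg_right hsG (by linarith)).trans_eq (by ring)
  have hsq' : √G ≤ 4 * G ^ 2 := by
    have := mul_le_mul_of_nonneg_left hG2 (show 0 ≤ G by linarith)
    linarith
  have hfirst : 2 * (c * d * H * √(Real.log (N / α))) * (r / √P * M * T / 2 +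
      (1 / (r / √P) + M * (√(2 * thr) + 1)) * (d * Real.log (1 + P))) ≤
      24 * c * d * H * B * √E * G ^ 2 := by
    calc _ ≤ 2 * (c * d * H * (2 * √G * √E)) * (3 * B * G) := by gcongr
      _ = 12 * c * d * H * B * √E * (√G * G) := by ring
      _ ≤ 12 * c * d * H * B * √E * (2 * G ^ 2) := by gcongr
      _ = _ := by ring
  have hsecond : H * √P * √(Real.log (2 * H / α)) ≤ 8 * d * H * B * √E * G ^ 2 := by
    calc _ ≤ H * B * (2 * √G * √E) := by gcongr
      _ ≤ d * (H * B * (2 * (4 * G ^ 2) * √E)) := by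
        refine le_trans ?_ (le_mul_of_one_le_left (by positivity) hd')
        gcongr
      _ = _ := by ring
  calc _ ≤ H * (24 * c * d * H * B * √E * G ^ 2 + 8 * d * H * B * √E * G ^ 2) := by
        gcongr
    _ = _ := by ring

/-- With few agents relative to the number of episodes, the communication term is dominated. -/
theorem communication_term_le {d M T : ℕ} {thr s₀ : ℝ} (hthr : thr ≤ s₀) (h : d * M ≤ T) :
    (d : ℝ) * (d * M * √(max 1 thr) + √(d * M * T)) ≤
      (√(max 1 s₀) + 1) * ((d : ℝ) ^ (3 / 2 : ℝ) * √(M * T)) := by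
  have h' : (d : ℝ) * M ≤ T := by exact_mod_cast h
  -- The condition `d M ≤ T` enters here, as `(d M)² ≤ d M T`.
  have h1 : (d : ℝ) * M ≤ √(d * M * T) := by
    refine Real.le_sqrt_of_sq_le ?_
    rw [pow_two]
    gcongr
  have h2 : (d : ℝ) ^ (3 / 2 : ℝ) = d * √d := by
    rw [Real.sqrt_eq_rpow, show (3 / 2 : ℝ) = 1 + 1 / 2 by norm_num,
      Real.rpow_add_of_nonneg (by positivity) (by norm_num) (by norm_num), Real.rpow_one]
  have h3 : √((d : ℝ) * M * T) = √d * √(M * T) := by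
    rw [mul_assoc, Real.sqrt_mul (by positivity)]
  calc (d : ℝ) * (d * M * √(max 1 thr) + √(d * M * T)) ≤
      d * (√(d * M * T) * √(max 1 s₀) + √(d * M * T)) := by gcongr
    _ = _ := by rw [h2, h3]; ring

end CoopLSVI

theorem theorem1 :
    ∃ c₀ : ℝ, 0 < c₀ ∧ ∃ p : ℕ, ∀ c : ℝ, c₀ ≤ c → ∃ C : ℝ, ∃ C' : ℝ → ℝ,
      ∀ {S A Ω : Type*} [MeasurableSpace S] [MeasurableSpace A] [MeasurableSingletonClass A]
        [Fintype A] [mΩ : MeasurableSpace Ω] (μ : MeasureTheory.Measure Ω)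
        [MeasureTheory.IsProbabilityMeasure μ]
        (d M H T : ℕ) (_ : 0 < d) (_ : 0 < M) (_ : 0 < H) (_ : 0 < T)
        (α : ℝ) (_ : 0 < α) (_ : α < 1)
        (mdp : CoopLSVI.EpisodicMDP S A H) (φ : S × A → EuclideanSpace ℝ (Fin d))
        (hlin : CoopLSVI.IsLinear mdp φ)
        (thr : ℝ) (_ : 0 ≤ thr)
        (β : ℕ → ℝ)
        (_ : ∀ t < T,
          c₀ * d * H * √(Real.log (2 * d * M * H * ((t : ℝ) + 1) / α)) ≤ β t ∧
          β t ≤ c * d * H * √(Real.log (2 * d * M * H * T / α)))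
        (select : (A → ℝ) → A) (hsel : Measurable select)
        (_ : ∀ (f : A → ℝ) (a : A), f a ≤ f (select f))
        (ℱ : MeasureTheory.Filtration (ℕ ×ₗ ℕ) mΩ) (R : Ω → CoopLSVI.Record S A M)
        (_ : CoopLSVI.IsRun mdp (CoopLSVI.mkInput mdp φ 1 thr (fun t _ _ => β t) select) T μ ℱ R),
        μ {ω | C * (d * H ^ 2 * (d * M * √(max 1 thr) + √(d * M * T)) * √(Real.log (2 / α)))
                * Real.log (2 * d * M * H * T) ^ p
              < CoopLSVI.groupRegret mdp
                  (CoopLSVI.mkInput mdp φ 1 thr (fun t _ _ => β t) select)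
                  hlin.measurable_feature hsel (R ω) T}
          ≤ ENNReal.ofReal α ∧
        ∀ s₀ : ℝ, thr ≤ s₀ → d * M ≤ T →
          μ {ω | C' s₀ * ((d : ℝ) ^ (3 / 2 : ℝ) * H ^ 2 * √(M * T) * √(Real.log (2 / α)))
                  * Real.log (2 * d * M * H * T) ^ p
                < CoopLSVI.groupRegret mdp
                  (CoopLSVI.mkInput mdp φ 1 thr (fun t _ _ => β t) select)
                    hlin.measurable_feature hsel (R ω) T}
            ≤ ENNReal.ofReal α := by
  -- The constant `100` is the one required by `exists_calibrated`, while the exponent `2` and `24 c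
  -- + 8` come from `regret_bound_numerics`; the extra factor in the second constant is that of
  -- `communication_term_le`.
  refine ⟨100, by norm_num, 2, fun c hc => ⟨24 * c + 8,
    fun s => (24 * c + 8) * (√(max 1 s) + 1), ?_⟩⟩
  intro S A Ω _ _ _ _ mΩ μ _ d M H T hd hM hH hT α hα hα1 mdp φ hlin thr hthr β hβ select hsel
    hmax ℱ R hrun
  obtain ⟨ε, hε, hnum⟩ := CoopLSVI.regret_bound_numerics hd hM hH hT hα hα1 hthr
    (show 0 ≤ c by linarith)
  have hmain := hrun.measure_groupRegret_le hd hM hH hT hα hα1 hlin thr (fun t ht => (hβ t ht).1)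
    (fun t ht => (hβ t ht).2) hsel hmax hε
  refine ⟨(MeasureTheory.measure_mono fun ω hω => hnum.trans_lt hω).trans hmain,
    fun s₀ hs hdM => (MeasureTheory.measure_mono fun ω hω =>
      (hnum.trans ?_).trans_lt hω).trans hmain⟩
  have hcomm := CoopLSVI.communication_term_le hs hdM
  refine mul_le_mul_of_nonneg_right ?_ (sq_nonneg _)
  have h := mul_le_mul_of_nonneg_left hcomm
    (show 0 ≤ (24 * c + 8) * ((H : ℝ) ^ 2 * √(Real.log (2 / α))) by positivity)
  linarith
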